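/- Let $\mathbb{T}$ be the triangular lattice with vertex set $\{a+be^{i\pi/3}:a,b\in\mathbb{Z}\}$ and let $\mathbb{H}$ be its dual, the hexagonal lattice, so that the vertices of $\mathbb{T}$ are the (centres of the) faces of $\mathbb{H}$; $\mathsf{0}$ denotes the face centred at the origin. For a non-negative integer $k$, let $\Lambda_k(\mathsf{0})$ be the subgraph of $\mathbb{H}$ induced by all vertices bordering a face in the ball of radius $k$ around $\mathsf{0}$ in $\mathbb{T}$; the faces of $\Lambda_k(\mathsf{0})$ are the faces in this ball. A *loop configuration* is a spanning subgraph $\omega$ of $\mathbb{H}$ in which every vertex has even degree; its connected components are isolated vertices, loops (finite cycles) and bi-infinite paths. It is viewed as an element of $\{0,1\}^{E(\mathbb{H})}$ with the product topology and product $\sigma$-algebra. For $n,x>0$, a finite subgraph $\mathcal{D}$ of $\mathbb{H}$ and a loop configuration $\xi$, let $\mathbb{P}^{\xi}_{\mathcal{D},n,x}$ be the probability measure supported on the (finitely many) loop configurations $\omega$ that coincide with $\xi$ outside $\mathcal{D}$, given by $$\mathbb{P}^{\xi}_{\mathcal{D},n,x}(\omega)=\frac{x^{|\omega|}\,n^{\ell(\omega)}}{Z^{\xi}_{\mathcal{D},n,x}},$$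 where $|\omega|$ is the number of edges of $\omega\cap\mathcal{D}$, $\ell(\omega)$ is the number of loops or bi-infinite paths of $\omega$ intersecting $\mathcal{D}$, and $Z^{\xi}_{\mathcal{D},n,x}$ is the normalizing constant. A probability measure $\mathbb{P}$ on $\{0,1\}^{E(\mathbb{H})}$ is an *(infinite-volume) Gibbs measure* of the loop $O(n)$ model with edge weight $x$ if it is supported on loop configurations and, for every finite subgraph $\mathcal{D}$ of $\mathbb{H}$, the conditional distribution of $\omega$ given its restriction to $\mathcal{D}^c$ is $\mathbb{P}$-almost surely equal to $\mathbb{P}^{\omega}_{\mathcal{D},n,x}$. It is *translation-invariant* if it is invariant under all translations of the plane preserving $\mathbb{H}$. Given loop configurations $\{\xi_k\}$, let $\tilde{\mathbb{P}}^{\,\xi_k}_{k,n,x}$ be the law of $\tau_{\mathbf{f}_k}^{-1}\omega_k$, where $\omega_k$ is sampled from $\mathbb{P}^{\xi_k}_{\Lambda_k(\mathsf{0}),n,x}$, $\mathbf{f}_k$ is an independent uniformly chosen face of $\Lambda_k(\mathsf{0})$, and $\tau_f$ is the translation of $\mathbb{H}$ mapping $\mathsf{0}$ to $f$. **Proposition.**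 For any $(n,x)\in(0,\infty)^2$ and any sequence of loop configurations $\{\xi_k\}$, every subsequential limit (in the sense of weak convergence of probability measures on $\{0,1\}^{E(\mathbb{H})}$) of $\{\tilde{\mathbb{P}}^{\,\xi_k}_{k,n,x}\}$ is a translation-invariant Gibbs measure of the loop $O(n)$ model with edge weight $x$, under which there is almost surely at most one bi-infinite path. -/

import Mathlib

open Filter Topology MeasureTheory ProbabilityTheory
open scoped ENNReal

noncomputable section

namespace LoopON

/-! ### The triangular lattice and the hexagonal lattice

The pair `(a, b)` stands for the point `a + b * exp (i * π / 3)` of the plane. These points are the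
vertices of the triangular lattice, i.e. the (centres of the) faces of the hexagonal lattice. -/

/-- Faces of the hexagonal lattice, i.e. vertices of the triangular lattice. -/
abbrev Face : Type := ℤ × ℤ

/-- The triangular lattice: `f` and `g` are adjacent when `g - f` is one of
`± 1`, `± exp (i * π / 3)`, `± exp (2 * i * π / 3)`. -/
def triLattice : SimpleGraph Face :=
  SimpleGraph.fromRel fun f g => g = f + (1, 0) ∨ g = f + (0, 1) ∨ g = f + (-1, 1)

/-- Vertices of the hexagonal lattice, i.e. triangles of the triangular lattice: `(p, false)` is the
upward triangle with corners `p`, `p + (1, 0)`, `p + (0, 1)`, and `(p, true)` is the downward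
triangle with corners `p + (1, 0)`, `p + (0, 1)`, `p + (1, 1)`. -/
abbrev HexVertex : Type := Face × Bool

/-- The three faces of the hexagonal lattice that a vertex borders. -/
def facesAt : HexVertex → Set Face
  | (p, false) => {p, p + (1, 0), p + (0, 1)}
  | (p, true) => {p + (1, 0), p + (0, 1), p + (1, 1)}

/-- The hexagonal lattice: two triangles are adjacent when they share a side. The upward triangle at
`p` shares a side with the downward triangles at `p`, `p - (1, 0)` and `p - (0, 1)`. -/
def hexLattice : SimpleGraph HexVertex :=
  SimpleGraph.fromRel fun u v =>
    u.2 = false ∧ v.2 = true ∧ (v.1 = u.1 ∨ v.1 = u.1 - (1, 0) ∨ v.1 = u.1 - (0, 1))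

/-- The ball of radius `k` around `f` for the graph distance of the triangular lattice. -/
def faceBall (k : ℕ) (f : Face) : Set Face := {g | triLattice.edist f g ≤ k}

/-- `Λ_k(f)`: the subgraph of the hexagonal lattice induced by all vertices that border a face in
the ball of radius `k` around `f`. -/
def hexBall (k : ℕ) (f : Face) : hexLattice.Subgraph :=
  (⊤ : hexLattice.Subgraph).induce {v | ∃ g ∈ faceBall k f, g ∈ facesAt v}

/-! ### Configurations, loops and bi-infinite paths -/

/-- A spanning subgraph of the hexagonal lattice, given by the indicator function of its edges. The
space `{0, 1} ^ E` carries the product topology and the product σ-algebra. -/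
abbrev Config : Type := hexLattice.edgeSet → Bool

/-- The spanning subgraph encoded by `ω`, as a graph on the vertices of the hexagonal lattice. -/
def toGraph (ω : Config) : SimpleGraph HexVertex :=
  SimpleGraph.fromEdgeSet (Subtype.val '' {e : hexLattice.edgeSet | ω e = true})

/-- A loop configuration: every vertex has even degree. -/
def IsLoopConfig (ω : Config) : Prop :=
  ∀ v, Even ((toGraph ω).neighborSet v).ncard

/-- A loop of `ω`: a connected component which is a cycle, i.e. which is finite and all of whose
vertices have degree two. -/
def IsLoop (ω : Config) (C : (toGraph ω).ConnectedComponent) : Prop :=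
  C.supp.Finite ∧ ∀ v ∈ C.supp, ((toGraph ω).neighborSet v).ncard = 2

/-- A bi-infinite path of `ω`: a connected component which is infinite and all of whose vertices
have degree two. -/
def IsBiInfinitePath (ω : Config) (C : (toGraph ω).ConnectedComponent) : Prop :=
  C.supp.Infinite ∧ ∀ v ∈ C.supp, ((toGraph ω).neighborSet v).ncard = 2

/-! ### The loop O(n) measure in a finite subgraph -/

/-- The number of edges of `ω ∩ D`. -/
def numEdges (D : hexLattice.Subgraph) (ω : Config) : ℕ :=
  {e : hexLattice.edgeSet | (e : Sym2 HexVertex) ∈ D.edgeSet ∧ ω e = true}.ncard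

/-- The number of loops or bi-infinite paths of `ω` that intersect `D`. -/
def numLoops (D : hexLattice.Subgraph) (ω : Config) : ℕ :=
  {C : (toGraph ω).ConnectedComponent |
    (IsLoop ω C ∨ IsBiInfinitePath ω C) ∧ (C.supp ∩ D.verts).Nonempty}.ncard

/-- The loop configurations coinciding with `ξ` outside `D`. -/
def loopConfigs (D : hexLattice.Subgraph) (ξ : Config) : Set Config :=
  {ω | IsLoopConfig ω ∧ ∀ e : hexLattice.edgeSet, (e : Sym2 HexVertex) ∉ D.edgeSet → ω e = ξ e}

/-- The weight `x ^ |ω| * n ^ ℓ(ω)`. -/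
def weight (D : hexLattice.Subgraph) (n x : ℝ) (ω : Config) : ℝ≥0∞ :=
  ENNReal.ofReal (x ^ numEdges D ω * n ^ numLoops D ω)

/-- The normalizing constant. -/
def partitionFn (D : hexLattice.Subgraph) (n x : ℝ) (ξ : Config) : ℝ≥0∞ :=
  ∑' ω : loopConfigs D ξ, weight D n x ω

/-- The loop O(n) measure on `D` with edge weight `x` and boundary conditions `ξ`: each loop
configuration `ω` coinciding with `ξ` outside `D` has mass `x ^ |ω| * n ^ ℓ(ω) / Z`.
(It is a probability measure if `D` is finite, `n, x > 0` and `ξ` is a loop configuration.) -/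
def loopMeasure (D : hexLattice.Subgraph) (n x : ℝ) (ξ : Config) : Measure Config :=
  Measure.sum fun ω : loopConfigs D ξ =>
    (weight D n x ω / partitionFn D n x ξ) • Measure.dirac (ω : Config)

/-! ### Infinite-volume Gibbs measures -/

/-- The σ-algebra generated by the restriction of the configuration to the complement of `D`. -/
abbrev outsideSigma (D : hexLattice.Subgraph) : MeasurableSpace Config :=
  MeasurableSpace.comap
    (fun ω : Config =>
      Set.domRestrict {e : hexLattice.edgeSet | (e : Sym2 HexVertex) ∉ D.edgeSet} ω) inferInstance

/-- Infinite-volume Gibbs measures of the loop O(n) model: `μ` is supported on loop configurations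
and, for every finite subgraph `D`, the conditional distribution of `ω` given its restriction to the
complement of `D` is almost surely the loop O(n) measure on `D` with boundary conditions `ω`. -/
def IsGibbs (n x : ℝ) (μ : Measure Config) : Prop :=
  (∀ᵐ ω ∂μ, IsLoopConfig ω) ∧
    ∀ D : hexLattice.Subgraph, D.verts.Finite → ∀ A : Set Config, MeasurableSet A →
      μ⟦A | outsideSigma D⟧ =ᵐ[μ] fun ω => (loopMeasure D n x ω).real A

/-! ### Translations -/

/-- The translation of the plane by `g`, as an automorphism of the hexagonal lattice. It maps the
face `f` to the face `g + f`, and every translation preserving the lattice is of this form. -/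
def translate (g : Face) : hexLattice ≃g hexLattice where
  toEquiv := (Equiv.addLeft g).prodCongr (Equiv.refl Bool)
  map_rel_iff' := by
    rintro ⟨u, a⟩ ⟨v, b⟩
    simp [hexLattice, add_sub_assoc]

/-- The configuration `ω` translated by `g`: it contains the translate of an edge `e` exactly when
`ω` contains `e`. -/
def shift (g : Face) (ω : Config) : Config := fun e => ω ((translate g).mapEdgeSet.symm e)

/-- Invariance under all translations preserving the lattice. -/
def IsTranslationInvariant (μ : Measure Config) : Prop :=
  ∀ g : Face, μ.map (shift g) = μ

/-! ### The measures seen from a uniformly chosen face -/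

/-- Sample `ω` from the loop O(n) measure on `Λ_k(0)` with boundary conditions `ξ` and,
independently, a uniform face `f` of `Λ_k(0)`, and translate `ω` so that `f` moves to `0`. -/
def recentredMeasure (n x : ℝ) (ξ : Config) (k : ℕ) : Measure Config :=
  ((loopMeasure (hexBall k 0) n x ξ).prod (uniformOn (faceBall k 0))).map
    fun p : Config × Face => shift (-p.2) p.1

/-! ### The measures above are probability measures -/

theorem faceBall_finite (k : ℕ) : (faceBall k 0).Finite := by
  have key : ∀ (f g : Face) (p : triLattice.Walk f g),
      |g.1 - f.1| ≤ p.length ∧ |g.2 - f.2| ≤ p.length := by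
    intro f g p
    induction p with
    | nil => simp
    | @cons a b c h p ih =>
      have h1 : |b.1 - a.1| ≤ 1 ∧ |b.2 - a.2| ≤ 1 := by
        simp only [triLattice, SimpleGraph.fromRel_adj] at h
        rcases h with ⟨-, (h | h | h) | (h | h | h)⟩ <;> subst h <;> simp
      have e1 := abs_add_le (c.1 - b.1) (b.1 - a.1)
      have e2 := abs_add_le (c.2 - b.2) (b.2 - a.2)
      simp only [sub_add_sub_cancel] at e1 e2
      simp only [SimpleGraph.Walk.length_cons]
      push_cast
      exact ⟨by linarith [ih.1, h1.1], by linarith [ih.2, h1.2]⟩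
  refine ((Set.finite_Icc (-(k : ℤ)) k).prod (Set.finite_Icc (-(k : ℤ)) k)).subset ?_
  intro g hg
  have hg' : triLattice.edist 0 g ≤ k := hg
  have hne : triLattice.edist 0 g ≠ ⊤ := fun h => by simp [h] at hg'
  obtain ⟨p, hp⟩ := SimpleGraph.exists_walk_of_edist_ne_top hne
  rw [← hp] at hg'
  have hl : p.length ≤ k := by exact_mod_cast hg'
  obtain ⟨h1, h2⟩ := key _ _ p
  simp only [Prod.fst_zero, Prod.snd_zero, sub_zero] at h1 h2
  have hl' : (p.length : ℤ) ≤ k := by exact_mod_cast hl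
  exact ⟨Set.mem_Icc.2 (abs_le.1 (h1.trans hl')), Set.mem_Icc.2 (abs_le.1 (h2.trans hl'))⟩

theorem faceBall_nonempty (k : ℕ) (f : Face) : (faceBall k f).Nonempty :=
  ⟨f, by simp [faceBall]⟩

theorem hexBall_finite (k : ℕ) : (hexBall k 0).verts.Finite := by
  have h : (hexBall k 0).verts ⊆ ⋃ g ∈ faceBall k 0,
      ((fun q : Face × Bool => (g - q.1, q.2)) ''
        (({0, (1, 0), (0, 1), (1, 1)} : Set Face) ×ˢ (Set.univ : Set Bool))) := by
    rintro ⟨p, b⟩ ⟨g, hg, hv⟩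
    simp only [Set.mem_iUnion]
    refine ⟨g, hg, (g - p, b), ⟨?_, trivial⟩, by simp⟩
    cases b <;> simp only [facesAt, Set.mem_insert_iff, Set.mem_singleton_iff] at hv <;>
      rcases hv with h | h | h <;> simp [h]
  refine Set.Finite.subset ((faceBall_finite k).biUnion fun g _ => Set.Finite.image _ ?_) h
  exact Set.Finite.prod (Set.toFinite _) Set.finite_univ

theorem loopConfigs_finite {D : hexLattice.Subgraph} (hD : D.verts.Finite) (ξ : Config) :
    (loopConfigs D ξ).Finite := by
  have hE : D.edgeSet.Finite := by
    refine Set.Finite.subset (Set.Finite.image (fun p : HexVertex × HexVertex => s(p.1, p.2))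
      (hD.prod hD)) ?_
    intro e
    induction e using Sym2.ind with
    | _ u v =>
      intro h
      exact ⟨(u, v), ⟨D.edge_vert h, D.edge_vert h.symm⟩, rfl⟩
  have hE' : {e : hexLattice.edgeSet | (e : Sym2 HexVertex) ∈ D.edgeSet}.Finite :=
    hE.preimage Subtype.val_injective.injOn
  have : Finite {e : hexLattice.edgeSet | (e : Sym2 HexVertex) ∈ D.edgeSet} := hE'
  refine Set.Finite.of_finite_image (f := fun ω : Config =>
    Set.domRestrict {e : hexLattice.edgeSet | (e : Sym2 HexVertex) ∈ D.edgeSet} ω)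
    (Set.toFinite _) ?_
  intro ω hω ω' hω' h
  funext e
  by_cases he : (e : Sym2 HexVertex) ∈ D.edgeSet
  · exact congrFun h ⟨e, he⟩
  · rw [hω.2 e he, hω'.2 e he]

theorem isProbabilityMeasure_loopMeasure {D : hexLattice.Subgraph} (hD : D.verts.Finite)
    {n x : ℝ} (hn : 0 < n) (hx : 0 < x) {ξ : Config} (hξ : IsLoopConfig ξ) :
    IsProbabilityMeasure (loopMeasure D n x ξ) := by
  have : Finite (loopConfigs D ξ) := loopConfigs_finite hD ξ
  have : Fintype (loopConfigs D ξ) := Fintype.ofFinite _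
  have h0 : partitionFn D n x ξ ≠ 0 := by
    intro h
    have h' := ENNReal.tsum_eq_zero.1 h ⟨ξ, hξ, fun _ _ => rfl⟩
    rw [weight, ENNReal.ofReal_eq_zero] at h'
    exact absurd h' (not_le.2 (by positivity))
  have ht : partitionFn D n x ξ ≠ ⊤ := by
    rw [partitionFn, tsum_fintype]
    exact ENNReal.sum_ne_top.2 fun _ _ => ENNReal.ofReal_ne_top
  constructor
  rw [loopMeasure, Measure.sum_apply _ MeasurableSet.univ]
  simp only [Measure.smul_apply, measure_univ, smul_eq_mul, mul_one, div_eq_mul_inv]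
  rw [ENNReal.tsum_mul_right]
  exact ENNReal.mul_inv_cancel h0 ht

theorem measurable_shift (g : Face) : Measurable (shift g) :=
  measurable_pi_lambda _ fun _ => measurable_pi_apply _

theorem measurable_recentring :
    Measurable fun p : Config × Face => shift (-p.2) p.1 :=
  measurable_from_prod_countable_left fun f => measurable_shift (-f)

theorem isProbabilityMeasure_recentredMeasure {n x : ℝ} (hn : 0 < n) (hx : 0 < x)
    {ξ : Config} (hξ : IsLoopConfig ξ) (k : ℕ) :
    IsProbabilityMeasure (recentredMeasure n x ξ k) := by
  have := isProbabilityMeasure_loopMeasure (hexBall_finite k) hn hx hξ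
  have := isProbabilityMeasure_uniformOn (faceBall_finite k) (faceBall_nonempty k 0)
  exact Measure.isProbabilityMeasure_map measurable_recentring.aemeasurable

/-- `recentredMeasure`, bundled as a probability measure, so that the topology of weak convergence
(equivalently here, convergence of the probabilities of events depending on finitely many edges)
is available. -/
def recentredLaw {n x : ℝ} (hn : 0 < n) (hx : 0 < x) {ξ : Config} (hξ : IsLoopConfig ξ) (k : ℕ) :
    ProbabilityMeasure Config :=
  ⟨recentredMeasure n x ξ k, isProbabilityMeasure_recentredMeasure hn hx hξ k⟩

end LoopON

end

open scoped symmDiff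

noncomputable section

namespace LoopON

/-! ### Site graphs and the counting of trifurcations -/

/-! Seen from a uniform face of a large ball, a fixed finite subgraph `D` lies inside the ball
except with probability of order perimeter over area. So the recentred law is, up to a vanishing
error, a sum of atoms whose masses obey the ratios prescribed by the weights in `D`
(`exists_specified_decomposition`), and a translation changes its probabilities by a vanishing
amount (`recentredMeasure_shift_le`). Translation invariance of the limit follows at once. The Gibbs
property does not: the number of loops is not a continuous function of the configuration, because
two long strands through `D` may be joined arbitrarily far away. It is continuous, among loop
configurations, at those with at most one bi-infinite path (`eventually_sameStrand_iff`), so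
uniqueness of the path has to be proved first, without the Gibbs property.

Uniqueness rests on a bound that needs no continuity. The exponents of the weight are bounded in
terms of `D`, so toggling a fixed loop configuration supported in `D` distorts probabilities by a
bounded factor, uniformly in the ball and the boundary condition; this passes to the limit
(`xorConfig_tolerant_of_tendsto`). A loop configuration is the set of domain walls of a spin
configuration on the faces, unique up to global reversal. Choosing the spin at the origin uniformly
gives a translation-invariant law that tolerates spin flips, and the Burton–Keane argument leaves at
most one infinite cluster of each spin (`inDistinct_null`). A bi-infinite path borders infinite
clusters of both spins, so two such paths would separate the same two clusters. The spin
configuration whose only wall is the first path is constant on clusters and changes across the first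
path but not across the second, a contradiction (`subsingleton_biInfinite`).

For the Gibbs property, let `κ` be a loop configuration supported in `D`. The measure `μ`, weighted
by the weight of `κ ∆ ω`, is invariant under `ω ↦ κ ∆ ω`: this holds up to a vanishing error before
the limit, and passes to it since the weight is almost surely continuous
(`setLIntegral_loopWeight_of_tendsto`). Dividing by the partition function and summing over `κ`
yields the integrated form of the conditional distribution (`setLIntegral_loopMeasure_of_tendsto`).
-/

/-- The edges of `G` with both endpoints in `X`. -/
def siteGraph {V : Type*} (G : SimpleGraph V) (X : Set V) : SimpleGraph V where
  Adj u v := G.Adj u v ∧ u ∈ X ∧ v ∈ X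
  symm := ⟨fun _ _ h => ⟨h.1.symm, h.2.2, h.2.1⟩⟩
  loopless := ⟨fun _ h => h.1.ne rfl⟩

theorem siteGraph_mono {V : Type*} (G : SimpleGraph V) {X X' : Set V} (h : X ⊆ X') :
    siteGraph G X ≤ siteGraph G X' :=
  fun _ _ hu => ⟨hu.1, h hu.2.1, h hu.2.2⟩

theorem exists_first_hit {V : Type*} {G : SimpleGraph V} {X : Set V} {u v : V}
    (h : (siteGraph G X).Reachable u v) (S : Set V) (hu : u ∉ S) (hv : v ∈ S) :
    ∃ c d, (siteGraph G (X \ S)).Reachable u c ∧ c ∉ S ∧ (siteGraph G X).Adj c d ∧ d ∈ S := by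
  obtain ⟨p⟩ := h
  induction p with
  | nil => exact absurd hv hu
  | @cons a b c h _ ih =>
    by_cases hb : b ∈ S
    · exact ⟨a, b, .refl _, hu, h, hb⟩
    · obtain ⟨c, d, h1, h2⟩ := ih hb hv
      have : (siteGraph G (X \ S)).Adj a b := ⟨h.1, ⟨h.2.1, hu⟩, ⟨h.2.2, hb⟩⟩
      exact ⟨c, d, this.reachable.trans h1, h2⟩

theorem reachable_siteGraph_sdiff {V : Type*} {G : SimpleGraph V} {X X' : Set V} {u v : V}
    (h : (siteGraph G X).Reachable u v) (hX : ∀ w, (siteGraph G X).Reachable u w → w ∈ X → w ∈ X') :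
    (siteGraph G X').Reachable u v := by
  obtain ⟨p⟩ := h
  induction p with
  | nil => exact .refl _
  | @cons a b c h _ ih =>
    have : (siteGraph G X').Adj a b := ⟨h.1, hX _ (.refl _) h.2.1, hX _ h.reachable h.2.2⟩
    exact this.reachable.trans (ih fun w hw => hX w (h.reachable.trans hw))

/-- To each `i` belongs a Haar-type function on `Y`: the normalised indicator of `A i false` minus
that of `A i true`. It has sum zero. By `hl`, of any two such functions one is constant on the set
carrying the other, so they are orthogonal, and there are at most `dim ℝ^Y` of them. -/
theorem card_le_of_haar {ι Y : Type*} [Fintype ι] [Fintype Y] (A : ι → Bool → Set Y)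
    (hne : ∀ i e, (A i e).Nonempty) (hd : ∀ i, Disjoint (A i false) (A i true))
    (hl : ∀ i j, i ≠ j →
      (∀ y ∈ A i false ∪ A i true, ∀ y' ∈ A i false ∪ A i true, ∀ e, y ∈ A j e ↔ y' ∈ A j e) ∨
      (∀ y ∈ A j false ∪ A j true, ∀ y' ∈ A j false ∪ A j true, ∀ e, y ∈ A i e ↔ y' ∈ A i e)) :
    Fintype.card ι ≤ Fintype.card Y := by
  classical
  let m : ι → Bool → ℝ := fun i e => ∑ y, if y ∈ A i e then (1 : ℝ) else 0
  have hm : ∀ i e, 0 < m i e := fun i e => by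
    obtain ⟨y, hy⟩ := hne i e
    refine Finset.sum_pos' (fun y _ => by split_ifs <;> simp) ⟨y, Finset.mem_univ _, by simp [hy]⟩
  let w : ι → Y → ℝ := fun i y => (if y ∈ A i false then 1 else 0) / m i false -
    (if y ∈ A i true then 1 else 0) / m i true
  have hsum : ∀ i, ∑ y, w i y = 0 := fun i => by
    simp only [w, Finset.sum_sub_distrib, ← Finset.sum_div]
    rw [div_self (hm i false).ne', div_self (hm i true).ne', sub_self]
  have key : ∀ i j, (∀ y ∈ A i false ∪ A i true, ∀ y' ∈ A i false ∪ A i true, ∀ e,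
      y ∈ A j e ↔ y' ∈ A j e) → ∑ y, w i y * w j y = 0 := by
    intro i j h
    obtain ⟨y0, hy0⟩ := hne i false
    have : ∀ y, w i y * w j y = w i y * w j y0 := by
      intro y
      by_cases hy : y ∈ A i false ∪ A i true
      · have := h y hy y0 (Or.inl hy0)
        simp only [w, this]
      · rw [Set.mem_union, not_or] at hy
        simp [w, hy.1, hy.2]
    rw [Finset.sum_congr rfl fun y _ => this y, ← Finset.sum_mul, hsum, zero_mul]
  let v : ι → EuclideanSpace ℝ Y := fun i => WithLp.toLp 2 (w i)
  have hli : LinearIndependent ℝ v := by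
    refine linearIndependent_of_ne_zero_of_inner_eq_zero (𝕜 := ℝ) (fun i h0 => ?_) fun i j hij => ?_
    · obtain ⟨y, hy⟩ := hne i false
      have h1 : w i y = 0 := congrArg (fun z : EuclideanSpace ℝ Y => z y) h0
      have h2 : y ∉ A i true := Set.disjoint_left.1 (hd i) hy
      simp only [w, hy, h2, if_true, if_false, zero_div, sub_zero, one_div, inv_eq_zero] at h1
      exact (hm i false).ne' h1
    · simp only [v, PiLp.inner_apply, RCLike.inner_apply, conj_trivial]
      rcases hl i j hij with h | h
      · rw [← key i j h]
        exact Finset.sum_congr rfl fun y _ => mul_comm _ _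
      · exact key j i h
  simpa using hli.fintype_card_le_finrank

/-- The sets fed to `card_le_of_haar` are the points of `Y` reached by the branches `z i e` off `box
i`. The root `r i`, common to all boxes of a cluster, orients that cluster: both branches point away
from it, so two boxes are either nested or unrelated. -/
theorem card_le_of_separation {V ι : Type*} [Fintype ι] (G : SimpleGraph V) (X : Set V)
    (box : ι → Set V) (hdisj : ∀ i j, i ≠ j → Disjoint (box i) (box j)) (hX : ∀ i, box i ⊆ X)
    (hconn : ∀ i, ∀ a ∈ box i, ∀ b ∈ box i, (siteGraph G (box i)).Reachable a b)
    (Y : Finset V) (hY : ∀ i, ∀ y ∈ Y, y ∉ box i)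
    (z : ι → Bool → V) (r : ι → V) (hz : ∀ i e, z i e ∈ X \ box i)
    (hadj : ∀ i e, ∃ b ∈ box i, G.Adj (z i e) b)
    (hsep : ∀ i, ¬(siteGraph G (X \ box i)).Reachable (z i false) (z i true))
    (hreach : ∀ i e, ∃ y ∈ Y, (siteGraph G (X \ box i)).Reachable (z i e) y)
    (hrY : ∀ i, r i ∈ Y) (hrX : ∀ i e, (siteGraph G X).Reachable (z i e) (r i))
    (hr : ∀ i e, ¬(siteGraph G (X \ box i)).Reachable (z i e) (r i))
    (hrr : ∀ i j, (siteGraph G X).Reachable (r i) (r j) → r i = r j) :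
    Fintype.card ι ≤ Y.card := by
  classical
  have hsub : ∀ i j, i ≠ j → box i ⊆ X \ box j := fun i j hij b hb =>
    ⟨hX i hb, Set.disjoint_left.1 (hdisj i j hij) hb⟩
  -- If no branch at `i` meets `box j`, these branches together with `box i` form one connected
  -- piece off `box j`, so no branch at `j` can tell their points apart.
  have K1 : ∀ i j, i ≠ j → (∀ e, ∀ b ∈ box j, ¬(siteGraph G (X \ box i)).Reachable (z i e) b) →
      ∀ e e' y y', (siteGraph G (X \ box i)).Reachable (z i e) y →
      (siteGraph G (X \ box i)).Reachable (z i e') y' →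
      (siteGraph G (X \ box j)).Reachable y y' := by
    intro i j hij h
    have h1 : ∀ e y, (siteGraph G (X \ box i)).Reachable (z i e) y →
        (siteGraph G (X \ box j)).Reachable (z i e) y := fun e y hy =>
      reachable_siteGraph_sdiff hy fun w hw hwX => ⟨hwX.1, fun hwj => h e w hwj hw⟩
    have h2 : ∀ e, ∃ b ∈ box i, (siteGraph G (X \ box j)).Reachable (z i e) b := fun e => by
      obtain ⟨b, hb, hb'⟩ := hadj i e
      refine ⟨b, hb, SimpleGraph.Adj.reachable ⟨hb', ⟨(hz i e).1, fun hj => h e _ hj (.refl _)⟩, ?_⟩⟩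
      exact hsub i j hij hb
    intro e e' y y' hy hy'
    obtain ⟨b, hb, hb'⟩ := h2 e
    obtain ⟨c, hc, hc'⟩ := h2 e'
    have h3 := (hconn i b hb c hc).mono (siteGraph_mono G (hsub i j hij))
    exact (h1 e y hy).symm.trans (hb'.trans (h3.trans (hc'.symm.trans (h1 e' y' hy'))))
  -- Branches at `i` and at `j` cannot reach each other's boxes. Starting from the common root, one
  -- of the two boxes is met first; that box is then joined to the root off the other box, and so is
  -- the branch of the other box that reaches it, contrary to `hr`.
  have K2 : ∀ i j, i ≠ j → ∀ e, ∀ b ∈ box j, (siteGraph G (X \ box i)).Reachable (z i e) b →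
      ∀ e', ∀ b' ∈ box i, (siteGraph G (X \ box j)).Reachable (z j e') b' → False := by
    intro i j hij e b hb hib e' b' hb' hjb
    have m1 : ∀ i, siteGraph G (X \ box i) ≤ siteGraph G X :=
      fun i => siteGraph_mono G Set.sdiff_subset
    have h1 : (siteGraph G X).Reachable (r i) b := (hrX i e).symm.trans (hib.mono (m1 i))
    have h2 : (siteGraph G X).Reachable (z j e') b := by
      obtain ⟨c, hc, hc'⟩ := hadj j e'
      have h3 : (siteGraph G X).Adj (z j e') c := ⟨hc', (hz j e').1, hX j hc⟩
      exact h3.reachable.trans ((hconn j c hc b hb).mono (siteGraph_mono G (hX j)))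
    have h3 : r i = r j := hrr i j (h1.trans (h2.symm.trans (hrX j e')))
    obtain ⟨c, d, hc, hcn, hcd, hd⟩ := exists_first_hit h1 (box i ∪ box j)
      (fun h => h.elim (hY i _ (hrY i)) (hY j _ (hrY i))) (Or.inr hb)
    rw [Set.mem_union, not_or] at hcn
    rcases hd with hd | hd
    · have h4 : (siteGraph G (X \ box j)).Adj c d :=
        ⟨hcd.1, ⟨hcd.2.1, hcn.2⟩, hsub i j hij hd⟩
      have h5 := (hconn i d hd b' hb').mono (siteGraph_mono G (hsub i j hij))
      have h6 := hc.mono (siteGraph_mono G (Set.sdiff_subset_sdiff_right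
        (Set.subset_union_right (s := box i) (t := box j))))
      refine hr j e' (hjb.trans ?_)
      rw [← h3]
      exact (h6.trans (h4.reachable.trans h5)).symm
    · have h4 : (siteGraph G (X \ box i)).Adj c d :=
        ⟨hcd.1, ⟨hcd.2.1, hcn.1⟩, hsub j i hij.symm hd⟩
      have h5 := (hconn j d hd b hb).mono (siteGraph_mono G (hsub j i hij.symm))
      have h6 := hc.mono (siteGraph_mono G (Set.sdiff_subset_sdiff_right
        (Set.subset_union_left (s := box i) (t := box j))))
      exact hr i e (hib.trans (h6.trans (h4.reachable.trans h5)).symm)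
  have := card_le_of_haar (ι := ι) (Y := Y)
    (fun i e => {y | (siteGraph G (X \ box i)).Reachable (z i e) y}) ?_ ?_ ?_
  · simpa using this
  · intro i e
    obtain ⟨y, hy, h⟩ := hreach i e
    exact ⟨⟨y, hy⟩, h⟩
  · intro i
    rw [Set.disjoint_left]
    intro y h1 h2
    exact hsep i (h1.trans h2.symm)
  · have K3 : ∀ i j, i ≠ j →
        (∀ e, ∀ b ∈ box j, ¬(siteGraph G (X \ box i)).Reachable (z i e) b) →
        ∀ y ∈ {y : Y | (siteGraph G (X \ box i)).Reachable (z i false) y} ∪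
          {y : Y | (siteGraph G (X \ box i)).Reachable (z i true) y},
        ∀ y' ∈ {y : Y | (siteGraph G (X \ box i)).Reachable (z i false) y} ∪
          {y : Y | (siteGraph G (X \ box i)).Reachable (z i true) y}, ∀ e,
        y ∈ {y : Y | (siteGraph G (X \ box j)).Reachable (z j e) y} ↔
        y' ∈ {y : Y | (siteGraph G (X \ box j)).Reachable (z j e) y} := by
      intro i j hij h y hy y' hy' e
      have h1 : (siteGraph G (X \ box j)).Reachable y y' := by
        rcases hy with hy | hy <;> rcases hy' with hy' | hy' <;> exact K1 i j hij h _ _ _ _ hy hy'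
      exact ⟨fun h => h.trans h1, fun h => h.trans h1.symm⟩
    intro i j hij
    by_cases h : ∀ e, ∀ b ∈ box j, ¬(siteGraph G (X \ box i)).Reachable (z i e) b
    · exact Or.inl (K3 i j hij h)
    · push Not at h
      obtain ⟨e, b, hb, hb'⟩ := h
      exact Or.inr (K3 j i hij.symm fun e' b' h1 h2 => K2 i j hij e b hb hb' e' b' h1 h2)

/-- A root in `Y` is fixed for each cluster meeting `Y`. At most one of the three branches at a box
contains the root, so two branches satisfy the hypotheses of `card_le_of_separation`. -/
theorem card_le_of_trifurcations {V ι : Type*} [Fintype ι] (G : SimpleGraph V) (X : Set V)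
    (box : ι → Set V) (hdisj : ∀ i j, i ≠ j → Disjoint (box i) (box j)) (hX : ∀ i, box i ⊆ X)
    (hconn : ∀ i, ∀ a ∈ box i, ∀ b ∈ box i, (siteGraph G (box i)).Reachable a b)
    (Y : Finset V) (hY : ∀ i, ∀ y ∈ Y, y ∉ box i)
    (u : ι → Fin 3 → V) (hu : ∀ i e, u i e ∈ X \ box i)
    (hadj : ∀ i e, ∃ b ∈ box i, G.Adj (u i e) b)
    (hsep : ∀ i a b, a ≠ b → ¬(siteGraph G (X \ box i)).Reachable (u i a) (u i b))
    (hreach : ∀ i e, ∃ y ∈ Y, (siteGraph G (X \ box i)).Reachable (u i e) y) :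
    Fintype.card ι ≤ Y.card := by
  classical
  have m1 : ∀ i, siteGraph G (X \ box i) ≤ siteGraph G X :=
    fun i => siteGraph_mono G Set.sdiff_subset
  -- The root depends on the component only, which makes it shared between boxes; components missing
  -- `Y` get an arbitrary vertex.
  have hroot : ∀ c : (siteGraph G X).ConnectedComponent, ∃ r,
      (∃ y ∈ Y, (siteGraph G X).connectedComponentMk y = c) →
        r ∈ Y ∧ (siteGraph G X).connectedComponentMk r = c := by
    intro c
    by_cases h : ∃ y ∈ Y, (siteGraph G X).connectedComponentMk y = c
    · exact ⟨h.choose, fun _ => h.choose_spec⟩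
    · obtain ⟨v, -⟩ := c.exists_rep
      exact ⟨v, fun h' => absurd h' h⟩
  choose root hroot using hroot
  let r : ι → V := fun i => root ((siteGraph G X).connectedComponentMk (u i 0))
  have hr0 : ∀ i, r i ∈ Y ∧ (siteGraph G X).connectedComponentMk (r i) =
      (siteGraph G X).connectedComponentMk (u i 0) := fun i => by
    refine hroot _ ?_
    obtain ⟨y, hy, h⟩ := hreach i 0
    exact ⟨y, hy, (SimpleGraph.ConnectedComponent.eq.2 (h.mono (m1 i))).symm⟩
  have hsame : ∀ i a, (siteGraph G X).Reachable (u i a) (u i 0) := fun i a => by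
    obtain ⟨b, hb, hab⟩ := hadj i a
    obtain ⟨c, hc, hac⟩ := hadj i 0
    have h1 : (siteGraph G X).Adj (u i a) b := ⟨hab, (hu i a).1, hX i hb⟩
    have h2 : (siteGraph G X).Adj (u i 0) c := ⟨hac, (hu i 0).1, hX i hc⟩
    exact h1.reachable.trans (((hconn i b hb c hc).mono (siteGraph_mono G (hX i))).trans
      h2.reachable.symm)
  have hpick : ∀ i, ∃ a b : Fin 3, a ≠ b ∧
      ¬(siteGraph G (X \ box i)).Reachable (u i a) (r i) ∧
      ¬(siteGraph G (X \ box i)).Reachable (u i b) (r i) := by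
    intro i
    have h : ∀ a b, a ≠ b → (siteGraph G (X \ box i)).Reachable (u i a) (r i) →
        ¬(siteGraph G (X \ box i)).Reachable (u i b) (r i) :=
      fun a b hab h1 h2 => hsep i a b hab (h1.trans h2.symm)
    by_cases h0 : (siteGraph G (X \ box i)).Reachable (u i 0) (r i)
    · exact ⟨1, 2, by decide, h 0 1 (by decide) h0, h 0 2 (by decide) h0⟩
    · by_cases h1 : (siteGraph G (X \ box i)).Reachable (u i 1) (r i)
      · exact ⟨0, 2, by decide, h0, h 1 2 (by decide) h1⟩
      · exact ⟨0, 1, by decide, h0, h1⟩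
  choose a b hab ha hb using hpick
  refine card_le_of_separation G X box hdisj hX hconn Y hY
    (fun i e => u i (if e then b i else a i)) r (fun i e => hu i _) (fun i e => hadj i _)
    (fun i => by simpa using hsep i _ _ (hab i)) (fun i e => hreach i _) (fun i => (hr0 i).1) ?_ ?_ ?_
  · intro i e
    exact (hsame i _).trans (SimpleGraph.ConnectedComponent.eq.1 (hr0 i).2).symm
  · intro i e
    cases e
    · simpa using ha i
    · simpa using hb i
  · intro i j h
    have h1 : (siteGraph G X).connectedComponentMk (u i 0) =
        (siteGraph G X).connectedComponentMk (u j 0) := by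
      rw [← (hr0 i).2, ← (hr0 j).2]
      exact SimpleGraph.ConnectedComponent.eq.2 h
    simp only [r, h1]

/-! ### Measurability of connection events -/

/-- A connection is witnessed by a finite walk, and each of its edges persists under small
perturbations. Disconnection is not open in general, which is the source of all later continuity
problems. -/
theorem isOpen_reachable {Ω V : Type*} [TopologicalSpace Ω] (H : Ω → SimpleGraph V)
    (hH : ∀ a b, IsOpen {ω | (H ω).Adj a b}) (u v : V) : IsOpen {ω | (H ω).Reachable u v} := by
  rw [isOpen_iff_mem_nhds]
  rintro ω ⟨p⟩
  change ∀ᶠ ω' in 𝓝 ω, (H ω').Reachable _ _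
  induction p with
  | nil => exact Eventually.of_forall fun _ => .refl _
  | @cons a b c h _ ih =>
    filter_upwards [(hH a b).mem_nhds h, ih] with ω' h1 h2
    exact SimpleGraph.Adj.reachable h1 |>.trans h2

theorem measurableSet_infinite {Ω V : Type*} [MeasurableSpace Ω] [Countable V] (P : Ω → V → Prop)
    (hP : ∀ v, MeasurableSet {ω | P ω v}) : MeasurableSet {ω | {v | P ω v}.Infinite} := by
  have : {ω | {v | P ω v}.Infinite} = ⋂ s : Finset V, ⋃ v : V, {ω | v ∉ s ∧ P ω v} := by
    ext ω
    simp only [Set.mem_ofPred_eq, Set.mem_iInter, Set.mem_iUnion]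
    constructor
    · intro h s
      obtain ⟨v, hv, hvs⟩ := h.exists_notMem_finset s
      exact ⟨v, hvs, hv⟩
    · intro h hfin
      obtain ⟨v, hv, hv'⟩ := h hfin.toFinset
      exact hv (by simpa using hv')
  rw [this]
  refine MeasurableSet.iInter fun s => MeasurableSet.iUnion fun v => ?_
  by_cases hv : v ∈ s
  · simp [hv]
  · simpa [hv] using hP v

/-! ### Spin configurations -/

/-- Spin configurations on the faces. -/
abbrev Spin : Type := Face → Bool

/-- The faces with spin `true`. -/
def occ (σ : Spin) : Set Face := {f | σ f = true}

/-- The translate of a spin configuration. -/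
def shiftSpin (g : Face) (σ : Spin) : Spin := fun f => σ (f - g)

/-- Reversing the spin at one face. -/
def flipSpin (f : Face) (σ : Spin) : Spin := Function.update σ f (!σ f)

/-- Setting all spins in `B` to `true`. -/
def fill (B : Finset Face) (σ : Spin) : Spin := fun f => if f ∈ B then true else σ f

/-- The face `u` lies in an infinite cluster of faces of spin `true`. -/
def InInfCluster (σ : Spin) (u : Face) : Prop :=
  {v | (siteGraph triLattice (occ σ)).Reachable u v}.Infinite

/-- `u` and `v` lie in distinct infinite clusters. -/
def InDistinct (σ : Spin) (u v : Face) : Prop :=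
  InInfCluster σ u ∧ InInfCluster σ v ∧ ¬(siteGraph triLattice (occ σ)).Reachable u v

theorem measurable_shiftSpin (g : Face) : Measurable (shiftSpin g) :=
  measurable_pi_lambda _ fun _ => measurable_pi_apply _

theorem measurable_flipSpin (f : Face) : Measurable (flipSpin f) := by
  refine measurable_pi_lambda _ fun g => ?_
  by_cases h : g = f
  · subst h
    simp only [flipSpin, Function.update_self]
    exact (measurable_from_top (f := Bool.not)).comp (measurable_pi_apply _)
  · simp only [flipSpin, Function.update_of_ne h]
    exact measurable_pi_apply _

theorem measurableSet_reachable_site (B : Set Face) (u v : Face) :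
    MeasurableSet {σ : Spin | (siteGraph triLattice (occ σ \ B)).Reachable u v} := by
  refine (isOpen_reachable _ (fun a b => ?_) u v).measurableSet
  have h : ∀ f : Face, IsOpen {σ : Spin | σ f = true} := fun f => by
    have : {σ : Spin | σ f = true} = (fun σ => σ f) ⁻¹' {true} := rfl
    rw [this]
    exact (isOpen_discrete {true}).preimage (continuous_apply f)
  simp only [siteGraph, occ, Set.mem_sdiff, Set.mem_ofPred_eq]
  exact isOpen_const.and (((h a).and isOpen_const).and ((h b).and isOpen_const))

theorem measurableSet_inInfCluster (B : Set Face) (u : Face) : MeasurableSet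
    {σ : Spin | {v | (siteGraph triLattice (occ σ \ B)).Reachable u v}.Infinite} :=
  measurableSet_infinite _ fun v => measurableSet_reachable_site B u v

theorem measurableSet_inDistinct (u v : Face) : MeasurableSet {σ : Spin | InDistinct σ u v} := by
  have h1 := fun u => measurableSet_inInfCluster ∅ u
  have h2 := measurableSet_reachable_site ∅ u v
  simp only [Set.sdiff_empty] at h1 h2
  exact (h1 u).inter ((h1 v).inter h2.compl)

theorem triLattice_adj_add (g a b : Face) (h : triLattice.Adj a b) :
    triLattice.Adj (a + g) (b + g) := by
  simp only [triLattice, SimpleGraph.fromRel_adj] at h ⊢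
  refine ⟨fun h' => h.1 (add_right_cancel h'), ?_⟩
  rcases h.2 with (h | h | h) | (h | h | h) <;> subst h <;> simp [add_right_comm]

theorem reachable_site_shift (σ : Spin) (B B' : Set Face) (g u v : Face)
    (hB : ∀ f, f + g ∈ B' → f ∈ B)
    (h : (siteGraph triLattice (occ σ \ B)).Reachable u v) :
    (siteGraph triLattice (occ (shiftSpin g σ) \ B')).Reachable (u + g) (v + g) := by
  let φ : siteGraph triLattice (occ σ \ B) →g
      siteGraph triLattice (occ (shiftSpin g σ) \ B') := ⟨fun f => f + g, fun {a b} hab =>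
    ⟨triLattice_adj_add g a b hab.1, ⟨?_, ?_⟩, ⟨?_, ?_⟩⟩⟩
  · exact h.map φ
  · simpa [occ, shiftSpin] using hab.2.1.1
  · exact fun h => hab.2.1.2 (hB _ h)
  · simpa [occ, shiftSpin] using hab.2.2.1
  · exact fun h => hab.2.2.2 (hB _ h)

theorem shiftSpin_neg (g : Face) (σ : Spin) : shiftSpin (-g) (shiftSpin g σ) = σ := by
  funext f
  simp [shiftSpin]

theorem reachable_site_shift_iff (σ : Spin) (B B' : Set Face) (g u v : Face)
    (hB : ∀ f, f + g ∈ B' ↔ f ∈ B) :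
    (siteGraph triLattice (occ (shiftSpin g σ) \ B')).Reachable (u + g) (v + g) ↔
    (siteGraph triLattice (occ σ \ B)).Reachable u v := by
  refine ⟨fun h => ?_, reachable_site_shift σ B B' g u v fun f => (hB f).1⟩
  have := reachable_site_shift _ B' B (-g) _ _ (fun f hf => ?_) h
  · simpa [shiftSpin_neg] using this
  · simpa using (hB _).2 hf

theorem infinite_site_shift (σ : Spin) (B B' : Set Face) (g u : Face)
    (hB : ∀ f, f + g ∈ B' ↔ f ∈ B)
    (h : {v | (siteGraph triLattice (occ σ \ B)).Reachable u v}.Infinite) :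
    {v | (siteGraph triLattice (occ (shiftSpin g σ) \ B')).Reachable (u + g) v}.Infinite := by
  refine (h.image (f := fun v => v + g) (add_left_injective g).injOn).mono ?_
  rintro _ ⟨v, hv, rfl⟩
  exact (reachable_site_shift_iff σ B B' g u v hB).2 hv

theorem inDistinct_shift (σ : Spin) (g u v : Face) (h : InDistinct σ u v) :
    InDistinct (shiftSpin g σ) (u + g) (v + g) := by
  have h1 := fun u => infinite_site_shift σ ∅ ∅ g u (by simp)
  have h2 := reachable_site_shift_iff σ ∅ ∅ g u v (by simp)
  simp only [Set.sdiff_empty] at h1 h2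
  exact ⟨h1 u h.1, h1 v h.2.1, fun h' => h.2.2 (h2.1 h')⟩

/-! ### Boxes of faces -/

/-- The square box of radius `R` around `g`. -/
def sqBox (R : ℕ) (g : Face) : Finset Face :=
  Finset.Icc (g.1 - R) (g.1 + R) ×ˢ Finset.Icc (g.2 - R) (g.2 + R)

theorem mem_sqBox {R : ℕ} {g f : Face} : f ∈ sqBox R g ↔
    (g.1 - R ≤ f.1 ∧ f.1 ≤ g.1 + R) ∧ (g.2 - R ≤ f.2 ∧ f.2 ≤ g.2 + R) := by
  simp [sqBox]

theorem abs_le_of_triLattice_adj {a b : Face} (h : triLattice.Adj a b) :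
    (a.1 ≤ b.1 + 1 ∧ b.1 ≤ a.1 + 1) ∧ (a.2 ≤ b.2 + 1 ∧ b.2 ≤ a.2 + 1) := by
  simp only [triLattice, SimpleGraph.fromRel_adj] at h
  rcases h.2 with (h | h | h) | (h | h | h) <;> subst h <;> simp <;> omega

theorem reachable_row {S : Set Face} {x y c : ℤ} (hxy : x ≤ y)
    (h : ∀ t, x ≤ t → t ≤ y → (t, c) ∈ S) : (siteGraph triLattice S).Reachable (x, c) (y, c) := by
  induction y, hxy using Int.leInduction with
  | base => exact .refl _
  | succ y hy ih =>
    refine (ih fun t h1 h2 => h t h1 (by omega)).trans (SimpleGraph.Adj.reachable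
      ⟨?_, h _ hy (by omega), h _ (by omega) le_rfl⟩)
    simp [triLattice]

theorem reachable_column {S : Set Face} {x y c : ℤ} (hxy : x ≤ y)
    (h : ∀ t, x ≤ t → t ≤ y → (c, t) ∈ S) : (siteGraph triLattice S).Reachable (c, x) (c, y) := by
  induction y, hxy using Int.leInduction with
  | base => exact .refl _
  | succ y hy ih =>
    refine (ih fun t h1 h2 => h t h1 (by omega)).trans (SimpleGraph.Adj.reachable
      ⟨?_, h _ hy (by omega), h _ (by omega) le_rfl⟩)
    simp [triLattice]

theorem reachable_sqBox (R : ℕ) (g : Face) : ∀ a ∈ (sqBox R g : Set Face),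
    ∀ b ∈ (sqBox R g : Set Face), (siteGraph triLattice (sqBox R g : Set Face)).Reachable a b := by
  have h : ∀ a ∈ (sqBox R g : Set Face), (siteGraph triLattice (sqBox R g : Set Face)).Reachable
      (g.1 - R, g.2 - R) a := by
    rintro ⟨a, b⟩ h
    rw [Finset.mem_coe, mem_sqBox] at h
    refine (reachable_row (y := a) h.1.1 fun t h1 h2 => ?_).trans
      (reachable_column h.2.1 fun t h1 h2 => ?_)
    · rw [Finset.mem_coe, mem_sqBox]
      dsimp only at *
      omega
    · rw [Finset.mem_coe, mem_sqBox]
      dsimp only at *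
      omega
  exact fun a ha b hb => (h a ha).symm.trans (h b hb)

theorem finite_adj_sqBox (R : ℕ) (g : Face) :
    {u : Face | ∃ b ∈ sqBox R g, triLattice.Adj u b}.Finite := by
  refine (sqBox (R + 1) g).finite_toSet.subset ?_
  rintro u ⟨b, hb, hub⟩
  have := abs_le_of_triLattice_adj hub
  rw [mem_sqBox] at hb
  rw [Finset.mem_coe, mem_sqBox]
  push_cast
  omega

/-- Otherwise the cluster would be covered by `B` and finitely many finite pieces, since every
vertex of it outside `B` is joined to a neighbour of `B` off `B`. -/
theorem exists_infinite_of_remove {V : Type*} {G : SimpleGraph V} {X : Set V} {B : Set V}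
    (hB : B.Finite) (hadj : {u : V | ∃ b ∈ B, G.Adj u b}.Finite) {b : V} (hb : b ∈ B)
    (hinf : {v | (siteGraph G X).Reachable b v}.Infinite) :
    ∃ u ∈ X \ B, (∃ b ∈ B, G.Adj u b) ∧ (siteGraph G X).Reachable b u ∧
      {v | (siteGraph G (X \ B)).Reachable u v}.Infinite := by
  by_contra hcon
  push Not at hcon
  let T : Set V := {u | (u ∈ X \ B ∧ (siteGraph G X).Reachable b u) ∧ ∃ b ∈ B, G.Adj u b}
  have hT : T.Finite := hadj.subset fun u hu => hu.2
  refine hinf ((hB.union (hT.biUnion (t := fun u => {v | (siteGraph G (X \ B)).Reachable u v})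
    fun u hu => hcon u hu.1.1 hu.2 hu.1.2)).subset ?_)
  intro v hv
  by_cases hvB : v ∈ B
  · exact Or.inl hvB
  · obtain ⟨c, d, h1, h2, h3, h4⟩ := exists_first_hit hv.symm B hvB hb
    refine Or.inr (Set.mem_iUnion₂.2 ⟨c, ⟨⟨⟨h3.2.1, h2⟩, ?_⟩, d, h4, h3.1⟩, h1.symm⟩)
    exact hv.trans (h1.mono (siteGraph_mono G Set.sdiff_subset))

/-! ### Trifurcations -/

/-- The box `sqBox R g` is filled, and removing it leaves at least three infinite clusters next
to it. -/
def Trifurcation (R : ℕ) (g : Face) : Set Spin :=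
  {σ | (∀ f ∈ sqBox R g, σ f = true) ∧ ∃ u : Fin 3 → Face,
    (∀ e, u e ∈ occ σ \ (sqBox R g : Set Face)) ∧ (∀ e, ∃ b ∈ sqBox R g, triLattice.Adj (u e) b) ∧
    (∀ a b, a ≠ b →
      ¬(siteGraph triLattice (occ σ \ (sqBox R g : Set Face))).Reachable (u a) (u b)) ∧
    ∀ e, {v | (siteGraph triLattice (occ σ \ (sqBox R g : Set Face))).Reachable
      (u e) v}.Infinite}

theorem measurableSet_trifurcation (R : ℕ) (g : Face) : MeasurableSet (Trifurcation R g) := by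
  have h0 : ∀ f : Face, MeasurableSet {σ : Spin | σ f = true} := fun f => by
    have : {σ : Spin | σ f = true} = (fun σ => σ f) ⁻¹' {true} := rfl
    rw [this]
    exact (measurable_pi_apply f) (measurableSet_singleton true)
  have e : Trifurcation R g = (⋂ f : Face, {σ : Spin | f ∈ sqBox R g → σ f = true}) ∩
      ⋃ u : Fin 3 → Face,
      (⋂ e, {σ : Spin | σ (u e) = true ∧ u e ∉ sqBox R g}) ∩
      ((⋂ e, {σ : Spin | ∃ b ∈ sqBox R g, triLattice.Adj (u e) b}) ∩
      ((⋂ a, ⋂ b, {σ : Spin | a ≠ b →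
      ¬(siteGraph triLattice (occ σ \ (sqBox R g : Set Face))).Reachable (u a) (u b)}) ∩
      ⋂ e, {σ : Spin | {v | (siteGraph triLattice (occ σ \ (sqBox R g : Set Face))).Reachable
      (u e) v}.Infinite})) := by
    ext σ
    simp [Trifurcation, occ]
  rw [e]
  refine MeasurableSet.inter (MeasurableSet.iInter fun f => ?_) (MeasurableSet.iUnion fun u =>
    (MeasurableSet.iInter fun e => ?_).inter ((MeasurableSet.iInter fun e => .const _).inter
      ((MeasurableSet.iInter fun a => MeasurableSet.iInter fun b => ?_).inter
        (MeasurableSet.iInter fun e => measurableSet_inInfCluster _ _))))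
  · exact MeasurableSet.imp (.const _) (h0 f)
  · exact (h0 _).inter (.const _)
  · exact MeasurableSet.imp (.const _) (measurableSet_reachable_site _ _ _).compl

theorem trifurcation_shift (R : ℕ) (g : Face) :
    Trifurcation R 0 ⊆ shiftSpin g ⁻¹' Trifurcation R g := by
  have hmem : ∀ f : Face, f + g ∈ sqBox R g ↔ f ∈ sqBox R 0 := fun f => by
    simp only [mem_sqBox, Prod.fst_add, Prod.snd_add, Prod.fst_zero, Prod.snd_zero]
    omega
  rintro σ ⟨h1, u, h2, h3, h4, h5⟩
  refine ⟨fun f hf => ?_, fun e => u e + g, fun e => ⟨?_, ?_⟩, fun e => ?_, fun a b hab => ?_,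
    fun e => infinite_site_shift σ _ _ g _ hmem (h5 e)⟩
  · exact h1 (f - g) ((hmem _).1 (by simpa using hf))
  · simpa [occ, shiftSpin] using (h2 e).1
  · exact fun h => (h2 e).2 ((hmem _).1 h)
  · obtain ⟨b, hb, hb'⟩ := h3 e
    exact ⟨b + g, (hmem b).2 hb, triLattice_adj_add g _ _ hb'⟩
  · rw [reachable_site_shift_iff σ _ _ g _ _ hmem]
    exact h4 a b hab

/-- Filling the box does not change the configuration outside it, so each of the three clusters
leaves an infinite piece touching the box, and these pieces stay separated off the box. -/
theorem fill_mem_trifurcation {R : ℕ} {σ : Spin} (u : Fin 3 → Face)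
    (hu : ∀ e, u e ∈ sqBox R 0) (hi : ∀ e, InInfCluster σ (u e))
    (hs : ∀ a b, a ≠ b → ¬(siteGraph triLattice (occ σ)).Reachable (u a) (u b)) :
    fill (sqBox R 0) σ ∈ Trifurcation R 0 := by
  have hocc : occ (fill (sqBox R 0) σ) \ (sqBox R 0 : Set Face) =
      occ σ \ (sqBox R 0 : Set Face) := by
    ext f
    by_cases h : f ∈ sqBox R 0 <;> simp [occ, fill, h]
  choose w hw hwadj hwr hwi using fun e => exists_infinite_of_remove (sqBox R 0).finite_toSet
    (finite_adj_sqBox R 0) (hu e) (hi e)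
  refine ⟨fun f hf => by simp [fill, hf], w, fun e => ?_, hwadj, fun a b hab h => ?_, fun e => ?_⟩
  · rw [hocc]
    exact hw e
  · rw [hocc] at h
    exact hs a b hab ((hwr a).trans ((h.mono (siteGraph_mono _ Set.sdiff_subset)).trans
      (hwr b).symm))
  · rw [hocc]
    exact hwi e

/-! ### Uniqueness of the infinite cluster -/

theorem exists_measurableCylinder_symmDiff_lt {ι : Type*} {α : ι → Type*}
    [∀ i, MeasurableSpace (α i)] (μ : Measure (∀ i, α i)) [IsFiniteMeasure μ]
    {A : Set (∀ i, α i)} (hA : MeasurableSet A) {ε : ℝ≥0∞} (hε : 0 < ε) :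
    ∃ S ∈ measurableCylinders α, μ (A ∆ S) < ε := by
  have hd := Measure.MeasureDense.of_generateFrom_isSetAlgebra_finite μ
    (isSetAlgebra_measurableCylinders (α := α)) generateFrom_measurableCylinders.symm
  -- The minimum with `1` covers `ε = ⊤`, where `toReal` would vanish.
  obtain ⟨S, hS, h⟩ := hd.approx A hA (measure_ne_top _ _) (min ε 1).toReal
    (ENNReal.toReal_pos (by simp [hε.ne']) (by simp))
  rw [ENNReal.ofReal_toReal (by simp)] at h
  exact ⟨S, hS, h.trans_le (min_le_left _ _)⟩

/-- A law on spin configurations for which reversing a spin distorts probabilities by at most a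
bounded factor. -/
def FlipTolerant (ν : Measure Spin) : Prop :=
  ∀ f, ∃ C : ℝ≥0∞, C ≠ ⊤ ∧ ∀ A, MeasurableSet A → ν (flipSpin f ⁻¹' A) ≤ C * ν A

theorem FlipTolerant.fill {ν : Measure Spin} (h : FlipTolerant ν) (B : Finset Face) :
    ∃ C : ℝ≥0∞, C ≠ ⊤ ∧ ∀ A, MeasurableSet A → ν (fill B ⁻¹' A) ≤ C * ν A := by
  classical
  induction B using Finset.induction_on with
  | empty =>
    refine ⟨1, by simp, fun A _ => ?_⟩
    have : LoopON.fill ∅ = id := by funext σ f; simp [LoopON.fill]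
    simp [this]
  | insert f B hf ih =>
    obtain ⟨C, hC, hCA⟩ := ih
    obtain ⟨C', hC', hCA'⟩ := h f
    refine ⟨C + C * C', by finiteness, fun A hA => ?_⟩
    -- Filling one more face either changes nothing or amounts to one spin flip, depending on the
    -- spin already there.
    have hsub : LoopON.fill (insert f B) ⁻¹' A ⊆
        LoopON.fill B ⁻¹' A ∪ LoopON.fill B ⁻¹' (flipSpin f ⁻¹' A) := by
      intro σ hσ
      rw [Set.mem_preimage] at hσ
      by_cases hb : LoopON.fill B σ f = true
      · left
        have : LoopON.fill B σ = LoopON.fill (insert f B) σ := by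
          funext g
          by_cases hg : g = f
          · subst hg; rw [hb]; simp [LoopON.fill]
          · simp [LoopON.fill, hg]
        rwa [Set.mem_preimage, this]
      · right
        have : flipSpin f (LoopON.fill B σ) = LoopON.fill (insert f B) σ := by
          funext g
          by_cases hg : g = f
          · subst hg; simp [flipSpin, hb]; simp [LoopON.fill]
          · simp [LoopON.fill, flipSpin, hg]
        rwa [Set.mem_preimage, Set.mem_preimage, this]
    calc ν (LoopON.fill (insert f B) ⁻¹' A) ≤ _ := (measure_mono hsub).trans (measure_union_le _ _)
      _ ≤ C * ν A + C * (C' * ν A) := by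
        gcongr
        · exact hCA A hA
        · exact (hCA _ (measurable_flipSpin f hA)).trans (by gcongr; exact hCA' A hA)
      _ = (C + C * C') * ν A := by ring

theorem exists_translate_disjoint (s B : Finset Face) : ∃ g : Face, ∀ f ∈ s, f - g ∉ B := by
  classical
  obtain ⟨g, hg⟩ := Infinite.exists_notMem_finset ((s ×ˢ B).image fun p : Face × Face => p.1 - p.2)
  refine ⟨g, fun f hf hB => hg (Finset.mem_image.2 ⟨(f, f - g), by simp [hf, hB], by simp⟩)⟩

/-- This replaces ergodicity. A translation-invariant event is approximated by a cylinder, which may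
be translated away from `B` at no cost; filling `B` leaves that cylinder unchanged, and by tolerance
it distorts the approximation error by at most a constant factor. -/
theorem fill_symmDiff_null {ν : Measure Spin} [IsProbabilityMeasure ν]
    (hTI : ∀ g, ν.map (shiftSpin g) = ν) (hFT : FlipTolerant ν) {A : Set Spin}
    (hA : MeasurableSet A) (hAinv : ∀ g, shiftSpin g ⁻¹' A = A) (B : Finset Face) :
    ν (A ∆ (fill B ⁻¹' A)) = 0 := by
  obtain ⟨C, hC, hCA⟩ := hFT.fill B
  refine le_antisymm (ENNReal.le_of_forall_pos_le_add fun ε hε _ => ?_) zero_le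
  rw [zero_add]
  obtain ⟨S, hS, hlt⟩ := exists_measurableCylinder_symmDiff_lt ν hA
    (ε := (ε : ℝ≥0∞) / (1 + C)) (ENNReal.div_pos (by simpa using hε.ne') (by finiteness))
  obtain ⟨s, S', hS', rfl⟩ := (mem_measurableCylinders S).1 hS
  obtain ⟨g, hg⟩ := exists_translate_disjoint s B
  set T : Set Spin := shiftSpin g ⁻¹' cylinder s S' with hT
  have hcm : MeasurableSet (cylinder s S' : Set Spin) := .of_mem_measurableCylinders hS
  have hTm : MeasurableSet T := measurable_shiftSpin g hcm
  have hTB : fill B ⁻¹' T = T := by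
    ext σ
    simp only [hT, Set.mem_preimage, mem_cylinder]
    have : s.restrict (shiftSpin g (fill B σ)) = s.restrict (shiftSpin g σ) := by
      funext f
      simp [shiftSpin, fill, hg f f.2]
    rw [this]
  have hAT : ν (A ∆ T) ≤ ε / (1 + C) := by
    have : A ∆ T = shiftSpin g ⁻¹' (A ∆ cylinder s S') := by
      rw [Set.preimage_symmDiff, hAinv]
    rw [this, ← Measure.map_apply (measurable_shiftSpin g) (hA.symmDiff hcm), hTI]
    exact hlt.le
  calc ν (A ∆ (fill B ⁻¹' A)) ≤ ν (A ∆ T) + ν (T ∆ (fill B ⁻¹' A)) :=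
        measure_symmDiff_le _ _ _
    _ ≤ ν (A ∆ T) + C * ν (A ∆ T) := by
        gcongr
        have : T ∆ (fill B ⁻¹' A) = fill B ⁻¹' (A ∆ T) := by
          rw [Set.preimage_symmDiff, hTB, symmDiff_comm]
        rw [this]
        exact hCA _ (hA.symmDiff hTm)
    _ = (1 + C) * ν (A ∆ T) := by ring
    _ ≤ (1 + C) * (ε / (1 + C)) := by gcongr
    _ = ε := ENNReal.mul_div_cancel (by simp) (by finiteness)

/-! ### Counting trifurcation boxes in a large square -/

/-- The square which contains `K ^ 2` disjoint boxes of radius `R` in its interior. -/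
def bigSquare (R K : ℕ) : Finset Face :=
  Finset.Icc (-(R : ℤ) - 1) ((2 * R + 1) * K - R) ×ˢ
    Finset.Icc (-(R : ℤ) - 1) ((2 * R + 1) * K - R)

/-- The perimeter of `bigSquare R K`. -/
def perimeter (R K : ℕ) : Finset Face :=
  (bigSquare R K).filter fun f => f.1 = -(R : ℤ) - 1 ∨ f.1 = (2 * R + 1) * K - R ∨
    f.2 = -(R : ℤ) - 1 ∨ f.2 = (2 * R + 1) * K - R

theorem card_perimeter_le (R K : ℕ) :
    (perimeter R K).card ≤ 4 * ((2 * R + 1) * K + 2) := by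
  classical
  set a : ℤ := -(R : ℤ) - 1
  set b : ℤ := (2 * R + 1) * K - R
  have h : perimeter R K ⊆ (({a} ×ˢ Finset.Icc a b) ∪ ({b} ×ˢ Finset.Icc a b)) ∪
      ((Finset.Icc a b ×ˢ {a}) ∪ (Finset.Icc a b ×ˢ {b})) := by
    rintro ⟨c, d⟩ h
    simp only [perimeter, bigSquare, Finset.mem_filter, Finset.mem_product, Finset.mem_Icc,
      Finset.mem_union, Finset.mem_singleton] at h ⊢
    tauto
  have hI : (Finset.Icc a b).card = (2 * R + 1) * K + 2 := by
    have : b + 1 - a = (((2 * R + 1) * K + 2 : ℕ) : ℤ) := by simp only [a, b]; push_cast; ring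
    rw [Int.card_Icc, this, Int.toNat_natCast]
  refine (Finset.card_le_card h).trans ((Finset.card_union_le _ _).trans
    ((add_le_add (Finset.card_union_le _ _) (Finset.card_union_le _ _)).trans ?_))
  simp only [Finset.card_product, Finset.card_singleton, hI]
  omega

/-- An infinite cluster leaves the square, and a step of the triangular lattice moves each
coordinate by at most one, so it cannot jump over the perimeter. -/
theorem exists_perimeter_reachable {R K : ℕ} {X : Set Face} {u : Face} (hu : u ∈ bigSquare R K)
    (hinf : {v | (siteGraph triLattice X).Reachable u v}.Infinite) :
    ∃ y ∈ perimeter R K, (siteGraph triLattice X).Reachable u y := by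
  obtain ⟨w, hw, hwQ⟩ := hinf.exists_notMem_finset (bigSquare R K)
  let S : Set Face := {f | ¬(f ∈ bigSquare R K ∧ f ∉ perimeter R K)}
  by_cases huP : u ∈ perimeter R K
  · exact ⟨u, huP, .refl _⟩
  have huS : u ∉ S := fun h => h ⟨hu, huP⟩
  obtain ⟨c, d, h1, h2, h3, h4⟩ := exists_first_hit hw S huS fun h => hwQ h.1
  have hc : c ∈ bigSquare R K ∧ c ∉ perimeter R K := by
    by_contra h
    exact h2 h
  refine ⟨d, ?_, (h1.mono (siteGraph_mono _ Set.sdiff_subset)).trans h3.reachable⟩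
  have hcd := abs_le_of_triLattice_adj h3.1
  have hd : d ∈ bigSquare R K := by
    simp only [perimeter, bigSquare, Finset.mem_filter, Finset.mem_product, Finset.mem_Icc] at hc ⊢
    obtain ⟨h5, h6⟩ := hc
    simp only [h5, and_self, true_and, not_or] at h6
    omega
  by_contra hd'
  exact h4 ⟨hd, hd'⟩

/-- The centres of `K ^ 2` disjoint boxes of radius `R`. -/
def centre (R : ℕ) {K : ℕ} (i : Fin K × Fin K) : Face :=
  ((2 * R + 1) * (i.1 : ℕ), (2 * R + 1) * (i.2 : ℕ))

theorem sqBox_centre_subset {R K : ℕ} (i : Fin K × Fin K) {f : Face}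
    (hf : f ∈ sqBox R (centre R i)) :
    (-(R : ℤ) ≤ f.1 ∧ f.1 + 1 ≤ (2 * R + 1) * K - R) ∧
      (-(R : ℤ) ≤ f.2 ∧ f.2 + 1 ≤ (2 * R + 1) * K - R) := by
  have h1 : ((i.1 : ℕ) : ℤ) + 1 ≤ K := by exact_mod_cast i.1.2
  have h2 : ((i.2 : ℕ) : ℤ) + 1 ≤ K := by exact_mod_cast i.2.2
  have h3 := mul_le_mul_of_nonneg_left h1 (show (0 : ℤ) ≤ 2 * R + 1 by positivity)
  have h4 := mul_le_mul_of_nonneg_left h2 (show (0 : ℤ) ≤ 2 * R + 1 by positivity)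
  have h5 : (0 : ℤ) ≤ (2 * R + 1) * (i.1 : ℕ) := by positivity
  have h6 : (0 : ℤ) ≤ (2 * R + 1) * (i.2 : ℕ) := by positivity
  rw [mul_add] at h3 h4
  simp only [mem_sqBox, centre] at hf
  generalize (2 * (R : ℤ) + 1) * ((i.1 : ℕ) : ℤ) = a at *
  generalize (2 * (R : ℤ) + 1) * ((i.2 : ℕ) : ℤ) = b at *
  generalize (2 * (R : ℤ) + 1) * (K : ℤ) = c at *
  omega

theorem disjoint_sqBox_centre {R K : ℕ} {i j : Fin K × Fin K} (hij : i ≠ j) :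
    Disjoint (sqBox R (centre R i) : Set Face) (sqBox R (centre R j) : Set Face) := by
  rw [Set.disjoint_left]
  intro f hi hj
  rw [Finset.mem_coe, mem_sqBox] at hi hj
  simp only [centre] at hi hj
  have key : ∀ a b c : ℤ, (2 * R + 1) * a - R ≤ c → c ≤ (2 * R + 1) * a + R →
      (2 * R + 1) * b - R ≤ c → c ≤ (2 * R + 1) * b + R → a = b := by
    intro a b c e1 e2 e3 e4
    have hR : (0 : ℤ) < 2 * R + 1 := by positivity
    rcases lt_trichotomy a b with h | h | h
    · have := mul_le_mul_of_nonneg_left (Int.add_one_le_iff.2 h) hR.le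
      rw [mul_add, mul_one] at this
      linarith
    · exact h
    · have := mul_le_mul_of_nonneg_left (Int.add_one_le_iff.2 h) hR.le
      rw [mul_add, mul_one] at this
      linarith
  refine hij (Prod.ext (Fin.ext ?_) (Fin.ext ?_))
  · exact_mod_cast key _ _ _ hi.1.1 hi.1.2 hj.1.1 hj.1.2
  · exact_mod_cast key _ _ _ hi.2.1 hi.2.2 hj.2.1 hj.2.2

theorem card_trifurcation_le (R K : ℕ) (σ : Spin) (s : Finset (Fin K × Fin K))
    (hs : ∀ i ∈ s, σ ∈ Trifurcation R (centre R i)) : s.card ≤ (perimeter R K).card := by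
  have hs' := fun i : s => (hs i.1 i.2).2
  choose u hu using hs'
  rw [← Fintype.card_coe]
  refine card_le_of_trifurcations triLattice (occ σ) (fun i => (sqBox R (centre R i.1) : Set Face))
    ?_ ?_ ?_ (perimeter R K) ?_ u ?_ ?_ ?_ ?_
  · exact fun i j hij => disjoint_sqBox_centre fun h => hij (Subtype.ext h)
  · exact fun i f hf => (hs i.1 i.2).1 f hf
  · exact fun i => reachable_sqBox R _
  · intro i y hy hy'
    have := sqBox_centre_subset i.1 hy'
    simp only [perimeter, Finset.mem_filter] at hy
    omega
  · exact fun i => (hu i).1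
  · exact fun i => (hu i).2.1
  · exact fun i => (hu i).2.2.1
  · intro i e
    obtain ⟨b, hb, hub⟩ := (hu i).2.1 e
    refine exists_perimeter_reachable ?_ ((hu i).2.2.2 e)
    have hb' := sqBox_centre_subset i.1 hb
    have hub' := abs_le_of_triLattice_adj hub
    simp only [bigSquare, Finset.mem_product, Finset.mem_Icc]
    omega

/-- The expected number of trifurcation boxes among the `K ^ 2` boxes is at least `K ^ 2` times the
probability at the origin, yet it is at most the perimeter, which is linear in `K`. -/
theorem trifurcation_null {ν : Measure Spin} [IsProbabilityMeasure ν]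
    (hTI : ∀ g, ν.map (shiftSpin g) = ν) (R : ℕ) : ν (Trifurcation R 0) = 0 := by
  classical
  by_contra hne
  have hp : ∀ g, ν (Trifurcation R 0) ≤ ν (Trifurcation R g) := fun g => by
    rw [← hTI g, Measure.map_apply (measurable_shiftSpin g) (measurableSet_trifurcation R g), hTI g]
    exact measure_mono (trifurcation_shift R g)
  have key : ∀ K : ℕ, (K * K : ℕ) * ν (Trifurcation R 0) ≤ (4 * ((2 * R + 1) * K + 2) : ℕ) := by
    intro K
    calc ((K * K : ℕ) : ℝ≥0∞) * ν (Trifurcation R 0)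
        = ∑ i : Fin K × Fin K, ν (Trifurcation R 0) := by simp
      _ ≤ ∑ i : Fin K × Fin K, ν (Trifurcation R (centre R i)) :=
          Finset.sum_le_sum fun i _ => hp _
      _ = ∫⁻ σ, ∑ i : Fin K × Fin K, (Trifurcation R (centre R i)).indicator 1 σ ∂ν := by
          rw [lintegral_finsetSum]
          · exact Finset.sum_congr rfl fun i _ =>
              (lintegral_indicator_one (measurableSet_trifurcation R _)).symm
          · exact fun i _ => measurable_one.indicator (measurableSet_trifurcation R _)
      _ ≤ ∫⁻ σ, (4 * ((2 * R + 1) * K + 2) : ℕ) ∂ν := by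
          refine lintegral_mono fun σ => ?_
          have : ∑ i : Fin K × Fin K, (Trifurcation R (centre R i)).indicator (1 : Spin → ℝ≥0∞) σ =
              ((Finset.univ.filter fun i : Fin K × Fin K => σ ∈ Trifurcation R (centre R i)).card : ℕ) := by
            simp [Set.indicator_apply]
          rw [this, Nat.cast_le]
          exact (card_trifurcation_le R K σ _ (by simp)).trans (card_perimeter_le R K)
      _ = (4 * ((2 * R + 1) * K + 2) : ℕ) := by simp
  have hreal : ∀ K : ℕ, (K * K : ℝ) * ν.real (Trifurcation R 0) ≤ 4 * ((2 * R + 1) * K + 2) := by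
    intro K
    have := ENNReal.toReal_mono (by finiteness) (key K)
    rw [ENNReal.toReal_mul, ENNReal.toReal_natCast, ENNReal.toReal_natCast] at this
    exact_mod_cast this
  have hpos : 0 < ν.real (Trifurcation R 0) := ENNReal.toReal_pos hne (measure_ne_top _ _)
  -- For `K ≥ 1` the perimeter bound `4 * ((2 * R + 1) * K + 2)` is at most `4 * (2 * R + 3) * K`.
  obtain ⟨K, hK⟩ := exists_nat_gt ((4 * (2 * R + 3) : ℝ) / ν.real (Trifurcation R 0))
  rw [div_lt_iff₀ hpos] at hK
  have hK1 : (1 : ℝ) ≤ K := by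
    have : K ≠ 0 := by
      rintro rfl
      simp only [CharP.cast_eq_zero, zero_mul] at hK
      have : (0 : ℝ) ≤ 4 * (2 * R + 3) := by positivity
      linarith
    exact_mod_cast Nat.one_le_iff_ne_zero.2 this
  have h1 := hreal K
  have h2 := mul_lt_mul_of_pos_left hK (show (0 : ℝ) < K by linarith)
  nlinarith [show (0 : ℝ) ≤ R by positivity]

theorem exists_mem_sqBox (u : Face) : ∃ R : ℕ, ∀ R', R ≤ R' → u ∈ sqBox R' 0 := by
  refine ⟨u.1.natAbs + u.2.natAbs, fun R' h => ?_⟩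
  rw [mem_sqBox]
  simp only [Prod.fst_zero, Prod.snd_zero]
  omega

/-- Filling a box that contains the three faces turns this event into a trifurcation; tolerance
pulls the null event back through the filling. -/
theorem three_infClusters_null {ν : Measure Spin} [IsProbabilityMeasure ν]
    (hTI : ∀ g, ν.map (shiftSpin g) = ν) (hFT : FlipTolerant ν) (u v w : Face) :
    ν {σ | InDistinct σ u v ∧ InDistinct σ u w ∧ InDistinct σ v w} = 0 := by
  obtain ⟨R₁, h₁⟩ := exists_mem_sqBox u
  obtain ⟨R₂, h₂⟩ := exists_mem_sqBox v
  obtain ⟨R₃, h₃⟩ := exists_mem_sqBox w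
  set R := R₁ + R₂ + R₃ with hR
  have hu := h₁ R (by omega)
  have hv := h₂ R (by omega)
  have hw := h₃ R (by omega)
  obtain ⟨C, hC, hCA⟩ := hFT.fill (sqBox R 0)
  have h0 := hCA _ (measurableSet_trifurcation R 0)
  rw [trifurcation_null hTI, mul_zero, nonpos_iff_eq_zero] at h0
  refine measure_mono_null (fun σ hσ => ?_) h0
  obtain ⟨⟨hui, hvi, huv⟩, ⟨-, hwi, huw⟩, -, -, hvw⟩ := hσ
  refine fill_mem_trifurcation ![u, v, w] (fun e => ?_) (fun e => ?_) fun a b hab h => ?_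
  · fin_cases e <;> simp [hu, hv, hw]
  · fin_cases e <;> simp [hui, hvi, hwi]
  · have hvu := fun h => huv (SimpleGraph.Reachable.symm h)
    have hwu := fun h => huw (SimpleGraph.Reachable.symm h)
    have hwv := fun h => hvw (SimpleGraph.Reachable.symm h)
    fin_cases a <;> fin_cases b <;> simp_all

/-- Burton–Keane: almost surely, there is at most one infinite cluster of spin `true`. -/
theorem inDistinct_null {ν : Measure Spin} [IsProbabilityMeasure ν]
    (hTI : ∀ g, ν.map (shiftSpin g) = ν) (hFT : FlipTolerant ν) :
    ∀ᵐ σ ∂ν, ∀ u v, ¬InDistinct σ u v := by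
  let A : Set Spin := {σ | ∃ u v, InDistinct σ u v}
  have hA : MeasurableSet A := by
    have : A = ⋃ u, ⋃ v, {σ | InDistinct σ u v} := by
      ext σ
      simp [A]
    rw [this]
    exact .iUnion fun u => .iUnion fun v => measurableSet_inDistinct u v
  have hsub : ∀ g, A ⊆ shiftSpin g ⁻¹' A := by
    rintro g σ ⟨u, v, h⟩
    exact ⟨_, _, inDistinct_shift σ g u v h⟩
  have hAinv : ∀ g, shiftSpin g ⁻¹' A = A := fun g => by
    refine subset_antisymm (fun σ hσ => ?_) (hsub g)
    have := hsub (-g) hσ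
    rwa [Set.mem_preimage, shiftSpin_neg] at this
  have h3 : ∀ᵐ σ ∂ν, ∀ u v w, ¬(InDistinct σ u v ∧ InDistinct σ u w ∧ InDistinct σ v w) := by
    simp only [ae_all_iff]
    intro u v w
    have := three_infClusters_null hTI hFT u v w
    rw [← compl_mem_ae_iff] at this
    exact this
  -- Having two infinite clusters is a translation-invariant event, so it almost surely survives the
  -- filling of any box, including one that merges the clusters of `u` and `v`.
  have hB : ∀ᵐ σ ∂ν, ∀ R, (σ ∈ A → fill (sqBox R 0) σ ∈ A) := by
    rw [ae_all_iff]
    intro R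
    have := fill_symmDiff_null hTI hFT hA hAinv (sqBox R 0)
    rw [← compl_mem_ae_iff] at this
    filter_upwards [this] with σ hσ h1
    by_contra h2
    exact hσ (Or.inl ⟨h1, h2⟩)
  filter_upwards [h3, hB] with σ h3 hB u v huv
  obtain ⟨R₁, h₁⟩ := exists_mem_sqBox u
  obtain ⟨R₂, h₂⟩ := exists_mem_sqBox v
  set R := R₁ + R₂
  have hu := h₁ R (by omega)
  have hv := h₂ R (by omega)
  have hfill : (sqBox R 0 : Set Face) ⊆ occ (fill (sqBox R 0) σ) := fun f hf => by
    have hf' : f ∈ sqBox R 0 := hf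
    change fill (sqBox R 0) σ f = true
    simp [fill, hf']
  have hle : occ σ ⊆ occ (fill (sqBox R 0) σ) := fun f hf => by
    have hf' : σ f = true := hf
    change fill (sqBox R 0) σ f = true
    simp [fill, hf']
  -- An infinite cluster of the filled configuration that avoids the box was already present in `σ`,
  -- where it is a third one next to those of `u` and `v`.
  have hout : ∀ a, InInfCluster (fill (sqBox R 0) σ) a →
      ¬(siteGraph triLattice (occ (fill (sqBox R 0) σ))).Reachable a u → False := by
    intro a ha hau
    have hav : ¬(siteGraph triLattice (occ (fill (sqBox R 0) σ))).Reachable a v := fun h =>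
      hau (h.trans ((reachable_sqBox R 0 v hv u hu).mono (siteGraph_mono _ hfill)))
    have hback : ∀ b, (siteGraph triLattice (occ (fill (sqBox R 0) σ))).Reachable a b →
        (siteGraph triLattice (occ σ)).Reachable a b := fun b hb =>
      reachable_siteGraph_sdiff hb fun w hw hwX => by
        by_cases hwB : w ∈ sqBox R 0
        · exact absurd (hw.trans ((reachable_sqBox R 0 w hwB u hu).mono (siteGraph_mono _ hfill)))
            hau
        · change fill (sqBox R 0) σ w = true at hwX
          change σ w = true
          simpa [fill, hwB] using hwX
    have hai : InInfCluster σ a := Set.Infinite.mono (fun b hb => hback b hb) ha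
    have hfw : ∀ b, (siteGraph triLattice (occ σ)).Reachable b a →
        (siteGraph triLattice (occ (fill (sqBox R 0) σ))).Reachable a b :=
      fun b h => h.symm.mono (siteGraph_mono _ hle)
    exact h3 u v a ⟨huv, ⟨huv.1, hai, fun h => hau (hfw u h)⟩,
      ⟨huv.2.1, hai, fun h => hav (hfw v h)⟩⟩
  obtain ⟨a, b, ha, hb, hab⟩ := hB R ⟨u, v, huv⟩
  by_cases h : (siteGraph triLattice (occ (fill (sqBox R 0) σ))).Reachable a u
  · exact hout b hb fun h' => hab (h.trans h'.symm)
  · exact hout a ha h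

/-! ### The edges of the hexagonal lattice and their dual edges -/

/-- The edge dual to the edge from `p + (1, 0)` to `p + (0, 1)`. -/
def edgeA (p : Face) : hexLattice.edgeSet := ⟨s((p, false), (p, true)), by simp [hexLattice]⟩

/-- The edge dual to the edge from `p` to `p + (0, 1)`. -/
def edgeB (p : Face) : hexLattice.edgeSet :=
  ⟨s((p, false), (p - (1, 0), true)), by simp [hexLattice]⟩

/-- The edge dual to the edge from `p` to `p + (1, 0)`. -/
def edgeC (p : Face) : hexLattice.edgeSet :=
  ⟨s((p, false), (p - (0, 1), true)), by simp [hexLattice]⟩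

theorem hexLattice_adj_up {p : Face} {v : HexVertex} : hexLattice.Adj (p, false) v ↔
    v = (p, true) ∨ v = (p - (1, 0), true) ∨ v = (p - (0, 1), true) := by
  obtain ⟨q, b⟩ := v
  simp only [hexLattice, SimpleGraph.fromRel_adj, Prod.mk.injEq]
  cases b <;> simp

/-- Every edge has exactly one upward endpoint, so edges are indexed by an upward triangle and one
of its three sides. -/
theorem edge_cases (e : hexLattice.edgeSet) : ∃ p, e = edgeA p ∨ e = edgeB p ∨ e = edgeC p := by
  obtain ⟨e, he⟩ := e
  induction e using Sym2.ind with
  | _ u v =>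
    have key : ∀ (p : Face) (v : HexVertex) (h : s((p, false), v) ∈ hexLattice.edgeSet),
        ∃ q, (⟨s((p, false), v), h⟩ : hexLattice.edgeSet) = edgeA q ∨
          (⟨s((p, false), v), h⟩ : hexLattice.edgeSet) = edgeB q ∨
          (⟨s((p, false), v), h⟩ : hexLattice.edgeSet) = edgeC q := by
      intro p v h
      rcases hexLattice_adj_up.1 h with rfl | rfl | rfl
      · exact ⟨p, Or.inl rfl⟩
      · exact ⟨p, Or.inr (Or.inl rfl)⟩
      · exact ⟨p, Or.inr (Or.inr rfl)⟩
    obtain ⟨p, b⟩ := u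
    cases b
    · exact key p v he
    · obtain ⟨q, b'⟩ := v
      cases b'
      · have := key q (p, true) (by rw [Sym2.eq_swap]; exact he)
        simpa only [Sym2.eq_swap] using this
      · simp [hexLattice] at he

theorem edge_eq_iff {p p' q q' : Face} {h : s((p, false), (p', true)) ∈ hexLattice.edgeSet}
    {h' : s((q, false), (q', true)) ∈ hexLattice.edgeSet} :
    (⟨s((p, false), (p', true)), h⟩ : hexLattice.edgeSet) = ⟨s((q, false), (q', true)), h'⟩ ↔
      p = q ∧ p' = q' := by
  rw [Subtype.ext_iff]
  simp

@[simp] theorem edgeA_inj {p q : Face} : edgeA p = edgeA q ↔ p = q :=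
  edge_eq_iff.trans (and_self_iff)

@[simp] theorem edgeB_inj {p q : Face} : edgeB p = edgeB q ↔ p = q :=
  edge_eq_iff.trans (by simp)

@[simp] theorem edgeC_inj {p q : Face} : edgeC p = edgeC q ↔ p = q :=
  edge_eq_iff.trans (by simp)

@[simp] theorem edgeA_ne_edgeB {p q : Face} : edgeA p ≠ edgeB q := by
  refine fun h => ?_
  obtain ⟨h1, h2⟩ := edge_eq_iff.1 h
  have := h1.symm.trans h2
  simp only [Prod.ext_iff, Prod.fst_sub, Prod.snd_sub] at this
  omega

@[simp] theorem edgeA_ne_edgeC {p q : Face} : edgeA p ≠ edgeC q := by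
  refine fun h => ?_
  obtain ⟨h1, h2⟩ := edge_eq_iff.1 h
  have := h1.symm.trans h2
  simp only [Prod.ext_iff, Prod.fst_sub, Prod.snd_sub] at this
  omega

@[simp] theorem edgeB_ne_edgeC {p q : Face} : edgeB p ≠ edgeC q := by
  refine fun h => ?_
  obtain ⟨h1, h2⟩ := edge_eq_iff.1 h
  subst h1
  simp [Prod.ext_iff] at h2

theorem toGraph_adj {ω : Config} {u v : HexVertex} :
    (toGraph ω).Adj u v ↔ ∃ h : hexLattice.Adj u v, ω ⟨s(u, v), h⟩ = true := by
  simp only [toGraph, SimpleGraph.fromEdgeSet_adj, Set.mem_image, Subtype.exists,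
    exists_and_right, exists_eq_right]
  constructor
  · rintro ⟨⟨h, h'⟩, -⟩
    exact ⟨h, h'⟩
  · rintro ⟨h, h'⟩
    exact ⟨⟨h, h'⟩, h.ne⟩

theorem toGraph_adj_up {ω : Config} {p : Face} {v : HexVertex} :
    (toGraph ω).Adj (p, false) v ↔ (v = (p, true) ∧ ω (edgeA p) = true) ∨
      (v = (p - (1, 0), true) ∧ ω (edgeB p) = true) ∨
      (v = (p - (0, 1), true) ∧ ω (edgeC p) = true) := by
  rw [toGraph_adj]
  constructor
  · rintro ⟨h, h'⟩
    rcases hexLattice_adj_up.1 h with rfl | rfl | rfl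
    · exact Or.inl ⟨rfl, h'⟩
    · exact Or.inr (Or.inl ⟨rfl, h'⟩)
    · exact Or.inr (Or.inr ⟨rfl, h'⟩)
  · rintro (⟨rfl, h⟩ | ⟨rfl, h⟩ | ⟨rfl, h⟩)
    · exact ⟨(edgeA p).2, h⟩
    · exact ⟨(edgeB p).2, h⟩
    · exact ⟨(edgeC p).2, h⟩

theorem toGraph_adj_down {ω : Config} {p : Face} {v : HexVertex} :
    (toGraph ω).Adj (p, true) v ↔ (v = (p, false) ∧ ω (edgeA p) = true) ∨
      (v = (p + (1, 0), false) ∧ ω (edgeB (p + (1, 0))) = true) ∨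
      (v = (p + (0, 1), false) ∧ ω (edgeC (p + (0, 1))) = true) := by
  rw [SimpleGraph.adj_comm]
  obtain ⟨q, b⟩ := v
  cases b
  · rw [toGraph_adj_up]
    simp only [Prod.mk.injEq, and_true, eq_sub_iff_add_eq]
    constructor
    · rintro (⟨h, h'⟩ | ⟨h, h'⟩ | ⟨h, h'⟩)
      · exact Or.inl ⟨h.symm, h ▸ h'⟩
      · exact Or.inr (Or.inl ⟨h.symm, h ▸ h'⟩)
      · exact Or.inr (Or.inr ⟨h.symm, h ▸ h'⟩)
    · rintro (⟨h, h'⟩ | ⟨h, h'⟩ | ⟨h, h'⟩)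
      · exact Or.inl ⟨h.symm, h ▸ h'⟩
      · exact Or.inr (Or.inl ⟨h.symm, h ▸ h'⟩)
      · exact Or.inr (Or.inr ⟨h.symm, h ▸ h'⟩)
  · rw [toGraph_adj]
    simp [hexLattice]

theorem ncard_of_three {α : Type*} {a b c : α} (hab : a ≠ b) (hac : a ≠ c) (hbc : b ≠ c)
    (x y z : Bool) (S : Set α)
    (hS : ∀ v, v ∈ S ↔ (v = a ∧ x = true) ∨ (v = b ∧ y = true) ∨ (v = c ∧ z = true)) :
    S.ncard = x.toNat + y.toNat + z.toNat := by
  classical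
  have : S = (((if x then {a} else ∅) ∪ ((if y then {b} else ∅) ∪ (if z then {c} else ∅)) :
      Finset α) : Set α) := by
    ext v
    rw [hS]
    cases x <;> cases y <;> cases z <;> simp [or_left_comm]
  rw [this, Set.ncard_coe_finset]
  cases x <;> cases y <;> cases z <;> simp [hab, hab.symm, hac, hbc]

theorem ncard_neighborSet_up (ω : Config) (p : Face) :
    ((toGraph ω).neighborSet (p, false)).ncard =
      (ω (edgeA p)).toNat + (ω (edgeB p)).toNat + (ω (edgeC p)).toNat := by
  refine ncard_of_three (a := (p, true)) (b := (p - (1, 0), true)) (c := (p - (0, 1), true))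
    ?_ ?_ ?_ _ _ _ _ fun v => ?_
  · simp [Prod.ext_iff, eq_sub_iff_add_eq]
  · simp [Prod.ext_iff, eq_sub_iff_add_eq]
  · simp [Prod.ext_iff]
  · exact toGraph_adj_up

theorem ncard_neighborSet_down (ω : Config) (p : Face) :
    ((toGraph ω).neighborSet (p, true)).ncard =
      (ω (edgeA p)).toNat + (ω (edgeB (p + (1, 0)))).toNat + (ω (edgeC (p + (0, 1)))).toNat := by
  refine ncard_of_three (a := (p, false)) (b := (p + (1, 0), false)) (c := (p + (0, 1), false))
    ?_ ?_ ?_ _ _ _ _ fun v => ?_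
  · simp [Prod.ext_iff]
  · simp [Prod.ext_iff]
  · simp [Prod.ext_iff]
  · exact toGraph_adj_down

/-- As the lattice is cubic, even degree is one parity relation per triangle; these local relations
are what closedness and the lifting to spins use. -/
theorem isLoopConfig_iff {ω : Config} : IsLoopConfig ω ↔
    ∀ p, ω (edgeA p) = (ω (edgeB p) ^^ ω (edgeC p)) ∧
      ω (edgeA p) = (ω (edgeB (p + (1, 0))) ^^ ω (edgeC (p + (0, 1)))) := by
  have key : ∀ x y z : Bool, Even (x.toNat + y.toNat + z.toNat) ↔ x = (y ^^ z) := by decide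
  constructor
  · intro h p
    have h1 := h (p, false)
    have h2 := h (p, true)
    rw [ncard_neighborSet_up, key] at h1
    rw [ncard_neighborSet_down, key] at h2
    exact ⟨h1, h2⟩
  · rintro h ⟨p, b⟩
    cases b
    · rw [ncard_neighborSet_up, key]
      exact (h p).1
    · rw [ncard_neighborSet_down, key]
      exact (h p).2

theorem ncard_eq_two_of_adj {ω : Config} (hω : IsLoopConfig ω) {u v : HexVertex}
    (h : (toGraph ω).Adj u v) : ((toGraph ω).neighborSet u).ncard = 2 := by
  have h1 := hω u
  have key : ∀ x y z : Bool, Even (x.toNat + y.toNat + z.toNat) →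
      x.toNat + y.toNat + z.toNat = 0 ∨ x.toNat + y.toNat + z.toNat = 2 := by decide
  have h3 : ((toGraph ω).neighborSet u).ncard = 0 ∨ ((toGraph ω).neighborSet u).ncard = 2 := by
    obtain ⟨p, b⟩ := u
    cases b
    · rw [ncard_neighborSet_up] at h1 ⊢
      exact key _ _ _ h1
    · rw [ncard_neighborSet_down] at h1 ⊢
      exact key _ _ _ h1
  have hfin : ((toGraph ω).neighborSet u).Finite := by
    obtain ⟨p, b⟩ := u
    cases b
    · refine (Set.toFinite {(p, true), (p - (1, 0), true), (p - (0, 1), true)}).subset ?_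
      intro w hw
      rcases toGraph_adj_up.1 hw with h | h | h <;> simp [h.1]
    · refine (Set.toFinite {(p, false), (p + (1, 0), false), (p + (0, 1), false)}).subset ?_
      intro w hw
      rcases toGraph_adj_down.1 hw with h | h | h <;> simp [h.1]
  refine h3.resolve_left fun h0 => ?_
  rw [Set.ncard_eq_zero hfin] at h0
  exact Set.eq_empty_iff_forall_notMem.1 h0 v h

/-! ### Domain walls -/

/-- The domain walls of a spin configuration. -/
def cob (σ : Spin) : Config := fun e => by
  classical
  exact decide (∃ p, (e = edgeA p ∧ (σ (p + (1, 0)) ^^ σ (p + (0, 1))) = true) ∨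
    (e = edgeB p ∧ (σ p ^^ σ (p + (0, 1))) = true) ∨
    (e = edgeC p ∧ (σ p ^^ σ (p + (1, 0))) = true))

@[simp] theorem cob_edgeA (σ : Spin) (p : Face) :
    cob σ (edgeA p) = (σ (p + (1, 0)) ^^ σ (p + (0, 1))) := by
  simp only [cob, edgeA_inj, edgeA_ne_edgeB, edgeA_ne_edgeC, false_and, or_false,
    exists_eq_left', Bool.decide_eq_true]

@[simp] theorem cob_edgeB (σ : Spin) (p : Face) :
    cob σ (edgeB p) = (σ p ^^ σ (p + (0, 1))) := by
  simp only [cob, edgeB_inj, edgeA_ne_edgeB.symm, edgeB_ne_edgeC, false_and, or_false, false_or,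
    exists_eq_left', Bool.decide_eq_true]

@[simp] theorem cob_edgeC (σ : Spin) (p : Face) :
    cob σ (edgeC p) = (σ p ^^ σ (p + (1, 0))) := by
  simp only [cob, edgeC_inj, edgeA_ne_edgeC.symm, edgeB_ne_edgeC.symm, false_and, false_or,
    exists_eq_left', Bool.decide_eq_true]

theorem config_ext {ω ω' : Config} (h : ∀ p, ω (edgeA p) = ω' (edgeA p) ∧
    ω (edgeB p) = ω' (edgeB p) ∧ ω (edgeC p) = ω' (edgeC p)) : ω = ω' := by
  funext e
  obtain ⟨p, rfl | rfl | rfl⟩ := edge_cases e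
  exacts [(h p).1, (h p).2.1, (h p).2.2]

theorem isLoopConfig_cob (σ : Spin) : IsLoopConfig (cob σ) := by
  rw [isLoopConfig_iff]
  intro p
  simp only [cob_edgeA, cob_edgeB, cob_edgeC]
  rw [add_right_comm p (1, 0) (0, 1)]
  generalize σ p = a, σ (p + (1, 0)) = b, σ (p + (0, 1)) = c, σ (p + (0, 1) + (1, 0)) = d
  revert a b c d
  decide

/-- The function on `ℤ` with value `s` at `0` which changes between `a` and `a + 1` when
`c a = true`. -/
def potential (s : Bool) (c : ℤ → Bool) : ℤ → Bool
  | Int.ofNat k => Nat.rec s (fun i r => r ^^ c i) k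
  | Int.negSucc k => Nat.rec (s ^^ c (-1)) (fun i r => r ^^ c (Int.negSucc (i + 1))) k

theorem potential_zero (s : Bool) (c : ℤ → Bool) : potential s c 0 = s := rfl

theorem potential_succ (s : Bool) (c : ℤ → Bool) (a : ℤ) :
    potential s c (a + 1) = (potential s c a ^^ c a) := by
  match a with
  | Int.ofNat k => rfl
  | Int.negSucc 0 =>
    change s = ((s ^^ c (-1)) ^^ c (-1))
    simp
  | Int.negSucc (k + 1) =>
    have : Int.negSucc (k + 1) + 1 = Int.negSucc k := by omega
    rw [this]
    change potential s c (Int.negSucc k) =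
      ((potential s c (Int.negSucc k) ^^ c (Int.negSucc (k + 1))) ^^ c (Int.negSucc (k + 1)))
    simp

theorem continuous_potential {Ω : Type*} [TopologicalSpace Ω] {s : Ω → Bool} {c : Ω → ℤ → Bool}
    (hs : Continuous s) (hc : ∀ i, Continuous fun ω => c ω i) (a : ℤ) :
    Continuous fun ω => potential (s ω) (c ω) a := by
  have hx : ∀ {f g : Ω → Bool}, Continuous f → Continuous g → Continuous fun ω => f ω ^^ g ω :=
    fun hf hg => (continuous_of_discreteTopology (f := fun p : Bool × Bool => p.1 ^^ p.2)).comp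
      (hf.prodMk hg)
  match a with
  | Int.ofNat k =>
    induction k with
    | zero => exact hs
    | succ k ih => exact hx ih (hc k)
  | Int.negSucc k =>
    induction k with
    | zero => exact hx hs (hc (-1))
    | succ k ih => exact hx ih (hc _)

/-- The spin configuration with value `s` at the origin whose domain walls are a given loop
configuration. -/
def lift (s : Bool) (ω : Config) : Spin := fun f =>
  potential (potential s (fun i => ω (edgeC (i, 0))) f.1) (fun j => ω (edgeB (f.1, j))) f.2

theorem continuous_lift (s : Bool) : Continuous (lift s) :=
  continuous_pi fun _ => continuous_potential
    (continuous_potential continuous_const (fun _ => continuous_apply _) _)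
    (fun _ => continuous_apply _) _

theorem lift_zero (s : Bool) (ω : Config) : lift s ω 0 = s := rfl

/-- The lift integrates `ω` along the row through the origin and then along columns, so walls across
columns are right by construction. The parity relations at the two triangles of a rhombus carry the
correct walls from one row to the next. -/
theorem cob_lift {ω : Config} (hω : IsLoopConfig ω) (s : Bool) : cob (lift s ω) = ω := by
  rw [isLoopConfig_iff] at hω
  have hB : ∀ p : Face, lift s ω (p + (0, 1)) = (lift s ω p ^^ ω (edgeB p)) := by
    rintro ⟨a, b⟩
    simp only [lift, Prod.mk_add_mk, add_zero, potential_succ]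
  have hC : ∀ a b : ℤ, lift s ω (a + 1, b) = (lift s ω (a, b) ^^ ω (edgeC (a, b))) := by
    intro a b
    induction b using Int.induction_on with
    | zero => simp only [lift, potential_zero, potential_succ]
    | succ b ih =>
      have h1 := hω (a, b)
      have h2 := hB (a, b)
      have h3 := hB (a + 1, b)
      simp only [Prod.mk_add_mk, add_zero] at h1 h2 h3
      rw [h2, h3, ih]
      rw [h1.1] at h1
      have := h1.2
      generalize ω (edgeB (a, b)) = x1, ω (edgeC (a, b)) = x2, ω (edgeB (a + 1, b)) = x3,
        ω (edgeC (a, b + 1)) = x4, lift s ω (a, b) = x5 at *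
      clear h1 h2 h3 ih hω hB
      revert x1 x2 x3 x4 x5
      decide
    | pred b ih =>
      have h1 := hω (a, -b - 1)
      have h2 := hB (a, -b - 1)
      have h3 := hB (a + 1, -b - 1)
      simp only [Prod.mk_add_mk, add_zero, sub_add_cancel] at h1 h2 h3
      rw [h2, h3] at ih
      rw [h1.1] at h1
      have := h1.2
      generalize ω (edgeB (a, -b - 1)) = x1, ω (edgeC (a, -b - 1)) = x2,
        ω (edgeB (a + 1, -b - 1)) = x3,
        ω (edgeC (a, -b)) = x4, lift s ω (a, -b - 1) = x5, lift s ω (a + 1, -b - 1) = x6 at *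
      clear h1 h2 h3 hω hB
      revert x1 x2 x3 x4 x5 x6
      decide
  refine config_ext fun p => ?_
  have h1 := hB p
  have h2 : lift s ω (p + (1, 0)) = (lift s ω p ^^ ω (edgeC p)) := by
    have := hC p.1 p.2
    rwa [show (p.1 + 1, p.2) = p + (1, 0) by simp [Prod.ext_iff]] at this
  simp only [cob_edgeA, cob_edgeB, cob_edgeC, h2, h1, (hω p).1]
  generalize lift s ω p = x, ω (edgeB p) = y, ω (edgeC p) = z
  revert x y z
  decide

theorem eq_of_cob_eq {σ τ : Spin} (h : cob σ = cob τ) (h0 : σ 0 = τ 0) : σ = τ := by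
  have hB : ∀ p, (σ p ^^ σ (p + (0, 1))) = (τ p ^^ τ (p + (0, 1))) := fun p => by
    simpa using congrFun h (edgeB p)
  have hC : ∀ p, (σ p ^^ σ (p + (1, 0))) = (τ p ^^ τ (p + (1, 0))) := fun p => by
    simpa using congrFun h (edgeC p)
  have key : ∀ x x' y y' : Bool, (x ^^ x') = (y ^^ y') → (x = y ↔ x' = y') := by decide
  have h1 : ∀ a : ℤ, σ (a, 0) = τ (a, 0) := by
    intro a
    induction a using Int.induction_on with
    | zero => exact h0
    | succ a ih => simpa using (key _ _ _ _ (hC (a, 0))).1 ih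
    | pred a ih => exact (key _ _ _ _ (hC (-a - 1, 0))).2 (by simpa using ih)
  funext ⟨a, b⟩
  induction b using Int.induction_on with
  | zero => exact h1 a
  | succ b ih => simpa using (key _ _ _ _ (hB (a, b))).1 ih
  | pred b ih => exact (key _ _ _ _ (hB (a, -b - 1))).2 (by simpa using ih)

theorem exists_spin {ω : Config} (hω : IsLoopConfig ω) : ∃ σ, cob σ = ω := ⟨_, cob_lift hω true⟩

theorem cob_not (σ : Spin) : cob (fun f => !σ f) = cob σ :=
  config_ext fun p => by simp

/-! ### Bi-infinite paths and infinite clusters -/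

theorem exists_dual_faces {v w : HexVertex} (h : hexLattice.Adj v w) : ∃ f g : Face,
    (f ∈ facesAt v ∧ f ∈ facesAt w) ∧ (g ∈ facesAt v ∧ g ∈ facesAt w) ∧
    ∀ σ, cob σ ⟨s(v, w), h⟩ = (σ f ^^ σ g) := by
  have key : ∀ (p : Face) (w : HexVertex) (h : hexLattice.Adj (p, false) w), ∃ f g : Face,
      (f ∈ facesAt (p, false) ∧ f ∈ facesAt w) ∧ (g ∈ facesAt (p, false) ∧ g ∈ facesAt w) ∧
      ∀ σ, cob σ ⟨s((p, false), w), h⟩ = (σ f ^^ σ g) := by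
    intro p w h
    rcases hexLattice_adj_up.1 h with rfl | rfl | rfl
    · exact ⟨p + (1, 0), p + (0, 1), by simp [facesAt], by simp [facesAt],
        fun σ => cob_edgeA σ p⟩
    · exact ⟨p, p + (0, 1), by simp [facesAt], by simp [facesAt, Prod.ext_iff],
        fun σ => cob_edgeB σ p⟩
    · exact ⟨p, p + (1, 0), by simp [facesAt], by simp [facesAt, Prod.ext_iff],
        fun σ => cob_edgeC σ p⟩
  obtain ⟨p, b⟩ := v
  cases b
  · exact key p w h
  · obtain ⟨q, b'⟩ := w
    cases b'
    · obtain ⟨f, g, hf, hg, h'⟩ := key q (p, true) h.symm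
      refine ⟨f, g, hf.symm, hg.symm, fun σ => ?_⟩
      rw [← h' σ]
      congr 1
      exact Subtype.ext Sym2.eq_swap
    · simp [hexLattice] at h

theorem exists_dual_edge {f g : Face} (h : triLattice.Adj f g) :
    ∃ e, ∀ σ, cob σ e = (σ f ^^ σ g) := by
  simp only [triLattice, SimpleGraph.fromRel_adj] at h
  rcases h.2 with (h | h | h) | (h | h | h) <;> subst h
  · exact ⟨edgeC f, fun σ => cob_edgeC σ f⟩
  · exact ⟨edgeB f, fun σ => cob_edgeB σ f⟩
  · refine ⟨edgeA (f - (1, 0)), fun σ => ?_⟩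
    rw [cob_edgeA, sub_add_cancel, sub_add]
    rfl
  · exact ⟨edgeC g, fun σ => by rw [cob_edgeC, Bool.xor_comm]⟩
  · exact ⟨edgeB g, fun σ => by rw [cob_edgeB, Bool.xor_comm]⟩
  · refine ⟨edgeA (g - (1, 0)), fun σ => ?_⟩
    rw [cob_edgeA, sub_add_cancel, sub_add, Bool.xor_comm]
    rfl

theorem triLattice_adj_of_mem_facesAt {v : HexVertex} {f g : Face} (hf : f ∈ facesAt v)
    (hg : g ∈ facesAt v) (hne : f ≠ g) : triLattice.Adj f g := by
  obtain ⟨p, b⟩ := v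
  simp only [triLattice, SimpleGraph.fromRel_adj]
  refine ⟨hne, ?_⟩
  cases b
  · simp only [facesAt, Set.mem_insert_iff, Set.mem_singleton_iff] at hf hg
    rcases hf with rfl | rfl | rfl <;> rcases hg with rfl | rfl | rfl <;>
      simp [Prod.ext_iff] at hne ⊢
  · simp only [facesAt, Set.mem_insert_iff, Set.mem_singleton_iff] at hf hg
    rcases hf with rfl | rfl | rfl <;> rcases hg with rfl | rfl | rfl <;>
      simp [Prod.ext_iff, add_assoc] at hne ⊢

theorem finite_vertices_of_face (f : Face) : {v : HexVertex | f ∈ facesAt v}.Finite := by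
  refine ((Set.finite_Icc (f.1 - 1, f.2 - 1) (f.1, f.2)).prod
    (Set.finite_univ (α := Bool))).subset ?_
  rintro ⟨p, b⟩ h
  simp only [Set.mem_prod, Set.mem_univ, and_true, Set.mem_Icc, Prod.le_def]
  cases b <;> simp only [facesAt, Set.mem_insert_iff, Set.mem_singleton_iff, Set.mem_ofPred_eq] at h <;>
    rcases h with rfl | rfl | rfl <;> simp

theorem exists_true_false_faces {σ : Spin} {v w : HexVertex} (h : (toGraph (cob σ)).Adj v w) :
    ∃ f g : Face, (f ∈ facesAt v ∧ f ∈ facesAt w ∧ σ f = true) ∧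
      (g ∈ facesAt v ∧ g ∈ facesAt w ∧ σ g = false) ∧
      ∃ h' : hexLattice.Adj v w, ∀ τ, cob τ ⟨s(v, w), h'⟩ = (τ f ^^ τ g) := by
  obtain ⟨h', h1⟩ := toGraph_adj.1 h
  obtain ⟨f, g, hf, hg, hfg⟩ := exists_dual_faces h'
  rw [hfg] at h1
  cases hσ : σ f
  · exact ⟨g, f, ⟨hg.1, hg.2, by simpa [hσ] using h1⟩, ⟨hf.1, hf.2, hσ⟩, h',
      fun τ => by rw [hfg, Bool.xor_comm]⟩
  · exact ⟨f, g, ⟨hf.1, hf.2, hσ⟩, ⟨hg.1, hg.2, by simpa [hσ] using h1⟩, h', hfg⟩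

theorem reachable_of_mem_facesAt {σ : Spin} {v : HexVertex} {f g : Face} (hf : f ∈ facesAt v)
    (hg : g ∈ facesAt v) (hσf : σ f = true) (hσg : σ g = true) :
    (siteGraph triLattice (occ σ)).Reachable f g := by
  by_cases h : f = g
  · rw [h]
  · exact SimpleGraph.Adj.reachable ⟨triLattice_adj_of_mem_facesAt hf hg h, hσf, hσg⟩

/-- The faces around a vertex are mutually adjacent, so following a wall never leaves the cluster of
true faces along it. -/
theorem reachable_face_of_reachable {σ : Spin} {v w : HexVertex}
    (h : (toGraph (cob σ)).Reachable v w) {f g : Face} (hf : f ∈ facesAt v) (hg : g ∈ facesAt w)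
    (hσf : σ f = true) (hσg : σ g = true) : (siteGraph triLattice (occ σ)).Reachable f g := by
  obtain ⟨p⟩ := h
  induction p generalizing f with
  | nil => exact reachable_of_mem_facesAt hf hg hσf hσg
  | cons h _ ih =>
    obtain ⟨f', -, ⟨h1, h2, h3⟩, -⟩ := exists_true_false_faces h
    exact (reachable_of_mem_facesAt hf h1 hσf h3).trans (ih h2 hg h3)

/-- Every vertex of the path borders a true face of the same cluster. Each face borders finitely
many vertices, so an infinite path needs infinitely many such faces. -/
theorem inInfCluster_of_biInfinite {σ : Spin} {C : (toGraph (cob σ)).ConnectedComponent}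
    (hC : IsBiInfinitePath (cob σ) C) {v : HexVertex} (hv : v ∈ C.supp) {f : Face}
    (hf : f ∈ facesAt v) (hσf : σ f = true) : InInfCluster σ f := by
  intro hfin
  refine hC.1 ((hfin.biUnion fun g _ => finite_vertices_of_face g).subset fun w hw => ?_)
  obtain ⟨w', hw'⟩ : ((toGraph (cob σ)).neighborSet w).Nonempty := by
    rw [← Set.ncard_pos (Set.finite_of_ncard_ne_zero (by rw [hC.2 w hw]; norm_num)), hC.2 w hw]
    norm_num
  obtain ⟨g, -, ⟨h1, -, h3⟩, -⟩ := exists_true_false_faces hw'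
  refine Set.mem_iUnion₂.2 ⟨g, ?_, h1⟩
  refine reachable_face_of_reachable (SimpleGraph.ConnectedComponent.eq.1 ?_) hf h1 hσf h3
  rw [SimpleGraph.ConnectedComponent.mem_supp_iff] at hv hw
  rw [hv, hw]

theorem isLoopConfig_component {ω : Config} (hω : IsLoopConfig ω)
    (C : (toGraph ω).ConnectedComponent) [DecidablePred fun e : hexLattice.edgeSet =>
      ∃ v ∈ C.supp, v ∈ (e : Sym2 HexVertex)] :
    IsLoopConfig fun e => ω e && decide (∃ v ∈ C.supp, v ∈ (e : Sym2 HexVertex)) := by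
  intro v
  set ω₁ : Config := fun e => ω e && decide (∃ v ∈ C.supp, v ∈ (e : Sym2 HexVertex)) with h1
  have hadj : ∀ w, (toGraph ω₁).Adj v w ↔ (toGraph ω).Adj v w ∧ v ∈ C.supp := by
    intro w
    constructor
    · intro h
      obtain ⟨h, h'⟩ := toGraph_adj.1 h
      simp only [h1, Bool.and_eq_true, decide_eq_true_eq] at h'
      have hvw : (toGraph ω).Adj v w := toGraph_adj.2 ⟨h, h'.1⟩
      refine ⟨hvw, ?_⟩
      obtain ⟨u, hu, hu'⟩ := h'.2
      rcases Sym2.mem_iff.1 hu' with rfl | rfl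
      · exact hu
      · exact (C.mem_supp_congr_adj hvw).2 hu
    · rintro ⟨h, hv⟩
      obtain ⟨h, h'⟩ := toGraph_adj.1 h
      refine toGraph_adj.2 ⟨h, ?_⟩
      simp only [h1, Bool.and_eq_true, decide_eq_true_eq]
      exact ⟨h', v, hv, by simp⟩
  by_cases hv : v ∈ C.supp
  · have : (toGraph ω₁).neighborSet v = (toGraph ω).neighborSet v := by
      ext w
      simp [hadj, hv]
    rw [this]
    exact hω v
  · have : (toGraph ω₁).neighborSet v = ∅ := by
      ext w
      simp [hadj, hv]
    simp [this]

/-- If there is at most one infinite cluster of each spin, then there is at most one bi-infinite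
domain wall. -/
theorem subsingleton_biInfinite {σ : Spin} (h₁ : ∀ u v, ¬InDistinct σ u v)
    (h₂ : ∀ u v, ¬InDistinct (fun f => !σ f) u v) :
    {C : (toGraph (cob σ)).ConnectedComponent | IsBiInfinitePath (cob σ) C}.Subsingleton := by
  classical
  intro C hC C' hC'
  by_contra hne
  -- The walls of `σ₁` are exactly the edges of `C`. Hence `σ₁` can change only across walls of `σ`,
  -- and it is constant on the clusters of both spins.
  obtain ⟨σ₁, hσ₁⟩ := exists_spin (isLoopConfig_component (isLoopConfig_cob σ) C)
  have hconst : ∀ τ : Spin, cob τ = cob σ → ∀ f g,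
      (siteGraph triLattice (occ τ)).Reachable f g → σ₁ f = σ₁ g := by
    rintro τ hτ f g ⟨p⟩
    induction p with
    | nil => rfl
    | @cons a b c h _ ih =>
      rw [← ih]
      obtain ⟨e, he⟩ := exists_dual_edge h.1
      have ha : τ a = true := h.2.1
      have hb : τ b = true := h.2.2
      have h3 := congrFun hσ₁ e
      have h4 : cob σ e = false := by rw [← hτ, he, ha, hb]; rfl
      rw [he] at h3
      simp only [h4, Bool.false_and] at h3
      simpa using h3
  have hnbr : ∀ C : (toGraph (cob σ)).ConnectedComponent, IsBiInfinitePath (cob σ) C →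
      ∃ v w, v ∈ C.supp ∧ w ∈ C.supp ∧ (toGraph (cob σ)).Adj v w := by
    intro C hC
    obtain ⟨v, hv⟩ := hC.1.nonempty
    obtain ⟨w, hw⟩ : ((toGraph (cob σ)).neighborSet v).Nonempty := by
      rw [← Set.ncard_pos (Set.finite_of_ncard_ne_zero (by rw [hC.2 v hv]; norm_num)), hC.2 v hv]
      norm_num
    exact ⟨v, w, hv, (C.mem_supp_congr_adj hw).1 hv, hw⟩
  obtain ⟨v, w, hv, hw, hvw⟩ := hnbr C hC
  obtain ⟨v', w', hv', hw', hvw'⟩ := hnbr C' hC'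
  obtain ⟨f, g, hf, hg, h, hfg⟩ := exists_true_false_faces hvw
  obtain ⟨f', g', hf', hg', h', hfg'⟩ := exists_true_false_faces hvw'
  -- The reversed spins have the same walls, so the statement for true faces also gives infinite
  -- clusters of false faces.
  have hC₂ : ∀ C : (toGraph (cob σ)).ConnectedComponent, IsBiInfinitePath (cob σ) C →
      ∀ v ∈ C.supp, ∀ g ∈ facesAt v, σ g = false → InInfCluster (fun f => !σ f) g := by
    intro C hC v hv g hg hσ
    have := cob_not σ
    revert C
    rw [← this]
    intro C hC hv
    exact inInfCluster_of_biInfinite hC hv hg (by simp [hσ])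
  have e1 : σ₁ f = σ₁ f' := by
    refine hconst σ rfl f f' (by_contra fun hcon => h₁ f f' ⟨?_, ?_, hcon⟩)
    · exact inInfCluster_of_biInfinite hC hv hf.1 hf.2.2
    · exact inInfCluster_of_biInfinite hC' hv' hf'.1 hf'.2.2
  have e2 : σ₁ g = σ₁ g' := by
    refine hconst _ (cob_not σ) g g' (by_contra fun hcon => h₂ g g' ⟨?_, ?_, hcon⟩)
    · exact hC₂ C hC v hv g hg.1 hg.2.2
    · exact hC₂ C' hC' v' hv' g' hg'.1 hg'.2.2
  have h3 := congrFun hσ₁ ⟨s(v, w), h⟩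
  have h4 := congrFun hσ₁ ⟨s(v', w'), h'⟩
  have hnot : ¬∃ u ∈ C.supp, u ∈ s(v', w') := by
    rintro ⟨u, hu, hu'⟩
    have hu'' : u ∈ C'.supp := by
      rcases Sym2.mem_iff.1 hu' with rfl | rfl
      exacts [hv', hw']
    rw [SimpleGraph.ConnectedComponent.mem_supp_iff] at hu hu''
    exact hne (hu.symm.trans hu'')
  rw [hfg] at h3
  rw [hfg', hfg'] at h4
  have hin : ∃ u ∈ C.supp, u ∈ s(v, w) := ⟨v, hv, by simp⟩
  simp only [hfg, hf.2.2, hg.2.2, hin, e1, e2, decide_true] at h3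
  simp only [hnot, decide_false, Bool.and_false] at h4
  rw [h4] at h3
  simp at h3

/-! ### From loop configurations to spin configurations -/

/-- Symmetric difference of two configurations. -/
def xorConfig (κ ω : Config) : Config := fun e => κ e ^^ ω e

theorem continuous_xorConfig (κ : Config) : Continuous (xorConfig κ) :=
  continuous_pi fun e => (continuous_of_discreteTopology (f := fun b => κ e ^^ b)).comp
    (continuous_apply e)

/-- The boundary of the face `f`. -/
def hexagon (f : Face) : Config := cob fun g => decide (g = f)

theorem cob_flipSpin (f : Face) (σ : Spin) : cob (flipSpin f σ) = xorConfig (hexagon f) (cob σ) := by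
  have hflip : ∀ g, flipSpin f σ g = (decide (g = f) ^^ σ g) := fun g => by
    by_cases h : g = f
    · subst h; simp [flipSpin]
    · simp [flipSpin, h]
  have key : ∀ a b c d : Bool, ((a ^^ b) ^^ (c ^^ d)) = ((a ^^ c) ^^ (b ^^ d)) := by decide
  refine config_ext fun p => ?_
  simp only [hexagon, xorConfig, cob_edgeA, cob_edgeB, cob_edgeC, hflip, key, and_self]

theorem finite_hexagon (f : Face) : {e | hexagon f e = true}.Finite := by
  have : {e | hexagon f e = true} ⊆ {edgeA (f - (1, 0)), edgeA (f - (0, 1)), edgeB f,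
      edgeB (f - (0, 1)), edgeC f, edgeC (f - (1, 0))} := by
    intro e he
    simp only [Set.mem_ofPred_eq] at he
    have key : ∀ a b : Bool, (a ^^ b) = true → a = true ∨ b = true := by decide
    obtain ⟨p, rfl | rfl | rfl⟩ := edge_cases e
    · rw [hexagon, cob_edgeA] at he
      rcases key _ _ he with h | h
      · simp [← eq_sub_iff_add_eq.2 (of_decide_eq_true h)]
      · simp [← eq_sub_iff_add_eq.2 (of_decide_eq_true h)]
    · rw [hexagon, cob_edgeB] at he
      rcases key _ _ he with h | h
      · simp [of_decide_eq_true h]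
      · simp [← eq_sub_iff_add_eq.2 (of_decide_eq_true h)]
    · rw [hexagon, cob_edgeC] at he
      rcases key _ _ he with h | h
      · simp [of_decide_eq_true h]
      · simp [← eq_sub_iff_add_eq.2 (of_decide_eq_true h)]
  exact (Set.toFinite _).subset this

theorem translate_edge (g p : Face) : (translate g).mapEdgeSet (edgeA p) = edgeA (p + g) ∧
    (translate g).mapEdgeSet (edgeB p) = edgeB (p + g) ∧
    (translate g).mapEdgeSet (edgeC p) = edgeC (p + g) := by
  refine ⟨Subtype.ext ?_, Subtype.ext ?_, Subtype.ext ?_⟩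
  · simp [translate, edgeA, add_comm]
  · simp [translate, edgeB, add_comm, add_sub_assoc]
  · simp [translate, edgeC, add_comm, add_sub_assoc]

theorem shift_edge (g p : Face) (ω : Config) : shift g ω (edgeA p) = ω (edgeA (p - g)) ∧
    shift g ω (edgeB p) = ω (edgeB (p - g)) ∧ shift g ω (edgeC p) = ω (edgeC (p - g)) := by
  have h := translate_edge g (p - g)
  rw [sub_add_cancel] at h
  refine ⟨congrArg ω ?_, congrArg ω ?_, congrArg ω ?_⟩
  · rw [Equiv.symm_apply_eq, h.1]
  · rw [Equiv.symm_apply_eq, h.2.1]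
  · rw [Equiv.symm_apply_eq, h.2.2]

theorem shift_cob (g : Face) (σ : Spin) : shift g (cob σ) = cob (shiftSpin g σ) := by
  refine config_ext fun p => ?_
  simp [shift_edge, shiftSpin, add_sub_right_comm]

theorem isLoopConfig_shift {ω : Config} (h : IsLoopConfig ω) (g : Face) :
    IsLoopConfig (shift g ω) := by
  obtain ⟨σ, rfl⟩ := exists_spin h
  rw [shift_cob]
  exact isLoopConfig_cob _

theorem xorConfig_self (κ ω : Config) : xorConfig κ (xorConfig κ ω) = ω := by
  funext e
  simp [xorConfig]

theorem isLoopConfig_xorConfig {κ ω : Config} (hκ : IsLoopConfig κ) (hω : IsLoopConfig ω) :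
    IsLoopConfig (xorConfig κ ω) := by
  rw [isLoopConfig_iff] at *
  have key : ∀ a b c d : Bool, ((a ^^ b) ^^ (c ^^ d)) = ((a ^^ c) ^^ (b ^^ d)) := by decide
  intro p
  simp only [xorConfig]
  rw [(hκ p).1, (hω p).1, key]
  refine ⟨rfl, ?_⟩
  rw [← key, ← (hκ p).1, ← (hω p).1, (hκ p).2, (hω p).2, key]

/-! ### Transferring invariance and tolerance to the spins -/

/-- The law of a spin configuration with given domain walls and a uniform spin at the origin. -/
def spinLaw (μ : Measure Config) : Measure Spin :=
  (2⁻¹ : ℝ≥0∞) • (μ.map (lift true) + μ.map (lift false))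

theorem measurable_lift (s : Bool) : Measurable (lift s) := (continuous_lift s).measurable

theorem spinLaw_apply (μ : Measure Config) {A : Set Spin} (hA : MeasurableSet A) :
    spinLaw μ A = 2⁻¹ * (μ (lift true ⁻¹' A) + μ (lift false ⁻¹' A)) := by
  simp [spinLaw, Measure.map_apply (measurable_lift _) hA, mul_add]

theorem isProbabilityMeasure_spinLaw (μ : Measure Config) [IsProbabilityMeasure μ] :
    IsProbabilityMeasure (spinLaw μ) := by
  constructor
  rw [spinLaw_apply μ .univ]
  simp [one_add_one_eq_two, ENNReal.inv_mul_cancel]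

theorem spinLaw_apply_lintegral (μ : Measure Config) {A : Set Spin} (hA : MeasurableSet A) :
    spinLaw μ A = 2⁻¹ * ∫⁻ ω, A.indicator 1 (lift true ω) + A.indicator 1 (lift false ω) ∂μ := by
  have h1 : Measurable (A.indicator (1 : Spin → ℝ≥0∞)) := measurable_one.indicator hA
  have h2 := lintegral_add_left (μ := μ) (h1.comp (measurable_lift true))
    fun ω => A.indicator 1 (lift false ω)
  simp only [Function.comp_apply] at h2
  rw [spinLaw_apply μ hA, h2]
  congr 2
  · exact (lintegral_indicator_one (measurable_lift true hA)).symm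
  · exact (lintegral_indicator_one (measurable_lift false hA)).symm

theorem map_shiftSpin_spinLaw {μ : Measure Config} (hloop : ∀ᵐ ω ∂μ, IsLoopConfig ω)
    (hTI : IsTranslationInvariant μ) (g : Face) :
    (spinLaw μ).map (shiftSpin g) = spinLaw μ := by
  ext A hA
  rw [Measure.map_apply (measurable_shiftSpin g) hA, spinLaw_apply_lintegral μ hA,
    spinLaw_apply_lintegral μ (measurable_shiftSpin g hA)]
  have h1 : Measurable (A.indicator (1 : Spin → ℝ≥0∞)) := measurable_one.indicator hA
  have h2 : Measurable fun ω : Config => (A.indicator 1 (lift true ω) : ℝ≥0∞) +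
      A.indicator 1 (lift false ω) :=
    (h1.comp (measurable_lift true)).add (h1.comp (measurable_lift false))
  conv_rhs => rw [← hTI g]
  rw [lintegral_map h2 (measurable_shift g)]
  congr 1
  refine lintegral_congr_ae ?_
  filter_upwards [hloop] with ω hω
  -- The new spin at the origin is the old spin at `-g`. It takes opposite values for the two
  -- choices of `s`, so translation at most exchanges the two halves of the mixture.
  have key : ∀ s, shiftSpin g (lift s ω) = lift (lift s ω (-g)) (shift g ω) := fun s => by
    refine eq_of_cob_eq ?_ ?_
    · rw [cob_lift (isLoopConfig_shift hω g), ← shift_cob, cob_lift hω]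
    · simp [lift_zero, shiftSpin]
  have hneg : lift false ω (-g) = !lift true ω (-g) := by
    have : lift false ω = fun f => !lift true ω f := by
      refine eq_of_cob_eq ?_ ?_
      · rw [cob_not, cob_lift hω, cob_lift hω]
      · simp [lift_zero]
    rw [this]
  have hpre : ∀ σ, (shiftSpin g ⁻¹' A).indicator (1 : Spin → ℝ≥0∞) σ =
      A.indicator 1 (shiftSpin g σ) := fun σ => rfl
  rw [hpre, hpre, key, key, hneg]
  cases lift true ω (-g)
  · exact add_comm _ _
  · rfl

/-- A law on configurations for which flipping the boundary of a face distorts probabilities by at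
most a bounded factor. -/
def HexagonTolerant (μ : Measure Config) : Prop :=
  ∀ f, ∃ C : ℝ≥0∞, C ≠ ⊤ ∧ ∀ A, MeasurableSet A → μ (xorConfig (hexagon f) ⁻¹' A) ≤ C * μ A

/-- Flipping the spin at `f` toggles the walls around `f`, and exchanges the two lifts precisely
when `f` is the origin. -/
theorem flipTolerant_spinLaw {μ : Measure Config} (hloop : ∀ᵐ ω ∂μ, IsLoopConfig ω)
    (hμ : HexagonTolerant μ) : FlipTolerant (spinLaw μ) := by
  intro f
  obtain ⟨C, hC, hCA⟩ := hμ f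
  refine ⟨C, hC, fun A hA => ?_⟩
  have key : ∀ s, μ (lift s ⁻¹' (flipSpin f ⁻¹' A)) ≤
      C * μ (lift (if f = 0 then !s else s) ⁻¹' A) := by
    intro s
    refine le_trans (measure_mono_ae ?_) (hCA _ (measurable_lift _ hA))
    filter_upwards [hloop] with ω hω
    have : flipSpin f (lift s ω) = lift (if f = 0 then !s else s) (xorConfig (hexagon f) ω) := by
      refine eq_of_cob_eq ?_ ?_
      · rw [cob_flipSpin, cob_lift hω, cob_lift]
        exact isLoopConfig_xorConfig (isLoopConfig_cob _) hω
      · by_cases h : f = 0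
        · subst h
          simp [lift_zero, flipSpin]
        · simp [lift_zero, flipSpin, h, Function.update_of_ne (Ne.symm h)]
    intro h
    change flipSpin f (lift s ω) ∈ A at h
    change lift _ (xorConfig (hexagon f) ω) ∈ A
    rwa [← this]
  rw [spinLaw_apply μ hA, spinLaw_apply μ (measurable_flipSpin f hA)]
  have h1 := add_le_add (key true) (key false)
  rw [mul_left_comm]
  gcongr
  refine h1.trans (le_of_eq ?_)
  by_cases h : f = 0
  · simp only [h, if_true, Bool.not_true, Bool.not_false]
    rw [← mul_add, add_comm]
  · simp only [h, if_false]
    rw [← mul_add]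

/-- A translation-invariant, hexagon tolerant law on loop configurations has almost surely at most
one bi-infinite path. -/
theorem ae_subsingleton_biInfinite {μ : Measure Config} [IsProbabilityMeasure μ]
    (hloop : ∀ᵐ ω ∂μ, IsLoopConfig ω) (hTI : IsTranslationInvariant μ) (hμ : HexagonTolerant μ) :
    ∀ᵐ ω ∂μ, {C : (toGraph ω).ConnectedComponent | IsBiInfinitePath ω C}.Subsingleton := by
  have := isProbabilityMeasure_spinLaw μ
  have h := inDistinct_null (map_shiftSpin_spinLaw hloop hTI) (flipTolerant_spinLaw hloop hμ)
  rw [spinLaw, Measure.ae_ennreal_smul_measure_iff (by simp), ae_add_measure_iff] at h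
  filter_upwards [hloop, ae_of_ae_map (measurable_lift true).aemeasurable h.1,
    ae_of_ae_map (measurable_lift false).aemeasurable h.2] with ω hω h1 h2
  -- The two lifts are opposite, so uniqueness for both of them is uniqueness for both spins of one
  -- lift.
  have hneg : lift false ω = fun f => !lift true ω f := by
    refine eq_of_cob_eq ?_ ?_
    · rw [cob_not, cob_lift hω, cob_lift hω]
    · simp [lift_zero]
  rw [hneg] at h2
  have := subsingleton_biInfinite h1 h2
  rwa [cob_lift hω] at this

/-! ### Counting loops -/

/-- The vertex sets of the loops and bi-infinite paths of a loop configuration. -/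
def strands (ω : Config) : Set (Set HexVertex) :=
  {S | ∃ u, (∃ w, (toGraph ω).Adj u w) ∧ S = {v | (toGraph ω).Reachable u v}}

theorem exists_adj_of_reachable {V : Type*} {G : SimpleGraph V} {u v : V} (h : G.Reachable u v)
    (hu : ∃ w, G.Adj u w) : ∃ w, G.Adj v w := by
  obtain ⟨p⟩ := h
  induction p with
  | nil => exact hu
  | cons h _ ih => exact ih ⟨_, h.symm⟩

theorem isLoop_or_isBiInfinitePath_iff {ω : Config} (hω : IsLoopConfig ω)
    (C : (toGraph ω).ConnectedComponent) :
    IsLoop ω C ∨ IsBiInfinitePath ω C ↔ ∃ u ∈ C.supp, ∃ w, (toGraph ω).Adj u w := by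
  constructor
  · intro h
    have h' : ∀ v ∈ C.supp, ((toGraph ω).neighborSet v).ncard = 2 := h.elim (·.2) (·.2)
    obtain ⟨u, hu⟩ := C.nonempty_supp
    have : ((toGraph ω).neighborSet u).Nonempty := Set.nonempty_of_ncard_ne_zero (by simp [h' u hu])
    exact ⟨u, hu, this⟩
  · rintro ⟨u, hu, hw⟩
    have h' : ∀ v ∈ C.supp, ((toGraph ω).neighborSet v).ncard = 2 := by
      intro v hv
      rw [SimpleGraph.ConnectedComponent.mem_supp_iff] at hu hv
      obtain ⟨w, hw⟩ := exists_adj_of_reachable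
        (SimpleGraph.ConnectedComponent.eq.1 (hu.trans hv.symm)) hw
      exact ncard_eq_two_of_adj hω hw
    exact C.supp.finite_or_infinite.imp (⟨·, h'⟩) (⟨·, h'⟩)

/-- Connected components of different configurations have different types; their vertex sets can be
compared. -/
theorem numLoops_eq_strands (D : hexLattice.Subgraph) {ω : Config} (hω : IsLoopConfig ω) :
    numLoops D ω = {S ∈ strands ω | (S ∩ D.verts).Nonempty}.ncard := by
  have hsupp : ∀ u, ((toGraph ω).connectedComponentMk u).supp = {v | (toGraph ω).Reachable u v} := by
    intro u
    ext v
    rw [SimpleGraph.ConnectedComponent.mem_supp_iff, SimpleGraph.ConnectedComponent.eq]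
    exact ⟨fun h => h.symm, fun h => SimpleGraph.Reachable.symm h⟩
  rw [numLoops, ← Set.ncard_image_of_injective _ SimpleGraph.ConnectedComponent.supp_injective]
  congr 1
  ext S
  constructor
  · rintro ⟨C, ⟨hC, hD⟩, rfl⟩
    obtain ⟨u, hu, hw⟩ := (isLoop_or_isBiInfinitePath_iff hω C).1 hC
    refine ⟨⟨u, hw, ?_⟩, hD⟩
    rw [← (SimpleGraph.ConnectedComponent.mem_supp_iff C u).1 hu, hsupp]
  · rintro ⟨⟨u, hw, rfl⟩, hD⟩
    refine ⟨(toGraph ω).connectedComponentMk u, ⟨?_, by rwa [hsupp]⟩, hsupp u⟩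
    exact (isLoop_or_isBiInfinitePath_iff hω _).2 ⟨u, rfl, hw⟩

theorem numLoops_le {D : hexLattice.Subgraph} (hD : D.verts.Finite) (ω : Config) :
    numLoops D ω ≤ D.verts.ncard := by
  refine le_trans (Set.ncard_le_ncard ?_ (hD.image (toGraph ω).connectedComponentMk))
    (Set.ncard_image_le hD)
  rintro C ⟨-, v, hv, hvD⟩
  exact ⟨v, hvD, hv⟩

theorem finite_strands {D : hexLattice.Subgraph} (hD : D.verts.Finite) (ω : Config) :
    {S ∈ strands ω | (S ∩ D.verts).Nonempty}.Finite := by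
  refine (hD.image fun u => {v | (toGraph ω).Reachable u v}).subset ?_
  rintro S ⟨⟨u, -, rfl⟩, v, hv, hvD⟩
  refine ⟨v, hvD, ?_⟩
  ext w
  exact ⟨fun h => SimpleGraph.Reachable.trans hv h,
    fun h => (SimpleGraph.Reachable.symm hv).trans h⟩

/-- `u` and `v` lie on the same loop or bi-infinite path. -/
def SameStrand (ω : Config) (u v : HexVertex) : Prop :=
  (toGraph ω).Reachable u v ∧ ∃ w, (toGraph ω).Adj u w

/-- A strand meeting `D` is determined by its trace on the vertices of `D`. Thus the count depends
only on a relation on a set that is finite when `D` is, which serves both local constancy and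
measurability. -/
theorem numLoops_eq_sameStrand (D : hexLattice.Subgraph) {ω : Config} (hω : IsLoopConfig ω) :
    numLoops D ω = {S | ∃ u ∈ D.verts, SameStrand ω u u ∧
      S = {v | v ∈ D.verts ∧ SameStrand ω u v}}.ncard := by
  rw [numLoops_eq_strands D hω]
  have hinj : Set.InjOn (fun S => S ∩ D.verts) {S ∈ strands ω | (S ∩ D.verts).Nonempty} := by
    rintro S ⟨⟨u, -, rfl⟩, -⟩ S' ⟨⟨u', -, rfl⟩, v, hv, hvD⟩ h
    have hv' : v ∈ {v | (toGraph ω).Reachable u v} ∩ D.verts := by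
      have h' : {v | (toGraph ω).Reachable u v} ∩ D.verts =
        {v | (toGraph ω).Reachable u' v} ∩ D.verts := h
      rw [h']
      exact ⟨hv, hvD⟩
    have huu' : (toGraph ω).Reachable u u' :=
      SimpleGraph.Reachable.trans hv'.1 (SimpleGraph.Reachable.symm hv)
    ext w
    exact ⟨fun h => huu'.symm.trans h, fun h => huu'.trans h⟩
  rw [← hinj.ncard_image]
  congr 1
  ext S
  constructor
  · rintro ⟨S, ⟨⟨u, hw, rfl⟩, v, hv, hvD⟩, rfl⟩
    have hvw := exists_adj_of_reachable hv hw
    refine ⟨v, hvD, ⟨.refl _, hvw⟩, ?_⟩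
    ext w
    constructor
    · rintro ⟨h1, h2⟩
      exact ⟨h2, (SimpleGraph.Reachable.symm hv).trans h1, hvw⟩
    · rintro ⟨h1, h2⟩
      exact ⟨SimpleGraph.Reachable.trans hv h2.1, h1⟩
  · rintro ⟨u, huD, hu, rfl⟩
    refine ⟨_, ⟨⟨u, hu.2, rfl⟩, u, .refl _, huD⟩, ?_⟩
    ext w
    constructor
    · rintro ⟨h1, h2⟩
      exact ⟨h2, h1, hu.2⟩
    · rintro ⟨h1, h2⟩
      exact ⟨h2.1, h1⟩

theorem numLoops_congr (D : hexLattice.Subgraph) {ω ω' : Config} (hω : IsLoopConfig ω)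
    (hω' : IsLoopConfig ω')
    (h : ∀ u ∈ D.verts, ∀ v ∈ D.verts, SameStrand ω u v ↔ SameStrand ω' u v) :
    numLoops D ω = numLoops D ω' := by
  rw [numLoops_eq_sameStrand D hω, numLoops_eq_sameStrand D hω']
  congr 1
  ext S
  refine exists_congr fun u => and_congr_right fun hu => and_congr (h u hu u hu) ?_
  have : {v | v ∈ D.verts ∧ SameStrand ω u v} = {v | v ∈ D.verts ∧ SameStrand ω' u v} := by
    ext v
    exact and_congr_right fun hv => h u hu v hv
  rw [this]

/-! ### Consistency of the weights -/

/-- The two configurations agree outside `D`. -/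
def AgreeOff (D : hexLattice.Subgraph) (ω ω' : Config) : Prop :=
  ∀ e : hexLattice.edgeSet, (e : Sym2 HexVertex) ∉ D.edgeSet → ω e = ω' e

theorem AgreeOff.symm {D : hexLattice.Subgraph} {ω ω' : Config} (h : AgreeOff D ω ω') :
    AgreeOff D ω' ω := fun e he => (h e he).symm

theorem AgreeOff.trans {D : hexLattice.Subgraph} {ω ω' ω'' : Config} (h : AgreeOff D ω ω')
    (h' : AgreeOff D ω' ω'') : AgreeOff D ω ω'' := fun e he => (h e he).trans (h' e he)

theorem AgreeOff.mono {D D' : hexLattice.Subgraph} {ω ω' : Config} (h : AgreeOff D ω ω')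
    (hD : D ≤ D') : AgreeOff D' ω ω' :=
  fun e he => h e fun he' => he (SimpleGraph.Subgraph.edgeSet_mono hD he')

theorem mem_loopConfigs {D : hexLattice.Subgraph} {ω ξ : Config} :
    ω ∈ loopConfigs D ξ ↔ IsLoopConfig ω ∧ AgreeOff D ω ξ := Iff.rfl

theorem AgreeOff.adj {D : hexLattice.Subgraph} {ω ω' : Config} (h : AgreeOff D ω ω')
    {u v : HexVertex} (hu : u ∉ D.verts) : (toGraph ω).Adj u v ↔ (toGraph ω').Adj u v := by
  rw [toGraph_adj, toGraph_adj]
  refine exists_congr fun h' => ?_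
  rw [h]
  exact fun he => hu (D.edge_vert he)

theorem AgreeOff.reachable {D : hexLattice.Subgraph} {ω ω' : Config} (h : AgreeOff D ω ω')
    {u v : HexVertex} (hu : ∀ w, (toGraph ω).Reachable u w → w ∉ D.verts) :
    (toGraph ω).Reachable u v ↔ (toGraph ω').Reachable u v := by
  constructor
  · rintro ⟨p⟩
    induction p with
    | nil => exact .refl _
    | cons hab _ ih =>
      exact ((h.adj (hu _ (.refl _))).1 hab).reachable.trans
        (ih fun w hw => hu w (hab.reachable.trans hw))
  · rintro ⟨p⟩
    induction p with
    | nil => exact .refl _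
    | cons hab _ ih =>
      have hab' := (h.adj (hu _ (.refl _))).2 hab
      exact hab'.reachable.trans (ih fun w hw => hu w (hab'.reachable.trans hw))

theorem AgreeOff.strands {D : hexLattice.Subgraph} {ω ω' : Config} (h : AgreeOff D ω ω')
    {S : Set HexVertex} (hS : S ∈ strands ω) (hSD : ¬(S ∩ D.verts).Nonempty) :
    S ∈ LoopON.strands ω' := by
  obtain ⟨u, ⟨w, hw⟩, rfl⟩ := hS
  have hu : ∀ w, (toGraph ω).Reachable u w → w ∉ D.verts := fun w hw hwD => hSD ⟨w, hw, hwD⟩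
  refine ⟨u, ⟨w, (h.adj (hu u (.refl _))).1 hw⟩, ?_⟩
  ext v
  exact h.reachable hu

/-- The strands that meet `Λ` but miss `D` are the same for both configurations. The additive form
avoids subtraction of natural numbers. -/
theorem numLoops_add {D Λ : hexLattice.Subgraph} (hΛ : Λ.verts.Finite) (hDΛ : D ≤ Λ)
    {ω ω' : Config} (hω : IsLoopConfig ω) (hω' : IsLoopConfig ω') (h : AgreeOff D ω ω') :
    numLoops Λ ω + numLoops D ω' = numLoops Λ ω' + numLoops D ω := by
  have key : ∀ ω, IsLoopConfig ω → numLoops Λ ω = numLoops D ω +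
      {S ∈ strands ω | (S ∩ Λ.verts).Nonempty ∧ ¬(S ∩ D.verts).Nonempty}.ncard := by
    intro ω hω
    rw [numLoops_eq_strands D hω, numLoops_eq_strands Λ hω, ← Set.ncard_union_eq ?_ ?_ ?_]
    · congr 1
      ext S
      have : (S ∩ D.verts).Nonempty → (S ∩ Λ.verts).Nonempty :=
        fun h => h.mono (Set.inter_subset_inter_right _ hDΛ.1)
      simp only [Set.mem_ofPred_eq, Set.mem_union]
      tauto
    · rw [Set.disjoint_left]
      rintro S ⟨-, h1⟩ ⟨-, -, h2⟩
      exact h2 h1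
    · exact finite_strands (hΛ.subset hDΛ.1) ω
    · exact (finite_strands hΛ ω).subset fun S hS => ⟨hS.1, hS.2.1⟩
  rw [key ω hω, key ω' hω']
  have : {S ∈ strands ω | (S ∩ Λ.verts).Nonempty ∧ ¬(S ∩ D.verts).Nonempty} =
      {S ∈ strands ω' | (S ∩ Λ.verts).Nonempty ∧ ¬(S ∩ D.verts).Nonempty} := by
    ext S
    exact ⟨fun hS => ⟨h.strands hS.1 hS.2.2, hS.2⟩, fun hS => ⟨h.symm.strands hS.1 hS.2.2, hS.2⟩⟩
  rw [this]
  ring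

theorem finite_edges {D : hexLattice.Subgraph} (hD : D.verts.Finite) :
    {e : hexLattice.edgeSet | (e : Sym2 HexVertex) ∈ D.edgeSet}.Finite := by
  have hE : D.edgeSet.Finite := by
    refine Set.Finite.subset (Set.Finite.image (fun p : HexVertex × HexVertex => s(p.1, p.2))
      (hD.prod hD)) ?_
    intro e
    induction e using Sym2.ind with
    | _ u v =>
      intro h
      exact ⟨(u, v), ⟨D.edge_vert h, D.edge_vert h.symm⟩, rfl⟩
  exact hE.preimage Subtype.val_injective.injOn

theorem numEdges_le {D : hexLattice.Subgraph} (hD : D.verts.Finite) (ω : Config) :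
    numEdges D ω ≤ {e : hexLattice.edgeSet | (e : Sym2 HexVertex) ∈ D.edgeSet}.ncard :=
  Set.ncard_le_ncard (fun _ h => h.1) (finite_edges hD)

theorem numEdges_add {D Λ : hexLattice.Subgraph} (hΛ : Λ.verts.Finite) (hDΛ : D ≤ Λ)
    {ω ω' : Config} (h : AgreeOff D ω ω') :
    numEdges Λ ω + numEdges D ω' = numEdges Λ ω' + numEdges D ω := by
  have key : ∀ ω, numEdges Λ ω = numEdges D ω +
      {e : hexLattice.edgeSet | ((e : Sym2 HexVertex) ∈ Λ.edgeSet ∧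
        (e : Sym2 HexVertex) ∉ D.edgeSet) ∧ ω e = true}.ncard := by
    intro ω
    rw [numEdges, numEdges, ← Set.ncard_union_eq ?_ ?_ ?_]
    · congr 1
      ext e
      have : (e : Sym2 HexVertex) ∈ D.edgeSet → (e : Sym2 HexVertex) ∈ Λ.edgeSet :=
        fun h => SimpleGraph.Subgraph.edgeSet_mono hDΛ h
      simp only [Set.mem_ofPred_eq, Set.mem_union]
      tauto
    · rw [Set.disjoint_left]
      rintro S ⟨h1, -⟩ ⟨h2, -⟩
      exact h2.2 h1
    · exact (finite_edges (hΛ.subset hDΛ.1)).subset fun _ h => h.1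
    · exact (finite_edges hΛ).subset fun _ h => h.1.1
  rw [key ω, key ω']
  have : {e : hexLattice.edgeSet | ((e : Sym2 HexVertex) ∈ Λ.edgeSet ∧
        (e : Sym2 HexVertex) ∉ D.edgeSet) ∧ ω e = true} =
      {e : hexLattice.edgeSet | ((e : Sym2 HexVertex) ∈ Λ.edgeSet ∧
        (e : Sym2 HexVertex) ∉ D.edgeSet) ∧ ω' e = true} := by
    ext e
    exact and_congr_right fun he => by rw [h e he.2]
  rw [this]
  ring

theorem weight_mul_weight {D Λ : hexLattice.Subgraph} (hΛ : Λ.verts.Finite) (hDΛ : D ≤ Λ)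
    {n x : ℝ} (hn : 0 < n) (hx : 0 < x) {ω ω' : Config} (hω : IsLoopConfig ω)
    (hω' : IsLoopConfig ω') (h : AgreeOff D ω ω') :
    weight Λ n x ω * weight D n x ω' = weight Λ n x ω' * weight D n x ω := by
  simp only [weight]
  rw [← ENNReal.ofReal_mul (by positivity), ← ENNReal.ofReal_mul (by positivity)]
  congr 1
  rw [mul_mul_mul_comm, ← pow_add, ← pow_add, mul_mul_mul_comm, ← pow_add, ← pow_add,
    numEdges_add hΛ hDΛ h, numLoops_add hΛ hDΛ hω hω' h]

theorem weight_ne_zero (D : hexLattice.Subgraph) {n x : ℝ} (hn : 0 < n) (hx : 0 < x)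
    (ω : Config) : weight D n x ω ≠ 0 := by
  rw [weight, ne_eq, ENNReal.ofReal_eq_zero, not_le]
  positivity

theorem weight_ne_top (D : hexLattice.Subgraph) (n x : ℝ) (ω : Config) : weight D n x ω ≠ ⊤ :=
  ENNReal.ofReal_ne_top

theorem exists_weight_le {D : hexLattice.Subgraph} (hD : D.verts.Finite) {n x : ℝ} (hn : 0 < n)
    (hx : 0 < x) : ∃ c : ℝ≥0∞, c ≠ ⊤ ∧ ∀ ω ω', weight D n x ω ≤ c * weight D n x ω' := by
  set K := {e : hexLattice.edgeSet | (e : Sym2 HexVertex) ∈ D.edgeSet}.ncard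
  set L := D.verts.ncard
  let F : ℕ × ℕ → ℝ≥0∞ := fun p => ENNReal.ofReal (x ^ p.1 * n ^ p.2)
  let s : Finset (ℕ × ℕ) := Finset.range (K + 1) ×ˢ Finset.range (L + 1)
  have hF0 : ∀ p, F p ≠ 0 := fun p => by
    simp only [F, ne_eq, ENNReal.ofReal_eq_zero, not_le]
    positivity
  have hs : ∀ ω, (numEdges D ω, numLoops D ω) ∈ s := fun ω => by
    simp only [s, Finset.mem_product, Finset.mem_range, Nat.lt_succ_iff]
    exact ⟨numEdges_le hD ω, numLoops_le hD ω⟩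
  -- Only the finitely many exponents in `s` occur, so the first sum dominates every weight and the
  -- second every inverse weight.
  refine ⟨(∑ p ∈ s, F p) * ∑ p ∈ s, (F p)⁻¹, ENNReal.mul_ne_top ?_ ?_, fun ω ω' => ?_⟩
  · exact ENNReal.sum_ne_top.2 fun p _ => ENNReal.ofReal_ne_top
  · exact ENNReal.sum_ne_top.2 fun p _ => ENNReal.inv_ne_top.2 (hF0 p)
  · have hw : ∀ ω, weight D n x ω = F (numEdges D ω, numLoops D ω) := fun _ => rfl
    have h0 : ∀ G : ℕ × ℕ → ℝ≥0∞, ∀ p ∈ s, G p ≤ ∑ p ∈ s, G p := fun G p hp =>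
      Finset.single_le_sum (fun _ _ => zero_le) hp
    have h1 : weight D n x ω ≤ ∑ p ∈ s, F p := by
      rw [hw]
      exact h0 F _ (hs ω)
    have h2 : (weight D n x ω')⁻¹ ≤ ∑ p ∈ s, (F p)⁻¹ := by
      rw [hw]
      exact h0 (fun p => (F p)⁻¹) _ (hs ω')
    calc weight D n x ω = weight D n x ω * ((weight D n x ω')⁻¹ * weight D n x ω') := by
          rw [ENNReal.inv_mul_cancel (weight_ne_zero D hn hx _) (weight_ne_top _ _ _ _), mul_one]
      _ = weight D n x ω * (weight D n x ω')⁻¹ * weight D n x ω' := by ring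
      _ ≤ _ := by gcongr

/-! ### Atomic measures with a given specification -/

/-- The measure with mass `q ω` at `ω`. -/
def atomic (q : Config → ℝ≥0∞) : Measure Config := Measure.sum fun ω => q ω • Measure.dirac ω

theorem atomic_apply (q : Config → ℝ≥0∞) {A : Set Config} (hA : MeasurableSet A) :
    atomic q A = ∑' ω, q ω * A.indicator 1 ω := by
  simp [atomic, Measure.sum_apply _ hA, hA]

theorem setLIntegral_atomic (q : Config → ℝ≥0∞) {B : Set Config} (hB : MeasurableSet B)
    (f : Config → ℝ≥0∞) : ∫⁻ ω in B, f ω ∂atomic q = ∑' ω, q ω * (B.indicator 1 ω * f ω) := by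
  rw [← lintegral_indicator hB, atomic, lintegral_sum_measure]
  refine tsum_congr fun ω => ?_
  rw [lintegral_smul_measure, lintegral_dirac, smul_eq_mul]
  by_cases h : ω ∈ B <;> simp [h]

/-- The masses `q` are proportional to the weights in `D` among the loop configurations with given
restriction to the complement of `D`. -/
structure Specified (D : hexLattice.Subgraph) (n x : ℝ) (q : Config → ℝ≥0∞) : Prop where
  loop : ∀ ω, q ω ≠ 0 → IsLoopConfig ω
  ratio : ∀ ω ω', IsLoopConfig ω → IsLoopConfig ω' → AgreeOff D ω ω' →
    q ω * weight D n x ω' = q ω' * weight D n x ω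

theorem loopConfigs_eq_of_agreeOff {D : hexLattice.Subgraph} {ω ω' : Config}
    (h : AgreeOff D ω ω') : loopConfigs D ω = loopConfigs D ω' := by
  ext η
  rw [mem_loopConfigs, mem_loopConfigs]
  exact and_congr_right fun _ => ⟨fun h' => h'.trans h, fun h' => h'.trans h.symm⟩

theorem partitionFn_eq_of_agreeOff {D : hexLattice.Subgraph} {n x : ℝ} {ω ω' : Config}
    (h : AgreeOff D ω ω') : partitionFn D n x ω = partitionFn D n x ω' := by
  rw [partitionFn, partitionFn, loopConfigs_eq_of_agreeOff h]

theorem loopMeasure_eq_of_agreeOff {D : hexLattice.Subgraph} {n x : ℝ} {ω ω' : Config}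
    (h : AgreeOff D ω ω') : loopMeasure D n x ω = loopMeasure D n x ω' := by
  rw [loopMeasure, loopMeasure, partitionFn_eq_of_agreeOff h, loopConfigs_eq_of_agreeOff h]

theorem loopMeasure_eq_atomic (D : hexLattice.Subgraph) (n x : ℝ) (ξ : Config) :
    loopMeasure D n x ξ = atomic ((loopConfigs D ξ).indicator
      fun ω => weight D n x ω / partitionFn D n x ξ) := by
  ext A hA
  rw [atomic_apply _ hA, loopMeasure, Measure.sum_apply _ hA]
  simp only [Measure.smul_apply, Measure.dirac_apply' _ hA, smul_eq_mul]
  rw [tsum_subtype (loopConfigs D ξ)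
    fun ω => weight D n x ω / partitionFn D n x ξ * A.indicator 1 ω]
  refine tsum_congr fun ω => ?_
  by_cases h : ω ∈ loopConfigs D ξ <;> simp [h]

theorem specified_loopMeasure {D Λ : hexLattice.Subgraph} (hΛ : Λ.verts.Finite) (hDΛ : D ≤ Λ)
    {n x : ℝ} (hn : 0 < n) (hx : 0 < x) (ξ : Config) :
    Specified D n x ((loopConfigs Λ ξ).indicator
      fun ω => weight Λ n x ω / partitionFn Λ n x ξ) := by
  refine ⟨fun ω h => ?_, fun ω ω' hω hω' h => ?_⟩
  · by_contra hcon
    exact h (Set.indicator_of_notMem (fun h' => hcon h'.1) _)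
  · have h' := h.mono hDΛ
    have hiff : ω ∈ loopConfigs Λ ξ ↔ ω' ∈ loopConfigs Λ ξ := by
      rw [mem_loopConfigs, mem_loopConfigs]
      exact ⟨fun h1 => ⟨hω', h'.symm.trans h1.2⟩, fun h1 => ⟨hω, h'.trans h1.2⟩⟩
    by_cases hmem : ω ∈ loopConfigs Λ ξ
    · rw [Set.indicator_of_mem hmem, Set.indicator_of_mem (hiff.1 hmem),
        div_eq_mul_inv, div_eq_mul_inv, mul_right_comm, weight_mul_weight hΛ hDΛ hn hx hω hω' h,
        mul_right_comm]
    · rw [Set.indicator_of_notMem hmem, Set.indicator_of_notMem (fun h1 => hmem (hiff.2 h1)),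
        zero_mul, zero_mul]

/-- Toggling `κ` changes the mass of an atom by a ratio of two weights in `D`, which is at most `c`
whatever `q` is. This uniformity is what survives the limit. -/
theorem Specified.xor_le {D : hexLattice.Subgraph} {n x : ℝ} (hn : 0 < n)
    (hx : 0 < x) {q : Config → ℝ≥0∞} (hq : Specified D n x q) {κ : Config} (hκ : IsLoopConfig κ)
    (hκD : ∀ e : hexLattice.edgeSet, (e : Sym2 HexVertex) ∉ D.edgeSet → κ e = false)
    {c : ℝ≥0∞} (hc : ∀ ω ω', weight D n x ω ≤ c * weight D n x ω')
    {A : Set Config} (hA : MeasurableSet A) :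
    atomic q (xorConfig κ ⁻¹' A) ≤ c * atomic q A := by
  rw [atomic_apply _ hA, atomic_apply _ ((continuous_xorConfig κ).measurable hA),
    ← ENNReal.tsum_mul_left]
  let σ : Config ≃ Config := ⟨xorConfig κ, xorConfig κ, xorConfig_self κ, xorConfig_self κ⟩
  rw [← σ.tsum_eq fun ω => c * (q ω * A.indicator 1 ω)]
  refine ENNReal.tsum_le_tsum fun ω => ?_
  have hind : (xorConfig κ ⁻¹' A).indicator (1 : Config → ℝ≥0∞) ω = A.indicator 1 (σ ω) := rfl
  rw [hind, ← mul_assoc]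
  gcongr
  by_cases h0 : q ω = 0
  · simp [h0]
  have hω := hq.loop ω h0
  have hω' : IsLoopConfig (σ ω) := isLoopConfig_xorConfig hκ hω
  have hr := hq.ratio ω (σ ω) hω hω' fun e he => by simp [σ, xorConfig, hκD e he]
  have hw := weight_ne_zero D hn hx (σ ω)
  have hw' := weight_ne_top D n x (σ ω)
  rw [← ENNReal.mul_le_mul_iff_left hw hw', hr, mul_assoc, mul_comm c, mul_assoc, mul_comm _ c]
  gcongr
  exact hc _ _

/-! ### Translations -/

theorem shift_mk (g : Face) (ω : Config) {u v : HexVertex} (h : hexLattice.Adj u v)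
    (h' : hexLattice.Adj (translate g u) (translate g v)) :
    shift g ω ⟨s(translate g u, translate g v), h'⟩ = ω ⟨s(u, v), h⟩ := by
  rw [shift]
  congr 1
  rw [Equiv.symm_apply_eq]
  exact Subtype.ext rfl

/-- Translations are isomorphisms of the graphs of the configurations. -/
def translateIso (g : Face) (ω : Config) : toGraph ω ≃g toGraph (shift g ω) where
  toEquiv := (translate g).toEquiv
  map_rel_iff' := by
    intro u v
    rw [toGraph_adj, toGraph_adj]
    constructor
    · rintro ⟨h, h'⟩
      have h1 : hexLattice.Adj u v := (translate g).map_adj_iff.1 h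
      exact ⟨h1, (shift_mk g ω h1 h).symm.trans h'⟩
    · rintro ⟨h, h'⟩
      have h1 : hexLattice.Adj (translate g u) (translate g v) := (translate g).map_adj_iff.2 h
      exact ⟨h1, (shift_mk g ω h h1).trans h'⟩

/-- The translate of a subgraph. -/
def translateSub (g : Face) (D : hexLattice.Subgraph) : hexLattice.Subgraph :=
  D.map (translate g).toHom

theorem mem_translateSub_edgeSet (g : Face) (D : hexLattice.Subgraph) (e : hexLattice.edgeSet) :
    ((translate g).mapEdgeSet e : Sym2 HexVertex) ∈ (translateSub g D).edgeSet ↔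
      (e : Sym2 HexVertex) ∈ D.edgeSet := by
  rw [translateSub, SimpleGraph.Subgraph.edgeSet_map]
  have h : ((translate g).mapEdgeSet e : Sym2 HexVertex) =
    Sym2.map (translate g).toHom (e : Sym2 HexVertex) := rfl
  rw [h]
  exact (Sym2.map.injective (translate g).injective).mem_set_image

theorem numEdges_shift (g : Face) (D : hexLattice.Subgraph) (ω : Config) :
    numEdges (translateSub g D) (shift g ω) = numEdges D ω := by
  rw [numEdges, numEdges]
  refine Eq.trans ?_ (Set.ncard_image_of_injective _ (translate g).mapEdgeSet.injective)
  congr 1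
  ext e
  obtain ⟨e, rfl⟩ := (translate g).mapEdgeSet.surjective e
  rw [Function.Injective.mem_set_image (translate g).mapEdgeSet.injective]
  simp only [Set.mem_ofPred_eq, mem_translateSub_edgeSet, shift, Equiv.symm_apply_apply]

theorem sameStrand_shift (g : Face) (ω : Config) (u v : HexVertex) :
    SameStrand (shift g ω) (translate g u) (translate g v) ↔ SameStrand ω u v := by
  refine and_congr (translateIso g ω).reachable_iff ?_
  constructor
  · rintro ⟨w, hw⟩
    obtain ⟨w, rfl⟩ := (translate g).surjective w
    exact ⟨w, (translateIso g ω).map_adj_iff.1 hw⟩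
  · rintro ⟨w, hw⟩
    exact ⟨translate g w, (translateIso g ω).map_adj_iff.2 hw⟩

theorem numLoops_shift (g : Face) (D : hexLattice.Subgraph) {ω : Config} (hω : IsLoopConfig ω) :
    numLoops (translateSub g D) (shift g ω) = numLoops D ω := by
  rw [numLoops_eq_sameStrand _ hω, numLoops_eq_sameStrand _ (isLoopConfig_shift hω g)]
  refine Eq.trans ?_ (Set.ncard_image_of_injective _ (translate g).injective.image_injective)
  congr 1
  have hset : ∀ u, {v | v ∈ (translateSub g D).verts ∧ SameStrand (shift g ω) (translate g u) v} =
      translate g '' {v | v ∈ D.verts ∧ SameStrand ω u v} := by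
    intro u
    ext v
    obtain ⟨v, rfl⟩ := (translate g).surjective v
    rw [(translate g).injective.mem_set_image]
    simp only [Set.mem_ofPred_eq, sameStrand_shift]
    refine and_congr_left fun _ => ?_
    exact (translate g).injective.mem_set_image
  ext S
  constructor
  · rintro ⟨_, ⟨u, hu, rfl⟩, h1, rfl⟩
    refine ⟨_, ⟨u, hu, (sameStrand_shift g ω u u).1 h1, rfl⟩, (hset u).symm⟩
  · rintro ⟨_, ⟨u, hu, h1, rfl⟩, rfl⟩
    exact ⟨translate g u, ⟨u, hu, rfl⟩, (sameStrand_shift g ω u u).2 h1, (hset u).symm⟩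

theorem weight_shift (g : Face) (D : hexLattice.Subgraph) (n x : ℝ) {ω : Config}
    (hω : IsLoopConfig ω) : weight (translateSub g D) n x (shift g ω) = weight D n x ω := by
  rw [weight, weight, numEdges_shift, numLoops_shift g D hω]

theorem shift_shift (g h : Face) (ω : Config) : shift g (shift h ω) = shift (g + h) ω := by
  refine config_ext fun p => ?_
  simp [shift_edge, sub_sub]

theorem shift_zero (ω : Config) : shift 0 ω = ω := by
  refine config_ext fun p => ?_
  simp [shift_edge]

theorem AgreeOff.shift {D : hexLattice.Subgraph} {ω ω' : Config} (h : AgreeOff D ω ω') (g : Face) :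
    AgreeOff (translateSub g D) (LoopON.shift g ω) (LoopON.shift g ω') := by
  intro e he
  obtain ⟨e, rfl⟩ := (translate g).mapEdgeSet.surjective e
  rw [mem_translateSub_edgeSet] at he
  simpa only [LoopON.shift, Equiv.symm_apply_apply] using h e he

theorem Specified.comp_shift {D : hexLattice.Subgraph} {n x : ℝ} {q : Config → ℝ≥0∞} (g : Face)
    (hq : Specified (translateSub g D) n x q) : Specified D n x fun ω => q (shift g ω) := by
  refine ⟨fun ω h => ?_, fun ω ω' hω hω' h => ?_⟩
  · have := isLoopConfig_shift (hq.loop _ h) (-g)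
    rwa [shift_shift, neg_add_cancel, shift_zero] at this
  · have := hq.ratio _ _ (isLoopConfig_shift hω g) (isLoopConfig_shift hω' g) (h.shift g)
    rwa [weight_shift g D n x hω, weight_shift g D n x hω'] at this

theorem map_shift_atomic (g : Face) (q : Config → ℝ≥0∞) :
    (atomic q).map (shift (-g)) = atomic fun ω => q (shift g ω) := by
  ext A hA
  rw [Measure.map_apply (measurable_shift _) hA, atomic_apply _ hA,
    atomic_apply _ (measurable_shift _ hA)]
  let σ : Config ≃ Config := ⟨shift g, shift (-g),
    fun ω => by rw [shift_shift, neg_add_cancel, shift_zero],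
    fun ω => by rw [shift_shift, add_neg_cancel, shift_zero]⟩
  rw [← σ.tsum_eq]
  refine tsum_congr fun ω => ?_
  have h1 : (shift (-g) ⁻¹' A).indicator (1 : Config → ℝ≥0∞) (σ ω) =
    A.indicator 1 (shift (-g) (shift g ω)) := rfl
  rw [h1, shift_shift, neg_add_cancel, shift_zero]
  rfl

/-! ### Balls of the triangular lattice -/

/-- The distance to the origin is the largest of `|a|`, `|b|` and `|a + b|`: each step changes all
three by at most one, and from any nonzero face some step lowers the maximum. -/
theorem mem_faceBall_iff {k : ℕ} {g : Face} : g ∈ faceBall k 0 ↔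
    (-(k : ℤ) ≤ g.1 ∧ g.1 ≤ k) ∧ (-(k : ℤ) ≤ g.2 ∧ g.2 ≤ k) ∧
      (-(k : ℤ) ≤ g.1 + g.2 ∧ g.1 + g.2 ≤ k) := by
  constructor
  · have key : ∀ (f g : Face) (p : triLattice.Walk f g),
        (-(p.length : ℤ) ≤ g.1 - f.1 ∧ g.1 - f.1 ≤ p.length) ∧
        (-(p.length : ℤ) ≤ g.2 - f.2 ∧ g.2 - f.2 ≤ p.length) ∧
        (-(p.length : ℤ) ≤ g.1 + g.2 - (f.1 + f.2) ∧ g.1 + g.2 - (f.1 + f.2) ≤ p.length) := by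
      intro f g p
      induction p with
      | nil => simp
      | @cons a b c h p ih =>
        have h1 : (-1 ≤ b.1 - a.1 ∧ b.1 - a.1 ≤ 1) ∧ (-1 ≤ b.2 - a.2 ∧ b.2 - a.2 ≤ 1) ∧
            (-1 ≤ b.1 + b.2 - (a.1 + a.2) ∧ b.1 + b.2 - (a.1 + a.2) ≤ 1) := by
          simp only [triLattice, SimpleGraph.fromRel_adj] at h
          rcases h with ⟨-, (h | h | h) | (h | h | h)⟩ <;> subst h <;> simp <;> omega
        simp only [SimpleGraph.Walk.length_cons]
        push_cast
        omega
    intro hg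
    have hg' : triLattice.edist 0 g ≤ k := hg
    have hne : triLattice.edist 0 g ≠ ⊤ := fun h => by simp [h] at hg'
    obtain ⟨p, hp⟩ := SimpleGraph.exists_walk_of_edist_ne_top hne
    rw [← hp] at hg'
    have hl : p.length ≤ k := by exact_mod_cast hg'
    have := key _ _ p
    simp only [Prod.fst_zero, Prod.snd_zero] at this
    omega
  · induction k generalizing g with
    | zero =>
      intro h
      have : g = 0 := by
        simp only [Prod.ext_iff, Prod.fst_zero, Prod.snd_zero]
        omega
      simp [faceBall, this]
    | succ k ih =>
      intro h
      push_cast at h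
      have step : ∀ d : Face, triLattice.Adj (g + d) g ∨ d = 0 →
          (-(k : ℤ) ≤ (g + d).1 ∧ (g + d).1 ≤ k) ∧ (-(k : ℤ) ≤ (g + d).2 ∧ (g + d).2 ≤ k) ∧
          (-(k : ℤ) ≤ (g + d).1 + (g + d).2 ∧ (g + d).1 + (g + d).2 ≤ k) →
          g ∈ faceBall (k + 1) 0 := by
        intro d hd h
        have h1 : triLattice.edist 0 (g + d) ≤ k := ih h
        have h2 : triLattice.edist (g + d) g ≤ 1 := by
          rcases hd with hd | rfl
          · exact (SimpleGraph.edist_eq_one_iff_adj.2 hd).le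
          · simp
        have h3 := (SimpleGraph.edist_triangle (G := triLattice) (u := 0) (v := g + d)
          (w := g)).trans (add_le_add h1 h2)
        change triLattice.edist 0 g ≤ ((k + 1 : ℕ) : ℕ∞)
        exact_mod_cast h3
      by_cases h0 : g = 0
      · exact step 0 (Or.inr rfl) (by rw [h0]; simp)
      have h0' : ¬(g.1 = 0 ∧ g.2 = 0) := fun h => h0 (Prod.ext h.1 h.2)
      have adj : ∀ d ∈ ({(1, 0), (-1, 0), (0, 1), (0, -1), (1, -1), (-1, 1)} : Set Face),
          triLattice.Adj (g + d) g ∨ d = 0 := by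
        intro d hd
        left
        simp only [Set.mem_insert_iff, Set.mem_singleton_iff] at hd
        simp only [triLattice, SimpleGraph.fromRel_adj]
        rcases hd with rfl | rfl | rfl | rfl | rfl | rfl <;> simp [Prod.ext_iff]
      by_cases c1 : 0 < g.1
      · by_cases c2 : 0 ≤ g.2
        · refine step (-1, 0) (adj _ (by simp)) ?_
          simp only [Prod.fst_add, Prod.snd_add]
          omega
        · refine step (-1, 1) (adj _ (by simp)) ?_
          simp only [Prod.fst_add, Prod.snd_add]
          omega
      · by_cases c2 : 0 < g.2
        · by_cases c3 : g.1 = 0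
          · refine step (0, -1) (adj _ (by simp)) ?_
            simp only [Prod.fst_add, Prod.snd_add]
            omega
          · refine step (1, -1) (adj _ (by simp)) ?_
            simp only [Prod.fst_add, Prod.snd_add]
            omega
        · by_cases c3 : g.1 = 0
          · refine step (0, 1) (adj _ (by simp)) ?_
            simp only [Prod.fst_add, Prod.snd_add]
            omega
          · refine step (1, 0) (adj _ (by simp)) ?_
            simp only [Prod.fst_add, Prod.snd_add]
            omega

/-- The ball of radius `k` around the origin. -/
def ballFinset (k : ℕ) : Finset Face := (faceBall_finite k).toFinset

theorem mem_ballFinset {k : ℕ} {g : Face} : g ∈ ballFinset k ↔ g ∈ faceBall k 0 := by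
  simp [ballFinset]

theorem sq_le_card_ballFinset (k : ℕ) : (k + 1) ^ 2 ≤ (ballFinset k).card := by
  have h : Finset.Icc (0 : ℤ) k ×ˢ Finset.Icc (-(k : ℤ)) 0 ⊆ ballFinset k := by
    intro g hg
    simp only [Finset.mem_product, Finset.mem_Icc] at hg
    rw [mem_ballFinset, mem_faceBall_iff]
    omega
  have h2 := Finset.card_le_card h
  rw [Finset.card_product, Int.card_Icc, Int.card_Icc] at h2
  have e1 : ((k : ℤ) + 1 - 0).toNat = k + 1 := by omega
  have e2 : ((0 : ℤ) + 1 - -(k : ℤ)).toNat = k + 1 := by omega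
  rw [e1, e2] at h2
  rwa [sq]

open Classical in
/-- The faces in the ball that leave it when translated by some element of `S`. -/
def ballBoundary (S : Finset Face) (k : ℕ) : Finset Face :=
  (ballFinset k).filter fun f => ∃ g ∈ S, f + g ∉ ballFinset k

/-- A face leaving the ball under translation by `g` has one of `a`, `b`, `a + b` within `m` of `k`
or `-k`. This gives three families of strips, each of at most `2 * m` lines with at most `2 * k + 1`
faces; the third is parametrised by `(a, a + b)`. -/
theorem card_ballBoundary_singleton_le (g : Face) (k : ℕ) :
    (ballBoundary {g} k).card ≤ 6 * (g.1.natAbs + g.2.natAbs) * (2 * k + 1) := by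
  set m := g.1.natAbs + g.2.natAbs with hm
  let U : Finset ℤ := Finset.Icc (k - m + 1 : ℤ) k ∪ Finset.Icc (-k : ℤ) (-k + m - 1)
  let V : Finset ℤ := Finset.Icc (-k : ℤ) k
  have hU : U.card ≤ 2 * m := by
    refine (Finset.card_union_le _ _).trans ?_
    rw [Int.card_Icc, Int.card_Icc]
    omega
  have hV : V.card = 2 * k + 1 := by
    rw [Int.card_Icc]
    omega
  have hsub : ballBoundary {g} k ⊆ (U ×ˢ V ∪ V ×ˢ U) ∪
      (V ×ˢ U).image fun p : ℤ × ℤ => (p.1, p.2 - p.1) := by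
    rintro ⟨a, b⟩ h
    simp only [ballBoundary, Finset.mem_filter, Finset.mem_singleton, exists_eq_left,
      mem_ballFinset, mem_faceBall_iff, Prod.fst_add, Prod.snd_add] at h
    have h3 : (a + b ∈ U ∧ a ∈ V) ∨ (a ∈ U ∧ b ∈ V) ∨ (a ∈ V ∧ b ∈ U) := by
      simp only [U, V, Finset.mem_union, Finset.mem_Icc]
      omega
    simp only [Finset.mem_union, Finset.mem_product, Finset.mem_image]
    rcases h3 with h3 | h3 | h3
    · exact Or.inr ⟨(a, a + b), ⟨h3.2, h3.1⟩, by simp⟩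
    · exact Or.inl (Or.inl h3)
    · exact Or.inl (Or.inr h3)
  have h1 := Finset.card_le_card hsub
  have h2 := Finset.card_union_le (U ×ˢ V ∪ V ×ˢ U)
    ((V ×ˢ U).image fun p : ℤ × ℤ => (p.1, p.2 - p.1))
  have h3 := Finset.card_union_le (U ×ˢ V) (V ×ˢ U)
  have h4 := Finset.card_image_le (s := V ×ˢ U) (f := fun p : ℤ × ℤ => (p.1, p.2 - p.1))
  simp only [Finset.card_product, hV] at h3 h4
  have h5 := Nat.mul_le_mul_right (2 * k + 1) hU
  rw [mul_comm (2 * k + 1) U.card] at h3 h4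
  calc _ ≤ 3 * (U.card * (2 * k + 1)) := by omega
    _ ≤ 3 * (2 * m * (2 * k + 1)) := by omega
    _ = _ := by ring

theorem card_ballBoundary_le (S : Finset Face) (k : ℕ) : (ballBoundary S k).card ≤
    (∑ g ∈ S, 6 * (g.1.natAbs + g.2.natAbs)) * (2 * k + 1) := by
  classical
  have h : ballBoundary S k ⊆ S.biUnion fun g => ballBoundary {g} k := by
    intro f hf
    simp only [ballBoundary, Finset.mem_filter, Finset.mem_biUnion, Finset.mem_singleton,
      exists_eq_left] at hf ⊢
    obtain ⟨h1, g, hg, h2⟩ := hf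
    exact ⟨g, hg, h1, h2⟩
  refine (Finset.card_le_card h).trans (Finset.card_biUnion_le.trans ?_)
  rw [Finset.sum_mul]
  exact Finset.sum_le_sum fun g _ => card_ballBoundary_singleton_le g k

/-- The proportion of `ballBoundary S k` in the ball. -/
def boundaryRatio (S : Finset Face) (k : ℕ) : ℝ≥0∞ :=
  ((ballFinset k).card : ℝ≥0∞)⁻¹ * (ballBoundary S k).card

theorem tendsto_boundaryRatio (S : Finset Face) :
    Tendsto (boundaryRatio S) atTop (𝓝 0) := by
  set c := ∑ g ∈ S, 6 * (g.1.natAbs + g.2.natAbs)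
  have h1 : ∀ k, boundaryRatio S k ≤ ENNReal.ofReal (2 * c * (1 / ((k : ℝ) + 1))) := by
    intro k
    have hb := card_ballBoundary_le S k
    have ha := sq_le_card_ballFinset k
    have e : boundaryRatio S k =
        ENNReal.ofReal (((ballBoundary S k).card : ℝ) / (ballFinset k).card) := by
      have hpos : (0 : ℝ) < (ballFinset k).card := by
        have : 0 < (ballFinset k).card := lt_of_lt_of_le (by positivity) ha
        exact_mod_cast this
      rw [ENNReal.ofReal_div_of_pos hpos, ENNReal.ofReal_natCast, ENNReal.ofReal_natCast,
        boundaryRatio, div_eq_mul_inv, mul_comm]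
    rw [e]
    refine ENNReal.ofReal_le_ofReal ?_
    have ha' : ((k : ℝ) + 1) ^ 2 ≤ (ballFinset k).card := by exact_mod_cast ha
    have hb' : ((ballBoundary S k).card : ℝ) ≤ c * (2 * k + 1) := by exact_mod_cast hb
    have hk : (0 : ℝ) < (k : ℝ) + 1 := by positivity
    calc ((ballBoundary S k).card : ℝ) / (ballFinset k).card
        ≤ (c * (2 * k + 1)) / ((k : ℝ) + 1) ^ 2 := by gcongr
      _ ≤ (c * (2 * (k + 1))) / ((k : ℝ) + 1) ^ 2 := by gcongr; linarith
      _ = 2 * c * (1 / ((k : ℝ) + 1)) := by field_simp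
  have h2 : Tendsto (fun k : ℕ => ENNReal.ofReal (2 * c * (1 / ((k : ℝ) + 1)))) atTop (𝓝 0) := by
    have := (tendsto_one_div_add_atTop_nhds_zero_nat (𝕜 := ℝ)).const_mul (2 * (c : ℝ))
    have := ENNReal.tendsto_ofReal this
    simpa using this
  exact tendsto_of_tendsto_of_tendsto_of_le_of_le tendsto_const_nhds h2 (fun _ => zero_le) h1

/-! ### Decomposition of the recentred measures -/

theorem recentredMeasure_eq_sum {n x : ℝ} (hn : 0 < n) (hx : 0 < x) {ξ : Config}
    (hξ : IsLoopConfig ξ) (k : ℕ) : recentredMeasure n x ξ k = ∑ f ∈ ballFinset k,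
      ((ballFinset k).card : ℝ≥0∞)⁻¹ • (loopMeasure (hexBall k 0) n x ξ).map (shift (-f)) := by
  have := isProbabilityMeasure_loopMeasure (hexBall_finite k) hn hx hξ
  have hball : faceBall k 0 = (ballFinset k : Set Face) := by
    ext f
    rw [Finset.mem_coe, mem_ballFinset]
  ext A hA
  have := isProbabilityMeasure_uniformOn (faceBall_finite k) (faceBall_nonempty k 0)
  rw [recentredMeasure, Measure.map_apply measurable_recentring hA,
    Measure.prod_apply_symm (measurable_recentring hA), hball, uniformOn, ProbabilityTheory.cond,
    lintegral_smul_measure, lintegral_finset, Measure.count_apply_finset,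
    Measure.finsetSum_apply, smul_eq_mul, Finset.mul_sum]
  refine Finset.sum_congr rfl fun f _ => ?_
  rw [Measure.count_singleton, mul_one, Measure.smul_apply,
    Measure.map_apply (measurable_shift _) hA, smul_eq_mul]
  rfl

theorem atomic_sum {ι : Type*} (s : Finset ι) (c : ℝ≥0∞) (q : ι → Config → ℝ≥0∞) :
    ∑ i ∈ s, c • atomic (q i) = atomic fun ω => ∑ i ∈ s, c * q i ω := by
  ext A hA
  rw [Measure.finsetSum_apply, atomic_apply _ hA]
  simp only [Measure.smul_apply, smul_eq_mul, atomic_apply _ hA, ← ENNReal.tsum_mul_left]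
  rw [← Summable.tsum_finsetSum fun _ _ => ENNReal.summable]
  refine tsum_congr fun ω => ?_
  rw [Finset.sum_mul]
  exact Finset.sum_congr rfl fun _ _ => by ring

theorem Specified.sum {ι : Type*} {D : hexLattice.Subgraph} {n x : ℝ} (s : Finset ι) (c : ℝ≥0∞)
    {q : ι → Config → ℝ≥0∞} (h : ∀ i ∈ s, Specified D n x (q i)) :
    Specified D n x fun ω => ∑ i ∈ s, c * q i ω := by
  refine ⟨fun ω hω => ?_, fun ω ω' hω hω' hag => ?_⟩
  · obtain ⟨i, hi, h0⟩ := Finset.exists_ne_zero_of_sum_ne_zero hω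
    exact (h i hi).loop ω (right_ne_zero_of_mul h0)
  · rw [Finset.sum_mul, Finset.sum_mul]
    refine Finset.sum_congr rfl fun i hi => ?_
    rw [mul_assoc, (h i hi).ratio ω ω' hω hω' hag, mul_assoc]

/-- The face `p + (1, 0)` is a corner of both the upward and the downward triangle at `p`, so it is
a uniform choice of a face bordered by a vertex. -/
theorem translateSub_le_hexBall {D : hexLattice.Subgraph} {k : ℕ} {f : Face}
    (h : ∀ v ∈ D.verts, f + (v.1 + (1, 0)) ∈ faceBall k 0) :
    translateSub f D ≤ hexBall k 0 := by
  have hv : (translateSub f D).verts ⊆ (hexBall k 0).verts := by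
    rintro _ ⟨v, hv, rfl⟩
    refine ⟨_, h v hv, ?_⟩
    obtain ⟨p, b⟩ := v
    change f + (p + (1, 0)) ∈ facesAt (f + p, b)
    cases b <;> simp [facesAt, add_assoc]
  refine ⟨hv, fun u v huv => ?_⟩
  exact ⟨hv huv.fst_mem, hv huv.snd_mem, huv.adj_sub⟩

/-- Up to an error that vanishes as `k` grows, the recentred measures have the weights of `D` as
specification. -/
theorem exists_specified_decomposition {D : hexLattice.Subgraph} (hD : D.verts.Finite) {n x : ℝ}
    (hn : 0 < n) (hx : 0 < x) : ∃ r : ℕ → ℝ≥0∞, Tendsto r atTop (𝓝 0) ∧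
      ∀ (ξ : Config) (_ : IsLoopConfig ξ) (k : ℕ), ∃ (q : Config → ℝ≥0∞) (R : Measure Config),
        Specified D n x q ∧ recentredMeasure n x ξ k = atomic q + R ∧ R Set.univ ≤ r k := by
  classical
  let S : Finset Face := hD.toFinset.image fun v => v.1 + (1, 0)
  refine ⟨boundaryRatio S, tendsto_boundaryRatio S, fun ξ hξ k => ?_⟩
  have := isProbabilityMeasure_loopMeasure (hexBall_finite k) hn hx hξ
  set c := ((ballFinset k).card : ℝ≥0∞)⁻¹
  set p : Config → ℝ≥0∞ := (loopConfigs (hexBall k 0) ξ).indicator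
      fun ω => weight (hexBall k 0) n x ω / partitionFn (hexBall k 0) n x ξ with hp
  -- The faces `f` whose translate of `D` stays inside the ball form the atomic part; the others, a
  -- proportion `boundaryRatio S k`, form the error.
  refine ⟨fun ω => ∑ f ∈ (ballFinset k).filter (fun f => ¬∃ g ∈ S, f + g ∉ ballFinset k),
    c * p (shift f ω), ∑ f ∈ ballBoundary S k,
    c • (loopMeasure (hexBall k 0) n x ξ).map (shift (-f)), ?_, ?_, ?_⟩
  · refine Specified.sum _ c fun f hf => Specified.comp_shift f ?_
    refine specified_loopMeasure (hexBall_finite k) (translateSub_le_hexBall fun v hv => ?_)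
      hn hx ξ
    by_contra hcon
    refine (Finset.mem_filter.1 hf).2 ⟨v.1 + (1, 0), Finset.mem_image.2 ⟨v, by simpa using hv, rfl⟩,
      fun h => hcon (mem_ballFinset.1 h)⟩
  · rw [← atomic_sum, recentredMeasure_eq_sum hn hx hξ,
      ← Finset.sum_filter_add_sum_filter_not (ballFinset k)
        fun f => ¬∃ g ∈ S, f + g ∉ ballFinset k]
    congr 1
    · refine Finset.sum_congr rfl fun f _ => ?_
      rw [loopMeasure_eq_atomic, map_shift_atomic]
    · refine Finset.sum_congr ?_ fun _ _ => rfl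
      ext f
      simp [ballBoundary]
  · rw [Measure.finsetSum_apply]
    simp only [Measure.smul_apply, Measure.map_apply (measurable_shift _) MeasurableSet.univ,
      Set.preimage_univ, measure_univ, smul_eq_mul, mul_one, Finset.sum_const, nsmul_eq_mul]
    rw [boundaryRatio, mul_comm]

theorem recentredMeasure_shift_le {n x : ℝ} (hn : 0 < n) (hx : 0 < x) {ξ : Config}
    (hξ : IsLoopConfig ξ) (k : ℕ) (g : Face) {A : Set Config} (hA : MeasurableSet A) :
    recentredMeasure n x ξ k (shift g ⁻¹' A) ≤
      recentredMeasure n x ξ k A + boundaryRatio {-g} k := by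
  classical
  have := isProbabilityMeasure_loopMeasure (hexBall_finite k) hn hx hξ
  set P := loopMeasure (hexBall k 0) n x ξ
  let a : Face → ℝ≥0∞ := fun f => P (shift (-f) ⁻¹' A)
  have hsum : ∀ B, MeasurableSet B → recentredMeasure n x ξ k B =
      ((ballFinset k).card : ℝ≥0∞)⁻¹ * ∑ f ∈ ballFinset k, P (shift (-f) ⁻¹' B) := by
    intro B hB
    rw [recentredMeasure_eq_sum hn hx hξ, Measure.finsetSum_apply, Finset.mul_sum]
    refine Finset.sum_congr rfl fun f _ => ?_
    rw [Measure.smul_apply, Measure.map_apply (measurable_shift _) hB, smul_eq_mul]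
  rw [hsum _ hA, hsum _ (measurable_shift g hA), boundaryRatio, ← mul_add]
  gcongr
  have h1 : ∀ f, P (shift (-f) ⁻¹' (shift g ⁻¹' A)) = a (f + -g) := by
    intro f
    simp only [a]
    congr 1
    ext ω
    simp only [Set.mem_preimage, shift_shift]
    rw [show g + -f = -(f + -g) by abel]
  rw [Finset.sum_congr rfl fun f _ => h1 f,
    -- Translating moves the uniform face: terms that stay in the ball are already counted in the
    -- original sum, and each of the others is at most one.
    ← Finset.sum_filter_add_sum_filter_not (ballFinset k) fun f => f + -g ∈ ballFinset k]
  refine add_le_add ?_ ?_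
  · rw [← Finset.sum_image (f := a) (g := fun f => f + -g) (add_left_injective (-g)).injOn]
    refine Finset.sum_le_sum_of_subset fun f hf => ?_
    obtain ⟨f', hf', rfl⟩ := Finset.mem_image.1 hf
    exact (Finset.mem_filter.1 hf').2
  · have h2 : (ballFinset k).filter (fun f => f + -g ∉ ballFinset k) = ballBoundary {-g} k := by
      ext f
      simp [ballBoundary]
    rw [h2, ← nsmul_one, ← Finset.sum_const]
    exact Finset.sum_le_sum fun f _ => prob_le_one

theorem isClosed_isLoopConfig : IsClosed {ω : Config | IsLoopConfig ω} := by
  have he : ∀ e : hexLattice.edgeSet, Continuous fun ω : Config => ω e := fun e =>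
    continuous_apply e
  have hx : ∀ e e' : hexLattice.edgeSet, Continuous fun ω : Config => (ω e ^^ ω e') := fun e e' =>
    (continuous_of_discreteTopology (f := fun p : Bool × Bool => p.1 ^^ p.2)).comp
      ((he e).prodMk (he e'))
  have : {ω : Config | IsLoopConfig ω} = ⋂ p,
      {ω : Config | ω (edgeA p) = (ω (edgeB p) ^^ ω (edgeC p))} ∩
      {ω | ω (edgeA p) = (ω (edgeB (p + (1, 0))) ^^ ω (edgeC (p + (0, 1))))} := by
    ext ω
    simp [isLoopConfig_iff]
  rw [this]
  exact isClosed_iInter fun p =>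
    (isClosed_eq (he _) (hx _ _)).inter (isClosed_eq (he _) (hx _ _))

theorem ae_isLoopConfig_atomic {q : Config → ℝ≥0∞} (hq : ∀ ω, q ω ≠ 0 → IsLoopConfig ω) :
    ∀ᵐ ω ∂atomic q, IsLoopConfig ω := by
  change atomic q {ω | IsLoopConfig ω}ᶜ = 0
  rw [atomic_apply _ isClosed_isLoopConfig.measurableSet.compl, ENNReal.tsum_eq_zero]
  intro ω
  by_cases h : q ω = 0
  · simp [h]
  · simp [hq ω h]

theorem ae_isLoopConfig_loopMeasure (D : hexLattice.Subgraph) (n x : ℝ) (ξ : Config) :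
    ∀ᵐ ω ∂loopMeasure D n x ξ, IsLoopConfig ω := by
  rw [loopMeasure_eq_atomic]
  refine ae_isLoopConfig_atomic fun ω h => ?_
  by_contra hcon
  exact h (Set.indicator_of_notMem (fun h' => hcon h'.1) _)

theorem ae_isLoopConfig_recentredMeasure {n x : ℝ} (hn : 0 < n) (hx : 0 < x) {ξ : Config}
    (hξ : IsLoopConfig ξ) (k : ℕ) : ∀ᵐ ω ∂recentredMeasure n x ξ k, IsLoopConfig ω := by
  change recentredMeasure n x ξ k {ω | IsLoopConfig ω}ᶜ = 0
  have hm : MeasurableSet {ω : Config | IsLoopConfig ω}ᶜ :=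
    isClosed_isLoopConfig.measurableSet.compl
  rw [recentredMeasure_eq_sum hn hx hξ, Measure.finsetSum_apply]
  refine Finset.sum_eq_zero fun f _ => ?_
  rw [Measure.smul_apply, Measure.map_apply (measurable_shift _) hm, smul_eq_mul]
  have h : loopMeasure (hexBall k 0) n x ξ {ω | IsLoopConfig ω}ᶜ = 0 :=
    ae_isLoopConfig_loopMeasure (hexBall k 0) n x ξ
  have hsub : shift (-f) ⁻¹' {ω | IsLoopConfig ω}ᶜ ⊆ {ω | IsLoopConfig ω}ᶜ :=
    fun ω hω h => hω (isLoopConfig_shift h _)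
  rw [measure_mono_null hsub h, mul_zero]

/-! ### Properties preserved by weak limits -/

theorem isClopen_of_mem_measurableCylinders {ι : Type*} {S : Set (ι → Bool)}
    (hS : S ∈ measurableCylinders fun _ : ι => Bool) : IsClopen S := by
  obtain ⟨s, T, -, rfl⟩ := (mem_measurableCylinders S).1 hS
  have hc : Continuous (s.restrict : (ι → Bool) → s → Bool) :=
    continuous_pi fun i => continuous_apply i.1
  exact (isClopen_discrete T).preimage hc

/-- Cylinders are clopen and approximate any event simultaneously for both measures, namely with
respect to their sum. Weak convergence controls clopen events, so this extends its inequalities to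
all events. -/
theorem le_const_mul_of_forall_isClopen {m₁ m₂ : Measure Config} [IsFiniteMeasure m₁]
    [IsFiniteMeasure m₂] {C : ℝ≥0∞} (hC : C ≠ ⊤) (h : ∀ A, IsClopen A → m₁ A ≤ C * m₂ A)
    {A : Set Config} (hA : MeasurableSet A) : m₁ A ≤ C * m₂ A := by
  refine ENNReal.le_of_forall_pos_le_add fun ε hε _ => ?_
  obtain ⟨S, hS, hlt⟩ := exists_measurableCylinder_symmDiff_lt (m₁ + m₂) hA
    (ε := (ε : ℝ≥0∞) / (1 + C)) (ENNReal.div_pos (by simpa using hε.ne') (by finiteness))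
  rw [Measure.add_apply] at hlt
  have h1 : m₁ A ≤ m₁ S + m₁ (A ∆ S) := by
    refine (measure_mono fun ω hω => ?_).trans (measure_union_le _ _)
    by_cases h : ω ∈ S
    · exact Or.inl h
    · exact Or.inr (Or.inl ⟨hω, h⟩)
  have h2 : m₂ S ≤ m₂ A + m₂ (A ∆ S) := by
    refine (measure_mono fun ω hω => ?_).trans (measure_union_le _ _)
    by_cases h : ω ∈ A
    · exact Or.inl h
    · exact Or.inr (Or.inr ⟨hω, h⟩)
  calc m₁ A ≤ C * m₂ S + m₁ (A ∆ S) :=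
        h1.trans (add_le_add_left (h S (isClopen_of_mem_measurableCylinders hS)) _)
    _ ≤ C * (m₂ A + m₂ (A ∆ S)) + m₁ (A ∆ S) := by gcongr
    _ ≤ C * m₂ A + (1 + C) * (m₁ (A ∆ S) + m₂ (A ∆ S)) := by
        rw [mul_add, add_assoc]
        gcongr
        rw [add_mul, mul_add C, one_mul, add_comm (C * m₂ _)]
        gcongr
        · exact le_self_add
        · exact le_add_self
    _ ≤ C * m₂ A + (1 + C) * (ε / (1 + C)) := by gcongr
    _ = C * m₂ A + ε := by rw [ENNReal.mul_div_cancel (by simp) (by finiteness)]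

theorem tendsto_recentredMeasure_isClopen
    {n x : ℝ} (hn : 0 < n) (hx : 0 < x) {ξ : ℕ → Config}
    (hξ : ∀ k, IsLoopConfig (ξ k)) {φ : ℕ → ℕ}
    {μ : ProbabilityMeasure Config}
    (hμ : Tendsto (fun j => recentredLaw hn hx (hξ (φ j)) (φ j)) atTop (𝓝 μ))
    {A : Set Config} (hA : IsClopen A) :
    Tendsto (fun j => recentredMeasure n x (ξ (φ j)) (φ j) A) atTop
      (𝓝 ((μ : Measure Config) A)) := by
  have h := ENNReal.tendsto_coe.2
    (ProbabilityMeasure.tendsto_measure_of_isClopen_of_tendsto hμ hA)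
  simp only [ProbabilityMeasure.ennreal_coeFn_eq_coeFn_toMeasure] at h
  exact h

theorem ae_isLoopConfig_of_tendsto
    {n x : ℝ} (hn : 0 < n) (hx : 0 < x) {ξ : ℕ → Config}
    (hξ : ∀ k, IsLoopConfig (ξ k)) {φ : ℕ → ℕ}
    {μ : ProbabilityMeasure Config}
    (hμ : Tendsto (fun j => recentredLaw hn hx (hξ (φ j)) (φ j)) atTop (𝓝 μ)) :
    ∀ᵐ ω ∂(μ : Measure Config), IsLoopConfig ω := by
  have hm := isClosed_isLoopConfig.measurableSet
  have h := ProbabilityMeasure.limsup_measure_closed_le_of_tendsto hμ isClosed_isLoopConfig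
  have h1 : ∀ j, (recentredLaw hn hx (hξ (φ j)) (φ j) : Measure Config)
      {ω | IsLoopConfig ω} = 1 := fun j =>
    (prob_compl_eq_zero_iff hm).1 (ae_isLoopConfig_recentredMeasure hn hx (hξ (φ j)) (φ j))
  simp only [h1, limsup_const] at h
  exact (prob_compl_eq_zero_iff hm).2 (le_antisymm prob_le_one h)

theorem continuous_shift (g : Face) : Continuous (shift g) :=
  continuous_pi fun _ => continuous_apply _

theorem isTranslationInvariant_of_tendsto
    {n x : ℝ} (hn : 0 < n) (hx : 0 < x) {ξ : ℕ → Config}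
    (hξ : ∀ k, IsLoopConfig (ξ k)) {φ : ℕ → ℕ} (hφ : StrictMono φ)
    {μ : ProbabilityMeasure Config}
    (hμ : Tendsto (fun j => recentredLaw hn hx (hξ (φ j)) (φ j)) atTop (𝓝 μ)) :
    IsTranslationInvariant (μ : Measure Config) := by
  have h1 : ∀ g A, IsClopen A → (μ : Measure Config) (shift g ⁻¹' A) ≤ (μ : Measure Config) A := by
    intro g A hA
    have e1 := tendsto_recentredMeasure_isClopen hn hx hξ hμ (hA.preimage (continuous_shift g))
    have e2 := (tendsto_recentredMeasure_isClopen hn hx hξ hμ hA).add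
      ((tendsto_boundaryRatio {-g}).comp hφ.tendsto_atTop)
    rw [add_zero] at e2
    exact le_of_tendsto_of_tendsto' e1 e2 fun j =>
      recentredMeasure_shift_le hn hx (hξ (φ j)) (φ j) g hA.isOpen.measurableSet
  have h2 : ∀ g A, MeasurableSet A →
      (μ : Measure Config) (shift g ⁻¹' A) ≤ (μ : Measure Config) A := by
    intro g A hA
    have : IsProbabilityMeasure ((μ : Measure Config).map (shift g)) :=
      Measure.isProbabilityMeasure_map (measurable_shift g).aemeasurable
    have := le_const_mul_of_forall_isClopen (m₁ := (μ : Measure Config).map (shift g))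
      (m₂ := (μ : Measure Config)) ENNReal.one_ne_top (fun A hA => ?_) hA
    · rwa [Measure.map_apply (measurable_shift g) hA, one_mul] at this
    · rw [Measure.map_apply (measurable_shift g) hA.isOpen.measurableSet, one_mul]
      exact h1 g A hA
  intro g
  ext A hA
  rw [Measure.map_apply (measurable_shift g) hA]
  refine le_antisymm (h2 g A hA) ?_
  have := h2 (-g) _ (measurable_shift g hA)
  have e : shift (-g) ⁻¹' (shift g ⁻¹' A) = A := by
    ext ω
    simp [shift_shift, shift_zero]
  rwa [e] at this

theorem xorConfig_tolerant_of_tendsto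
    {n x : ℝ} (hn : 0 < n) (hx : 0 < x) {ξ : ℕ → Config}
    (hξ : ∀ k, IsLoopConfig (ξ k)) {φ : ℕ → ℕ} (hφ : StrictMono φ)
    {μ : ProbabilityMeasure Config}
    (hμ : Tendsto (fun j => recentredLaw hn hx (hξ (φ j)) (φ j)) atTop (𝓝 μ))
    {D : hexLattice.Subgraph} (hD : D.verts.Finite) {κ : Config}
    (hκ : IsLoopConfig κ)
    (hκD : ∀ e : hexLattice.edgeSet, (e : Sym2 HexVertex) ∉ D.edgeSet → κ e = false) :
    ∃ C : ℝ≥0∞, C ≠ ⊤ ∧ ∀ A, MeasurableSet A →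
      (μ : Measure Config) (xorConfig κ ⁻¹' A) ≤ C * (μ : Measure Config) A := by
  obtain ⟨c, hc, hcw⟩ := exists_weight_le hD hn hx
  obtain ⟨r, hr, hdec⟩ := exists_specified_decomposition hD hn hx
  have hm := (continuous_xorConfig κ).measurable
  have h1 : ∀ A, IsClopen A →
      (μ : Measure Config) (xorConfig κ ⁻¹' A) ≤ c * (μ : Measure Config) A := by
    intro A hA
    have e1 := tendsto_recentredMeasure_isClopen hn hx hξ hμ
      (hA.preimage (continuous_xorConfig κ))
    have e2 := (ENNReal.Tendsto.const_mul (tendsto_recentredMeasure_isClopen hn hx hξ hμ hA)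
      (Or.inr hc)).add (hr.comp hφ.tendsto_atTop)
    rw [add_zero] at e2
    refine le_of_tendsto_of_tendsto' e1 e2 fun j => ?_
    obtain ⟨q, R, hq, hqR, hR⟩ := hdec (ξ (φ j)) (hξ _) (φ j)
    rw [hqR, Measure.add_apply, Measure.add_apply]
    refine add_le_add ?_ ((measure_mono (Set.subset_univ _)).trans hR)
    refine (hq.xor_le hn hx hκ hκD hcw hA.isOpen.measurableSet).trans ?_
    gcongr
    exact le_self_add
  refine ⟨c, hc, fun A hA => ?_⟩
  have : IsProbabilityMeasure ((μ : Measure Config).map (xorConfig κ)) :=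
    Measure.isProbabilityMeasure_map hm.aemeasurable
  have := le_const_mul_of_forall_isClopen (m₁ := (μ : Measure Config).map (xorConfig κ))
    (m₂ := (μ : Measure Config)) hc (fun A hA => ?_) hA
  · rwa [Measure.map_apply hm hA] at this
  · rw [Measure.map_apply hm hA.isOpen.measurableSet]
    exact h1 A hA

theorem exists_finite_subgraph {E : Set hexLattice.edgeSet} (hE : E.Finite) :
    ∃ D : hexLattice.Subgraph, D.verts.Finite ∧ ∀ e ∈ E, (e : Sym2 HexVertex) ∈ D.edgeSet := by
  refine ⟨(⊤ : hexLattice.Subgraph).induce (⋃ e ∈ E, {v | v ∈ (e : Sym2 HexVertex)}),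
    hE.biUnion fun e _ => ?_, ?_⟩
  · obtain ⟨e, he⟩ := e
    induction e using Sym2.ind with
    | _ u v =>
      refine (Set.toFinite {u, v}).subset fun w hw => ?_
      simpa using hw
  · rintro ⟨e, he⟩ heE
    induction e using Sym2.ind with
    | _ u v =>
      refine ⟨?_, ?_, he⟩
      · exact Set.mem_iUnion₂.2 ⟨_, heE, by simp⟩
      · exact Set.mem_iUnion₂.2 ⟨_, heE, by simp⟩

theorem hexagonTolerant_of_tendsto
    {n x : ℝ} (hn : 0 < n) (hx : 0 < x) {ξ : ℕ → Config}
    (hξ : ∀ k, IsLoopConfig (ξ k)) {φ : ℕ → ℕ} (hφ : StrictMono φ)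
    {μ : ProbabilityMeasure Config}
    (hμ : Tendsto (fun j => recentredLaw hn hx (hξ (φ j)) (φ j)) atTop (𝓝 μ)) :
    HexagonTolerant (μ : Measure Config) := by
  intro f
  obtain ⟨D, hD, hDf⟩ := exists_finite_subgraph (finite_hexagon f)
  refine xorConfig_tolerant_of_tendsto hn hx hξ hφ hμ hD (isLoopConfig_cob _) fun e he => ?_
  by_contra h
  exact he (hDf e (by simpa using h))

/-! ### Local constancy of the number of loops -/

theorem isClopen_edge (e : hexLattice.edgeSet) (b : Bool) : IsClopen {ω : Config | ω e = b} := by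
  have he : Continuous fun ω : Config => ω e := continuous_apply e
  exact (isClopen_discrete {b}).preimage he

theorem eventually_edge_eq (ω : Config) (e : hexLattice.edgeSet) :
    ∀ᶠ ω' in 𝓝 ω, ω' e = ω e :=
  (isClopen_edge e (ω e)).isOpen.mem_nhds rfl

theorem isOpen_toGraph_adj (u v : HexVertex) : IsOpen {ω : Config | (toGraph ω).Adj u v} := by
  simp only [toGraph_adj]
  by_cases h : hexLattice.Adj u v
  · have : {ω : Config | ∃ h : hexLattice.Adj u v, ω ⟨s(u, v), h⟩ = true} =
        {ω | ω ⟨s(u, v), h⟩ = true} := by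
      ext ω
      exact ⟨fun ⟨_, h'⟩ => h', fun h' => ⟨h, h'⟩⟩
    rw [this]
    exact (isClopen_edge _ _).isOpen
  · simp [h]

theorem isOpen_sameStrand (u v : HexVertex) : IsOpen {ω : Config | SameStrand ω u v} := by
  have h : IsOpen {ω : Config | ∃ w, (toGraph ω).Adj u w} := by
    have : {ω : Config | ∃ w, (toGraph ω).Adj u w} = ⋃ w, {ω | (toGraph ω).Adj u w} := by
      ext ω
      simp
    rw [this]
    exact isOpen_iUnion fun w => isOpen_toGraph_adj u w
  exact (isOpen_reachable toGraph isOpen_toGraph_adj u v).inter h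

theorem eventually_adj_iff (ω : Config) (u : HexVertex) :
    ∀ᶠ ω' in 𝓝 ω, ∀ v, (toGraph ω').Adj u v ↔ (toGraph ω).Adj u v := by
  obtain ⟨p, b⟩ := u
  cases b
  · filter_upwards [eventually_edge_eq ω (edgeA p), eventually_edge_eq ω (edgeB p),
      eventually_edge_eq ω (edgeC p)] with ω' h1 h2 h3 v
    rw [toGraph_adj_up, toGraph_adj_up, h1, h2, h3]
  · filter_upwards [eventually_edge_eq ω (edgeA p), eventually_edge_eq ω (edgeB (p + (1, 0))),
      eventually_edge_eq ω (edgeC (p + (0, 1)))] with ω' h1 h2 h3 v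
    rw [toGraph_adj_down, toGraph_adj_down, h1, h2, h3]

/-- The edges at the finite component of `u` are finitely many; nearby configurations agree on them
and cannot leave that component. -/
theorem eventually_not_reachable {ω : Config} {u v : HexVertex}
    (hfin : {w | (toGraph ω).Reachable u w}.Finite) (h : ¬(toGraph ω).Reachable u v) :
    ∀ᶠ ω' in 𝓝 ω, ¬(toGraph ω').Reachable u v := by
  have h1 : ∀ᶠ ω' in 𝓝 ω, ∀ a ∈ {w | (toGraph ω).Reachable u w}, ∀ b,
      (toGraph ω').Adj a b ↔ (toGraph ω).Adj a b :=
    (eventually_all_finite hfin).2 fun a _ => eventually_adj_iff ω a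
  filter_upwards [h1] with ω' h1 hcon
  have key : ∀ {a b : HexVertex}, (toGraph ω').Walk a b → (toGraph ω).Reachable u a →
      (toGraph ω).Reachable u b := by
    intro a b p
    induction p with
    | nil => exact id
    | cons hab _ ih => exact fun ha => ih (ha.trans ((h1 _ ha _).1 hab).reachable)
  obtain ⟨p⟩ := hcon
  exact h (key p (.refl _))

/-- A small perturbation acts only far away, so it can join two distinct strands only if both are
infinite. Uniqueness of the bi-infinite path excludes this. -/
theorem eventually_sameStrand_iff {ω : Config} (hω : IsLoopConfig ω)
    (hsub : {C : (toGraph ω).ConnectedComponent | IsBiInfinitePath ω C}.Subsingleton)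
    (u v : HexVertex) : ∀ᶠ ω' in 𝓝 ω, (SameStrand ω' u v ↔ SameStrand ω u v) := by
  by_cases h : SameStrand ω u v
  · filter_upwards [(isOpen_sameStrand u v).mem_nhds h] with ω' h'
    exact iff_of_true h' h
  by_cases hu : ∃ w, (toGraph ω).Adj u w
  swap
  · filter_upwards [eventually_adj_iff ω u] with ω' h'
    exact iff_of_false (fun hs => hu (hs.2.imp fun w hw => (h' w).1 hw)) h
  have hr : ¬(toGraph ω).Reachable u v := fun hr => h ⟨hr, hu⟩
  suffices h' : ∀ᶠ ω' in 𝓝 ω, ¬(toGraph ω').Reachable u v by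
    filter_upwards [h'] with ω' h'
    exact iff_of_false (fun hs => h' hs.1) h
  by_cases h1 : {w | (toGraph ω).Reachable u w}.Finite
  · exact eventually_not_reachable h1 hr
  by_cases h2 : {w | (toGraph ω).Reachable v w}.Finite
  · filter_upwards [eventually_not_reachable h2 fun h => hr h.symm] with ω' h' hcon
    exact h' hcon.symm
  exfalso
  have hbi : ∀ a, ¬{w | (toGraph ω).Reachable a w}.Finite →
      (toGraph ω).connectedComponentMk a ∈
        {C : (toGraph ω).ConnectedComponent | IsBiInfinitePath ω C} := by
    intro a ha
    have hs : ((toGraph ω).connectedComponentMk a).supp = {w | (toGraph ω).Reachable a w} := by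
      ext w
      rw [SimpleGraph.ConnectedComponent.mem_supp_iff, SimpleGraph.ConnectedComponent.eq]
      exact ⟨fun h => h.symm, fun h => SimpleGraph.Reachable.symm h⟩
    refine ((isLoop_or_isBiInfinitePath_iff hω _).2 ⟨a, rfl, ?_⟩).resolve_left fun hl => ?_
    · by_contra hno
      refine ha ((Set.finite_singleton a).subset ?_)
      rintro w ⟨p⟩
      cases p with
      | nil => rfl
      | cons hab _ => exact absurd ⟨_, hab⟩ hno
    · exact ha (hs ▸ hl.1)
  exact hr (SimpleGraph.ConnectedComponent.eq.1 (hsub (hbi u h1) (hbi v h2)))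

/-- The exponents of the weight of a configuration. -/
def exponents (D : hexLattice.Subgraph) (ω : Config) : ℕ × ℕ := (numEdges D ω, numLoops D ω)

theorem eventually_numEdges_eq {D : hexLattice.Subgraph} (hD : D.verts.Finite) (ω : Config) :
    ∀ᶠ ω' in 𝓝 ω, numEdges D ω' = numEdges D ω := by
  have h1 : ∀ᶠ ω' in 𝓝 ω, ∀ e ∈ {e : hexLattice.edgeSet | (e : Sym2 HexVertex) ∈ D.edgeSet},
      ω' e = ω e := (eventually_all_finite (finite_edges hD)).2 fun e _ => eventually_edge_eq ω e
  filter_upwards [h1] with ω' h1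
  rw [numEdges, numEdges]
  congr 1
  ext e
  exact and_congr_right fun he => by rw [h1 e he]

theorem eventually_exponents_eq {D : hexLattice.Subgraph} (hD : D.verts.Finite) {ω : Config}
    (hω : IsLoopConfig ω)
    (hsub : {C : (toGraph ω).ConnectedComponent | IsBiInfinitePath ω C}.Subsingleton) :
    ∀ᶠ ω' in 𝓝 ω, IsLoopConfig ω' → exponents D ω' = exponents D ω := by
  have h1 : ∀ᶠ ω' in 𝓝 ω, ∀ u ∈ D.verts, ∀ v ∈ D.verts, SameStrand ω' u v ↔ SameStrand ω u v :=
    (eventually_all_finite hD).2 fun u _ => (eventually_all_finite hD).2 fun v _ =>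
      eventually_sameStrand_iff hω hsub u v
  filter_upwards [h1, eventually_numEdges_eq hD ω] with ω' h1 h2 hω'
  rw [exponents, exponents, h2, numLoops_congr D hω' hω h1]

theorem measurableSet_exponents {D : hexLattice.Subgraph} (hD : D.verts.Finite) (p : ℕ × ℕ) :
    MeasurableSet {ω : Config | IsLoopConfig ω ∧ exponents D ω = p} := by
  have : Finite D.verts := hD
  let code : Config → Set (D.verts × D.verts) := fun ω => {q | SameStrand ω q.1 q.2}
  have hcode : ∀ T, MeasurableSet {ω | code ω = T} := by
    intro T
    have : {ω | code ω = T} = ⋂ q : D.verts × D.verts, {ω | SameStrand ω q.1 q.2 ↔ q ∈ T} := by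
      ext ω
      simp [code, Set.ext_iff]
    rw [this]
    refine MeasurableSet.iInter fun q => ?_
    exact (isOpen_sameStrand q.1 q.2).measurableSet.iff (MeasurableSet.const _)
  have hE : MeasurableSet {ω : Config | numEdges D ω = p.1} := by
    refine IsOpen.measurableSet (isOpen_iff_mem_nhds.2 fun ω hω => ?_)
    filter_upwards [eventually_numEdges_eq hD ω] with ω' h
    exact h.trans hω
  have hL : MeasurableSet {ω : Config | IsLoopConfig ω} := isClosed_isLoopConfig.measurableSet
  have : {ω : Config | IsLoopConfig ω ∧ exponents D ω = p} =
      ({ω | IsLoopConfig ω} ∩ {ω | numEdges D ω = p.1}) ∩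
        ⋃ T ∈ {T | ∃ ω, IsLoopConfig ω ∧ numLoops D ω = p.2 ∧ code ω = T}, {ω | code ω = T} := by
    ext ω
    simp only [Set.mem_inter_iff, Set.mem_iUnion, exists_prop]
    constructor
    · rintro ⟨h1, h2⟩
      exact ⟨⟨h1, congrArg Prod.fst h2⟩, code ω, ⟨ω, h1, congrArg Prod.snd h2, rfl⟩, rfl⟩
    · rintro ⟨⟨h1, h2⟩, T, ⟨ω', h3, h4, h5⟩, h6⟩
      refine ⟨h1, Prod.ext h2 (Eq.trans ?_ h4)⟩
      refine numLoops_congr D h1 h3 fun u hu v hv => ?_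
      have h7 : code ω = code ω' := Eq.trans h6 h5.symm
      exact Set.ext_iff.1 h7 (⟨u, hu⟩, ⟨v, hv⟩)
  rw [this]
  exact (hL.inter hE).inter (MeasurableSet.biUnion (Set.toFinite _).countable fun T _ => hcode T)

/-! ### The weight as a function on all configurations -/

/-- The weight of a loop configuration, extended by zero. -/
def loopWeight (D : hexLattice.Subgraph) (n x : ℝ) : Config → ℝ≥0∞ :=
  {ω | IsLoopConfig ω}.indicator (weight D n x)

theorem loopWeight_of_isLoopConfig {D : hexLattice.Subgraph} {n x : ℝ} {ω : Config}
    (hω : IsLoopConfig ω) : loopWeight D n x ω = weight D n x ω := Set.indicator_of_mem hω _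

theorem exists_loopWeight_eq_sum {D : hexLattice.Subgraph} (hD : D.verts.Finite) (n x : ℝ) :
    ∃ (s : Finset (ℕ × ℕ)) (F : ℕ × ℕ → ℝ≥0∞), (∀ p, F p ≠ ⊤) ∧ ∀ ω, loopWeight D n x ω =
      ∑ p ∈ s, F p * {ω : Config | IsLoopConfig ω ∧ exponents D ω = p}.indicator 1 ω := by
  refine ⟨Finset.range ({e : hexLattice.edgeSet | (e : Sym2 HexVertex) ∈ D.edgeSet}.ncard + 1) ×ˢ
    Finset.range (D.verts.ncard + 1), fun p => ENNReal.ofReal (x ^ p.1 * n ^ p.2),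
    fun p => ENNReal.ofReal_ne_top, fun ω => ?_⟩
  by_cases hω : IsLoopConfig ω
  · rw [loopWeight_of_isLoopConfig hω, Finset.sum_eq_single (exponents D ω)]
    · have hm : ω ∈ {ω' : Config | IsLoopConfig ω' ∧ exponents D ω' = exponents D ω} := ⟨hω, rfl⟩
      rw [Set.indicator_of_mem hm, Pi.one_apply, mul_one]
      rfl
    · intro p _ hp
      rw [Set.indicator_of_notMem (fun h => hp h.2.symm), mul_zero]
    · intro h
      refine absurd ?_ h
      simp only [exponents, Finset.mem_product, Finset.mem_range, Nat.lt_succ_iff]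
      exact ⟨numEdges_le hD ω, numLoops_le hD ω⟩
  · have h1 : loopWeight D n x ω = 0 := Set.indicator_of_notMem hω _
    rw [h1]
    refine (Finset.sum_eq_zero fun p _ => ?_).symm
    rw [Set.indicator_of_notMem (fun h => hω h.1), mul_zero]

theorem measurable_loopWeight {D : hexLattice.Subgraph} (hD : D.verts.Finite) (n x : ℝ) :
    Measurable (loopWeight D n x) := by
  obtain ⟨s, F, -, h⟩ := exists_loopWeight_eq_sum hD n x
  rw [funext h]
  exact Finset.measurable_sum _ fun p _ =>
    (measurable_one.indicator (measurableSet_exponents hD p)).const_mul _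

theorem exists_loopWeight_le {D : hexLattice.Subgraph} (hD : D.verts.Finite) {n x : ℝ}
    (hn : 0 < n) (hx : 0 < x) : ∃ M : ℝ≥0∞, M ≠ ⊤ ∧ ∀ ω, loopWeight D n x ω ≤ M := by
  obtain ⟨c, hc, h⟩ := exists_weight_le hD hn hx
  refine ⟨c * weight D n x fun _ => false, ENNReal.mul_ne_top hc (weight_ne_top _ _ _ _),
    fun ω => ?_⟩
  exact (Set.indicator_le_self' (fun _ _ => zero_le) ω).trans (h ω _)

/-! ### Convergence of the weighted probabilities -/

/-- A portmanteau theorem relative to `L`: the set `S` need only be a continuity set among the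
points of `L`, since all the laws live there. It is applied with `L` the loop configurations,
outside of which the exponents are not controlled. -/
theorem tendsto_measure_of_eventually_mem_iff {Ω : Type*} [MeasurableSpace Ω] [TopologicalSpace Ω]
    [OpensMeasurableSpace Ω] [HasOuterApproxClosed Ω] {ν : ℕ → ProbabilityMeasure Ω}
    {μ : ProbabilityMeasure Ω} (hν : Tendsto ν atTop (𝓝 μ)) {L S : Set Ω}
    (hνL : ∀ j, ∀ᵐ ω ∂(ν j : Measure Ω), ω ∈ L)
    (hμS : ∀ᵐ ω ∂(μ : Measure Ω), ω ∈ L → ∀ᶠ ω' in 𝓝 ω, ω' ∈ L → (ω' ∈ S ↔ ω ∈ S))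
    (hμL : ∀ᵐ ω ∂(μ : Measure Ω), ω ∈ L) :
    Tendsto (fun j => (ν j : Measure Ω) S) atTop (𝓝 ((μ : Measure Ω) S)) := by
  refine tendsto_of_le_liminf_of_limsup_le ?_ ?_
  · set U := interior {ω | ω ∈ L → ω ∈ S}
    have h1 : (μ : Measure Ω) S ≤ (μ : Measure Ω) U := by
      refine measure_mono_ae ?_
      filter_upwards [hμS, hμL] with ω h hω hS
      refine mem_interior_iff_mem_nhds.2 ?_
      filter_upwards [h hω] with ω' h' hω'
      exact (h' hω').2 hS
    refine h1.trans ((ProbabilityMeasure.le_liminf_measure_open_of_tendsto hν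
      isOpen_interior).trans (liminf_le_liminf (Eventually.of_forall fun j => ?_)))
    refine measure_mono_ae ?_
    filter_upwards [hνL j] with ω hω hU
    exact interior_subset hU hω
  · have h1 : (μ : Measure Ω) (closure (S ∩ L)) ≤ (μ : Measure Ω) S := by
      refine measure_mono_ae ?_
      filter_upwards [hμS, hμL] with ω h hω hcl
      obtain ⟨ω', h', hS, hL'⟩ := mem_closure_iff_nhds.1 hcl _ (h hω)
      exact (h' hL').1 hS
    refine (limsup_le_limsup (Eventually.of_forall fun j => ?_)).trans
      ((ProbabilityMeasure.limsup_measure_closed_le_of_tendsto hν isClosed_closure).trans h1)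
    refine measure_mono_ae ?_
    filter_upwards [hνL j] with ω hω hS
    exact subset_closure ⟨hS, hω⟩

theorem setLIntegral_loopWeight_xorConfig {D : hexLattice.Subgraph} (hD : D.verts.Finite)
    {n x : ℝ} {s : Finset (ℕ × ℕ)} {F : ℕ × ℕ → ℝ≥0∞}
    (h : ∀ ω, loopWeight D n x ω =
      ∑ p ∈ s, F p * {ω : Config | IsLoopConfig ω ∧ exponents D ω = p}.indicator 1 ω)
    (κ : Config) (m : Measure Config) (A : Set Config) :
    ∫⁻ ω in A, loopWeight D n x (xorConfig κ ω) ∂m = ∑ p ∈ s, F p *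
      m ({ω | IsLoopConfig (xorConfig κ ω) ∧ exponents D (xorConfig κ ω) = p} ∩ A) := by
  have hm := (continuous_xorConfig κ).measurable
  have hS : ∀ p, MeasurableSet
      {ω | IsLoopConfig (xorConfig κ ω) ∧ exponents D (xorConfig κ ω) = p} := fun p =>
    hm (measurableSet_exponents hD p)
  have h1 : ∀ ω, loopWeight D n x (xorConfig κ ω) = ∑ p ∈ s, F p *
      {ω | IsLoopConfig (xorConfig κ ω) ∧ exponents D (xorConfig κ ω) = p}.indicator 1 ω :=
    fun ω => h _
  simp only [h1]
  rw [lintegral_finsetSum _ fun p _ => (measurable_one.indicator (hS p)).const_mul _]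
  refine Finset.sum_congr rfl fun p _ => ?_
  rw [lintegral_const_mul _ (measurable_one.indicator (hS p)), lintegral_indicator_one (hS p),
    Measure.restrict_apply (hS p)]

theorem Specified.setLIntegral_loopWeight {D : hexLattice.Subgraph} {n x : ℝ}
    {q : Config → ℝ≥0∞} (hq : Specified D n x q) {κ : Config} (hκ : IsLoopConfig κ)
    (hκD : ∀ e : hexLattice.edgeSet, (e : Sym2 HexVertex) ∉ D.edgeSet → κ e = false)
    {A : Set Config} (hA : MeasurableSet A) :
    ∫⁻ ω in xorConfig κ ⁻¹' A, loopWeight D n x (xorConfig κ ω) ∂atomic q =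
      ∫⁻ ω in A, loopWeight D n x (xorConfig κ ω) ∂atomic q := by
  rw [setLIntegral_atomic _ hA, setLIntegral_atomic _ ((continuous_xorConfig κ).measurable hA)]
  let σ : Config ≃ Config := ⟨xorConfig κ, xorConfig κ, xorConfig_self κ, xorConfig_self κ⟩
  rw [← σ.tsum_eq fun ω => q ω * (A.indicator 1 ω * loopWeight D n x (xorConfig κ ω))]
  refine tsum_congr fun ω => ?_
  have h1 : (xorConfig κ ⁻¹' A).indicator (1 : Config → ℝ≥0∞) ω = A.indicator 1 (σ ω) := rfl
  have h2 : xorConfig κ (σ ω) = ω := xorConfig_self κ ω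
  have h3 : xorConfig κ ω = σ ω := rfl
  rw [h1, h2, h3]
  -- This is detailed balance for toggling `κ`.
  have key : q ω * loopWeight D n x (σ ω) = q (σ ω) * loopWeight D n x ω := by
    by_cases hω : IsLoopConfig ω
    · have hω' : IsLoopConfig (σ ω) := isLoopConfig_xorConfig hκ hω
      rw [loopWeight_of_isLoopConfig hω, loopWeight_of_isLoopConfig hω']
      exact hq.ratio ω (σ ω) hω hω' fun e he => by simp [σ, xorConfig, hκD e he]
    · have h4 : q ω = 0 := by_contra fun h => hω (hq.loop _ h)
      have h5 : loopWeight D n x ω = 0 := Set.indicator_of_notMem hω _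
      rw [h4, h5, zero_mul, mul_zero]
  rw [mul_left_comm, key, mul_left_comm]

/-- Toggling the edges of `κ` preserves the limit measure, weighted by the weight of the toggled
configuration. -/
theorem setLIntegral_loopWeight_of_tendsto
    {n x : ℝ} (hn : 0 < n) (hx : 0 < x) {ξ : ℕ → Config}
    (hξ : ∀ k, IsLoopConfig (ξ k)) {φ : ℕ → ℕ} (hφ : StrictMono φ)
    {μ : ProbabilityMeasure Config}
    (hμ : Tendsto (fun j => recentredLaw hn hx (hξ (φ j)) (φ j)) atTop (𝓝 μ))
    {D : hexLattice.Subgraph} (hD : D.verts.Finite) {κ : Config} (hκ : IsLoopConfig κ)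
    (hκD : ∀ e : hexLattice.edgeSet, (e : Sym2 HexVertex) ∉ D.edgeSet → κ e = false)
    {A : Set Config} (hA : MeasurableSet A) :
    ∫⁻ ω in xorConfig κ ⁻¹' A, loopWeight D n x (xorConfig κ ω) ∂(μ : Measure Config) =
      ∫⁻ ω in A, loopWeight D n x (xorConfig κ ω) ∂(μ : Measure Config) := by
  have hκm := (continuous_xorConfig κ).measurable
  obtain ⟨M, hM, hWM⟩ := exists_loopWeight_le hD hn hx
  obtain ⟨r, hr, hdec⟩ := exists_specified_decomposition hD hn hx
  obtain ⟨s, F, hF, hsum⟩ := exists_loopWeight_eq_sum hD n x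
  have hloop := ae_isLoopConfig_of_tendsto hn hx hξ hμ
  -- Continuity is needed at the toggled configuration. Tolerance shows that toggling pulls null
  -- events back to null events, so it too has almost surely at most one bi-infinite path.
  have hgood : ∀ᵐ ω ∂(μ : Measure Config),
      {C : (toGraph (xorConfig κ ω)).ConnectedComponent |
        IsBiInfinitePath (xorConfig κ ω) C}.Subsingleton := by
    have h1 := ae_subsingleton_biInfinite hloop (isTranslationInvariant_of_tendsto hn hx hξ hφ hμ)
      (hexagonTolerant_of_tendsto hn hx hξ hφ hμ)
    obtain ⟨N, hN, hNm, hN0⟩ := exists_measurable_superset_of_null h1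
    obtain ⟨C, -, hC⟩ := xorConfig_tolerant_of_tendsto hn hx hξ hφ hμ hD hκ hκD
    have h2 := hC N hNm
    rw [hN0, mul_zero] at h2
    have h3 : (μ : Measure Config) (xorConfig κ ⁻¹' N) = 0 := le_antisymm h2 zero_le
    refine measure_mono_null (fun ω hω => ?_) h3
    exact hN (show xorConfig κ ω ∈ _ from hω)
  have hlim : ∀ A, IsClopen A → Tendsto
      (fun j => ∫⁻ ω in A, loopWeight D n x (xorConfig κ ω) ∂recentredMeasure n x (ξ (φ j)) (φ j))
      atTop (𝓝 (∫⁻ ω in A, loopWeight D n x (xorConfig κ ω) ∂(μ : Measure Config))) := by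
    intro A hA
    simp only [setLIntegral_loopWeight_xorConfig hD hsum κ]
    refine tendsto_finsetSum _ fun p _ => ENNReal.Tendsto.const_mul ?_ (Or.inr (hF p))
    refine tendsto_measure_of_eventually_mem_iff (L := {ω | IsLoopConfig ω}) hμ
      (fun j => ae_isLoopConfig_recentredMeasure hn hx (hξ (φ j)) (φ j)) ?_ hloop
    filter_upwards [hgood] with ω hω hωl
    have h1 := (continuous_xorConfig κ).continuousAt.eventually
      (eventually_exponents_eq hD (isLoopConfig_xorConfig hκ hωl) hω)
    have h2 : ∀ᶠ ω' in 𝓝 ω, (ω' ∈ A ↔ ω ∈ A) := by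
      by_cases h : ω ∈ A
      · filter_upwards [hA.isOpen.mem_nhds h] with ω' h'
        exact iff_of_true h' h
      · filter_upwards [hA.compl.isOpen.mem_nhds h] with ω' h'
        exact iff_of_false h' h
    filter_upwards [h1, h2] with ω' h1 h2 hl
    have h3 := isLoopConfig_xorConfig hκ hl
    have h4 := isLoopConfig_xorConfig hκ hωl
    refine and_congr ?_ h2
    change _ ∧ _ ↔ _ ∧ _
    rw [h1 h3]
    exact and_congr_left fun _ => iff_of_true h3 h4
  set m : Measure Config :=
    (μ : Measure Config).withDensity fun ω => loopWeight D n x (xorConfig κ ω) with hm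
  have hmfin : IsFiniteMeasure m := by
    refine isFiniteMeasure_withDensity (ne_top_of_le_ne_top hM ?_)
    refine (lintegral_mono fun ω => hWM (xorConfig κ ω)).trans ?_
    simp
  have hclopen : ∀ A, IsClopen A → m (xorConfig κ ⁻¹' A) ≤ m A := by
    intro A hA
    have hAm := hA.isOpen.measurableSet
    rw [hm, withDensity_apply _ hAm, withDensity_apply _ (hκm hAm)]
    have e1 := hlim _ (hA.preimage (continuous_xorConfig κ))
    have e2 := (hlim A hA).add
      (ENNReal.Tendsto.const_mul (hr.comp hφ.tendsto_atTop) (Or.inr hM))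
    rw [mul_zero, add_zero] at e2
    refine le_of_tendsto_of_tendsto' e1 e2 fun j => ?_
    obtain ⟨q, R, hq, hqR, hR⟩ := hdec (ξ (φ j)) (hξ _) (φ j)
    rw [hqR, Measure.restrict_add, lintegral_add_measure, Measure.restrict_add,
      lintegral_add_measure, hq.setLIntegral_loopWeight hκ hκD hAm]
    refine add_le_add le_self_add ?_
    refine (lintegral_mono fun ω => hWM (xorConfig κ ω)).trans ?_
    rw [setLIntegral_const]
    gcongr
    exact (measure_mono (Set.subset_univ _)).trans hR
  have hle : ∀ A, MeasurableSet A → m (xorConfig κ ⁻¹' A) ≤ m A := by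
    intro A hA
    have := le_const_mul_of_forall_isClopen (m₁ := m.map (xorConfig κ)) (m₂ := m)
      ENNReal.one_ne_top (fun A hA => ?_) hA
    · rwa [Measure.map_apply hκm hA, one_mul] at this
    · rw [Measure.map_apply hκm hA.isOpen.measurableSet, one_mul]
      exact hclopen A hA
  rw [← withDensity_apply _ hA, ← withDensity_apply _ (hκm hA), ← hm]
  -- Toggling is an involution, so the one-sided inequality for all events is an equality.
  refine le_antisymm (hle A hA) ?_
  have h1 := hle _ (hκm hA)
  have h2 : xorConfig κ ⁻¹' (xorConfig κ ⁻¹' A) = A := by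
    ext ω
    rw [Set.mem_preimage, Set.mem_preimage, xorConfig_self]
  rwa [h2] at h1

/-! ### The Gibbs property -/

theorem xorConfig_comm (κ ω : Config) : xorConfig κ ω = xorConfig ω κ :=
  funext fun _ => Bool.xor_comm _ _

theorem finite_supported {D : hexLattice.Subgraph} (hD : D.verts.Finite) :
    {κ : Config | AgreeOff D κ fun _ => false}.Finite := by
  have : Finite {e : hexLattice.edgeSet | (e : Sym2 HexVertex) ∈ D.edgeSet} := finite_edges hD
  refine Set.Finite.of_finite_image (f := fun ω : Config =>
    Set.domRestrict {e : hexLattice.edgeSet | (e : Sym2 HexVertex) ∈ D.edgeSet} ω)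
    (Set.toFinite _) ?_
  intro ω hω ω' hω' h
  funext e
  by_cases he : (e : Sym2 HexVertex) ∈ D.edgeSet
  · exact congrFun h ⟨e, he⟩
  · rw [hω e he, hω' e he]

/-- The configurations without edges outside `D`. -/
def supported {D : hexLattice.Subgraph} (hD : D.verts.Finite) : Finset Config :=
  (finite_supported hD).toFinset

theorem mem_supported {D : hexLattice.Subgraph} {hD : D.verts.Finite} {κ : Config} :
    κ ∈ supported hD ↔ AgreeOff D κ fun _ => false := by
  rw [supported, Set.Finite.mem_toFinset]
  rfl

theorem agreeOff_xorConfig_iff {D : hexLattice.Subgraph} {κ : Config} (ω : Config) :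
    AgreeOff D (xorConfig κ ω) ω ↔ AgreeOff D κ fun _ => false :=
  forall₂_congr fun e _ => by
    simp only [xorConfig]
    cases κ e <;> cases ω e <;> simp

/-- Writing configurations as differences from `ω` gives a finite index set that no longer depends
on `ω`, so sums and integrals can be exchanged. -/
theorem tsum_agreeOff {D : hexLattice.Subgraph} (hD : D.verts.Finite) (n x : ℝ) (ω : Config)
    (g : Config → ℝ≥0∞) :
    ∑' η, (loopConfigs D ω).indicator (weight D n x) η * g η =
      ∑ κ ∈ supported hD, loopWeight D n x (xorConfig κ ω) * g (xorConfig κ ω) := by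
  let σ : Config ≃ Config := ⟨xorConfig ω, xorConfig ω, xorConfig_self ω, xorConfig_self ω⟩
  rw [← σ.tsum_eq, tsum_eq_sum (s := supported hD)]
  · refine Finset.sum_congr rfl fun κ hκ => ?_
    have h1 : σ κ = xorConfig κ ω := xorConfig_comm _ _
    rw [h1]
    congr 1
    have h2 := (agreeOff_xorConfig_iff ω).2 (mem_supported.1 hκ)
    by_cases h : IsLoopConfig (xorConfig κ ω)
    · rw [Set.indicator_of_mem (mem_loopConfigs.2 ⟨h, h2⟩), loopWeight_of_isLoopConfig h]
    · rw [Set.indicator_of_notMem fun h' => h h'.1]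
      exact (Set.indicator_of_notMem h _).symm
  · intro κ hκ
    have h1 : σ κ = xorConfig κ ω := xorConfig_comm _ _
    rw [h1, Set.indicator_of_notMem, zero_mul]
    exact fun h => hκ (mem_supported.2 ((agreeOff_xorConfig_iff ω).1 h.2))

theorem partitionFn_eq_sum {D : hexLattice.Subgraph} (hD : D.verts.Finite) (n x : ℝ)
    (ω : Config) : partitionFn D n x ω = ∑ κ ∈ supported hD, loopWeight D n x (xorConfig κ ω) := by
  have h := tsum_agreeOff hD n x ω 1
  simp only [Pi.one_apply, mul_one] at h
  rw [partitionFn, tsum_subtype (loopConfigs D ω) (weight D n x), h]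

/-- The partition function does not change under toggling inside `D`; it is evaluated at the toggled
configuration so that each summand is a weight times one fixed function of `xorConfig κ ω`. -/
theorem loopMeasure_apply_eq_sum {D : hexLattice.Subgraph} (hD : D.verts.Finite) (n x : ℝ)
    (ω : Config) {A : Set Config} (hA : MeasurableSet A) :
    loopMeasure D n x ω A = ∑ κ ∈ supported hD,
      loopWeight D n x (xorConfig κ ω) *
        ((partitionFn D n x (xorConfig κ ω))⁻¹ * A.indicator 1 (xorConfig κ ω)) := by
  rw [← tsum_agreeOff hD n x ω fun η => (partitionFn D n x η)⁻¹ * A.indicator 1 η,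
    loopMeasure_eq_atomic, atomic_apply _ hA]
  refine tsum_congr fun η => ?_
  by_cases h : η ∈ loopConfigs D ω
  · rw [Set.indicator_of_mem h, Set.indicator_of_mem h, div_eq_mul_inv, mul_assoc,
      partitionFn_eq_of_agreeOff h.2]
  · simp [h]

theorem measurable_partitionFn {D : hexLattice.Subgraph} (hD : D.verts.Finite) (n x : ℝ) :
    Measurable (partitionFn D n x) := by
  rw [funext (partitionFn_eq_sum hD n x)]
  exact Finset.measurable_sum _ fun κ _ =>
    (measurable_loopWeight hD n x).comp (continuous_xorConfig κ).measurable

theorem measurable_loopMeasure_apply {D : hexLattice.Subgraph} (hD : D.verts.Finite) (n x : ℝ)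
    {A : Set Config} (hA : MeasurableSet A) : Measurable fun ω => loopMeasure D n x ω A := by
  simp only [loopMeasure_apply_eq_sum hD n x _ hA]
  refine Finset.measurable_sum _ fun κ _ => ?_
  have hκ := (continuous_xorConfig κ).measurable
  exact ((measurable_loopWeight hD n x).comp hκ).mul
    (((measurable_partitionFn hD n x).comp hκ).inv.mul ((measurable_one.indicator hA).comp hκ))

theorem measurable_loopMeasure_outside {D : hexLattice.Subgraph} (hD : D.verts.Finite) (n x : ℝ)
    {A : Set Config} (hA : MeasurableSet A) :
    Measurable[outsideSigma D] fun ω => loopMeasure D n x ω A := by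
  classical
  let O : Set hexLattice.edgeSet := {e | (e : Sym2 HexVertex) ∉ D.edgeSet}
  -- The values put inside `D` are irrelevant, as the measure depends on the boundary condition only
  -- off `D`; the extension need not be a loop configuration.
  let ext : (O → Bool) → Config := fun τ e => if h : e ∈ O then τ ⟨e, h⟩ else false
  have hext : Measurable ext := by
    refine measurable_pi_lambda _ fun e => ?_
    by_cases h : e ∈ O
    · simpa only [ext, h, dif_pos] using measurable_pi_apply _
    · simpa only [ext, h, dif_neg, not_false_eq_true] using measurable_const
  have h1 : (fun ω => loopMeasure D n x ω A) =
      (fun τ => loopMeasure D n x (ext τ) A) ∘ fun ω : Config => Set.domRestrict O ω := by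
    funext ω
    refine congrArg (fun m : Measure Config => m A) (loopMeasure_eq_of_agreeOff fun e he => ?_)
    have he' : e ∈ O := he
    simp [ext, he', Set.domRestrict]
  rw [h1]
  exact ((measurable_loopMeasure_apply hD n x hA).comp hext).comp (comap_measurable _)

theorem outsideSigma_le (D : hexLattice.Subgraph) : outsideSigma D ≤ MeasurableSpace.pi := by
  refine Measurable.comap_le ?_
  exact measurable_pi_lambda _ fun e => measurable_pi_apply _

theorem mem_iff_of_agreeOff {D : hexLattice.Subgraph} {B : Set Config}
    (hB : MeasurableSet[outsideSigma D] B) {ω ω' : Config} (h : AgreeOff D ω ω') :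
    ω ∈ B ↔ ω' ∈ B := by
  obtain ⟨T, -, rfl⟩ := hB
  have : (Set.domRestrict {e : hexLattice.edgeSet | (e : Sym2 HexVertex) ∉ D.edgeSet} ω) =
      Set.domRestrict {e : hexLattice.edgeSet | (e : Sym2 HexVertex) ∉ D.edgeSet} ω' :=
    funext fun e => h e.1 e.2
  rw [Set.mem_preimage, Set.mem_preimage, this]

theorem setLIntegral_loopMeasure_of_tendsto
    {n x : ℝ} (hn : 0 < n) (hx : 0 < x) {ξ : ℕ → Config}
    (hξ : ∀ k, IsLoopConfig (ξ k)) {φ : ℕ → ℕ} (hφ : StrictMono φ)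
    {μ : ProbabilityMeasure Config}
    (hμ : Tendsto (fun j => recentredLaw hn hx (hξ (φ j)) (φ j)) atTop (𝓝 μ))
    {D : hexLattice.Subgraph} (hD : D.verts.Finite) {A B : Set Config}
    (hA : MeasurableSet A) (hB : MeasurableSet[outsideSigma D] B) :
    ∫⁻ ω in B, loopMeasure D n x ω A ∂(μ : Measure Config) = (μ : Measure Config) (B ∩ A) := by
  have hBm : MeasurableSet B := outsideSigma_le D _ hB
  have hloop := ae_isLoopConfig_of_tendsto hn hx hξ hμ
  have hW := measurable_loopWeight hD n x
  have hZ := measurable_partitionFn hD n x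
  set H : Config → ℝ≥0∞ := fun ω =>
    B.indicator 1 ω * ((partitionFn D n x ω)⁻¹ * A.indicator 1 ω) with hH
  have hHm : Measurable H :=
    (measurable_one.indicator hBm).mul (hZ.inv.mul (measurable_one.indicator hA))
  -- The invariance of the weighted measure moves the toggling off `H`. If `κ` is not a loop
  -- configuration, then neither is its difference with a loop configuration, and both sides vanish.
  have key : ∀ κ ∈ supported hD,
      ∫⁻ ω, loopWeight D n x (xorConfig κ ω) * H (xorConfig κ ω) ∂(μ : Measure Config) =
        ∫⁻ ω, loopWeight D n x (xorConfig κ ω) * H ω ∂(μ : Measure Config) := by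
    intro κ hκ
    have hκm := (continuous_xorConfig κ).measurable
    by_cases hκl : IsLoopConfig κ
    · set m : Measure Config :=
        (μ : Measure Config).withDensity fun ω => loopWeight D n x (xorConfig κ ω) with hm
      have hmap : m.map (xorConfig κ) = m := by
        ext S hS
        rw [Measure.map_apply hκm hS, hm, withDensity_apply _ hS, withDensity_apply _ (hκm hS)]
        exact setLIntegral_loopWeight_of_tendsto hn hx hξ hφ hμ hD hκl (mem_supported.1 hκ) hS
      have e1 := lintegral_withDensity_eq_lintegral_mul (μ : Measure Config) (hW.comp hκm)
        (hHm.comp hκm)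
      have e2 := lintegral_withDensity_eq_lintegral_mul (μ : Measure Config) (hW.comp hκm) hHm
      have e3 := lintegral_map hHm hκm (μ := m)
      rw [hmap] at e3
      exact e1.symm.trans (e3.symm.trans e2)
    · refine lintegral_congr_ae ?_
      filter_upwards [hloop] with ω hω
      have : loopWeight D n x (xorConfig κ ω) = 0 := by
        refine Set.indicator_of_notMem (fun h => hκl ?_) _
        have h2 := isLoopConfig_xorConfig (κ := xorConfig κ ω) h hω
        rwa [xorConfig_comm, xorConfig_comm κ, xorConfig_self] at h2
      rw [this, zero_mul, zero_mul]
  rw [← lintegral_indicator hBm]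
  calc ∫⁻ ω, B.indicator (fun ω => loopMeasure D n x ω A) ω ∂(μ : Measure Config)
      = ∫⁻ ω, ∑ κ ∈ supported hD,
          loopWeight D n x (xorConfig κ ω) * H (xorConfig κ ω) ∂(μ : Measure Config) := by
        refine lintegral_congr fun ω => ?_
        have h1 : ∀ κ ∈ supported hD, B.indicator (1 : Config → ℝ≥0∞) (xorConfig κ ω) =
            B.indicator 1 ω := by
          intro κ hκ
          have := mem_iff_of_agreeOff hB ((agreeOff_xorConfig_iff ω).2 (mem_supported.1 hκ))
          by_cases h : ω ∈ B
          · rw [Set.indicator_of_mem h, Set.indicator_of_mem (this.2 h), Pi.one_apply, Pi.one_apply]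
          · rw [Set.indicator_of_notMem h, Set.indicator_of_notMem fun h' => h (this.1 h')]
        have h2 : ∀ κ ∈ supported hD, loopWeight D n x (xorConfig κ ω) * H (xorConfig κ ω) =
            B.indicator 1 ω * (loopWeight D n x (xorConfig κ ω) *
              ((partitionFn D n x (xorConfig κ ω))⁻¹ * A.indicator 1 (xorConfig κ ω))) := by
          intro κ hκ
          rw [← h1 κ hκ, mul_left_comm]
        rw [Finset.sum_congr rfl h2, ← Finset.mul_sum, ← loopMeasure_apply_eq_sum hD n x ω hA]
        by_cases h : ω ∈ B
        · simp [h]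
        · simp [h]
    _ = ∫⁻ ω, ∑ κ ∈ supported hD,
          loopWeight D n x (xorConfig κ ω) * H ω ∂(μ : Measure Config) := by
        have hm : ∀ κ : Config, Measurable (xorConfig κ) := fun κ =>
          (continuous_xorConfig κ).measurable
        have h1 : ∀ κ ∈ supported hD, Measurable fun ω =>
            loopWeight D n x (xorConfig κ ω) * H (xorConfig κ ω) := fun κ _ =>
          (hW.comp (hm κ)).mul (hHm.comp (hm κ))
        have h2 : ∀ κ ∈ supported hD, Measurable fun ω =>
            loopWeight D n x (xorConfig κ ω) * H ω := fun κ _ => (hW.comp (hm κ)).mul hHm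
        rw [lintegral_finsetSum _ h1, lintegral_finsetSum _ h2]
        exact Finset.sum_congr rfl key
    _ = ∫⁻ ω, (B ∩ A).indicator 1 ω ∂(μ : Measure Config) := by
        refine lintegral_congr_ae ?_
        filter_upwards [hloop] with ω hω
        have hprob := isProbabilityMeasure_loopMeasure hD hn hx hω
        have h0 : partitionFn D n x ω ≠ 0 := by
          intro h
          have h' := ENNReal.tsum_eq_zero.1 h ⟨ω, hω, fun _ _ => rfl⟩
          exact weight_ne_zero D hn hx ω h'
        have ht : partitionFn D n x ω ≠ ⊤ := by
          obtain ⟨M, hM, hWM⟩ := exists_loopWeight_le hD hn hx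
          rw [partitionFn_eq_sum hD]
          exact ENNReal.sum_ne_top.2 fun κ _ => ne_top_of_le_ne_top hM (hWM _)
        -- With the toggling gone from `H`, the weights sum to the partition function and cancel its
        -- inverse.
        rw [← Finset.sum_mul, ← partitionFn_eq_sum hD, hH, Set.inter_indicator_one, Pi.mul_apply,
          mul_left_comm, ← mul_assoc (partitionFn D n x ω), ENNReal.mul_inv_cancel h0 ht, one_mul]
    _ = _ := lintegral_indicator_one (hBm.inter hA)

theorem isGibbs_of_tendsto
    {n x : ℝ} (hn : 0 < n) (hx : 0 < x) {ξ : ℕ → Config}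
    (hξ : ∀ k, IsLoopConfig (ξ k)) {φ : ℕ → ℕ} (hφ : StrictMono φ)
    {μ : ProbabilityMeasure Config}
    (hμ : Tendsto (fun j => recentredLaw hn hx (hξ (φ j)) (φ j)) atTop (𝓝 μ)) :
    IsGibbs n x (μ : Measure Config) := by
  have hloop := ae_isLoopConfig_of_tendsto hn hx hξ hμ
  refine ⟨hloop, fun D hD A hA => ?_⟩
  have hf := measurable_loopMeasure_outside hD n x hA
  have hle1 : ∀ᵐ ω ∂(μ : Measure Config), loopMeasure D n x ω A ≤ 1 := by
    filter_upwards [hloop] with ω hω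
    have := isProbabilityMeasure_loopMeasure hD hn hx hω
    exact prob_le_one
  have hfm : Measurable fun ω => loopMeasure D n x ω A := hf.mono (outsideSigma_le D) le_rfl
  have hfin : ∫⁻ ω, loopMeasure D n x ω A ∂(μ : Measure Config) ≠ ⊤ := by
    refine ne_top_of_le_ne_top ENNReal.one_ne_top ((lintegral_mono_ae hle1).trans ?_)
    simp
  refine (ae_eq_condExp_of_forall_setIntegral_eq (outsideSigma_le D) ?_ ?_ ?_ ?_).symm
  · exact (integrable_const _).indicator hA
  · exact fun t _ _ => (integrable_toReal_of_lintegral_ne_top hfm.aemeasurable hfin).integrableOn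
  · intro t ht _
    have ht' := outsideSigma_le D _ ht
    simp_rw [measureReal_def]
    rw [integral_toReal hfm.aemeasurable, setLIntegral_loopMeasure_of_tendsto hn hx hξ hφ hμ hD hA ht,
      integral_indicator_const _ hA, measureReal_restrict_apply hA, smul_eq_mul, mul_one,
      Set.inter_comm, measureReal_def]
    refine ae_restrict_of_ae ?_
    filter_upwards [hle1] with ω hω
    exact hω.trans_lt ENNReal.one_lt_top
  · exact hf.ennreal_toReal.stronglyMeasurable.aestronglyMeasurable

end LoopON

end

theorem proposition4p12 (n x : ℝ) (hn : 0 < n) (hx : 0 < x)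
    (ξ : ℕ → LoopON.Config) (hξ : ∀ k, LoopON.IsLoopConfig (ξ k))
    (φ : ℕ → ℕ) (hφ : StrictMono φ) (μ : ProbabilityMeasure LoopON.Config)
    (hμ : Tendsto (fun j => LoopON.recentredLaw hn hx (hξ (φ j)) (φ j)) atTop (𝓝 μ)) :
    LoopON.IsGibbs n x (μ : Measure LoopON.Config) ∧
      LoopON.IsTranslationInvariant (μ : Measure LoopON.Config) ∧
      ∀ᵐ ω ∂(μ : Measure LoopON.Config),
        {C : (LoopON.toGraph ω).ConnectedComponent | LoopON.IsBiInfinitePath ω C}.Subsingleton :=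
  ⟨LoopON.isGibbs_of_tendsto hn hx hξ hφ hμ,
    LoopON.isTranslationInvariant_of_tendsto hn hx hξ hφ hμ,
    LoopON.ae_subsingleton_biInfinite (LoopON.ae_isLoopConfig_of_tendsto hn hx hξ hμ)
      (LoopON.isTranslationInvariant_of_tendsto hn hx hξ hφ hμ)
      (LoopON.hexagonTolerant_of_tendsto hn hx hξ hφ hμ)⟩
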